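/- **Conventions.** Let $\alpha=e^{i\pi/4}$ and $S=\mathrm{diag}(1,i)$. An *XS-stabilizer group* on a finite set of qubits is a subgroup $G$ of the group generated by $\alpha I$ and the single-qubit operators $X_q,S_q$, such that the space $\mathcal L_G$ of all vectors fixed by $G$ (its *XS-stabilizer code*) is nonzero. It is *regular* if $G\cap\langle\alpha I,S_q\rangle=G\cap\langle\alpha I,Z_q\rangle$, where $Z=S^2$. The triangular lattice has vertex set $\mathbb Z_L\times\mathbb Z_M$ with $L,M\neq1$ (where $\mathbb Z_0=\mathbb Z$, so that planes, cylinders and tori are included), oriented edges $v\to v+a$, $v\to v+b$, $v\to v+a+b$ with $a=(1,0)$, $b=(0,1)$, and triangles $v\to v+a\to v+a+b$ (positive) and $v\to v+b\to v+a+b$ (negative). The *first* and *second* edges of a triangle $u\to v\to w$ are $u\to v$ and $v\to w$. Around a vertex $s$ the edges are numbered as follows: $1,\dots,6$ join $s$ to $s-a$, $s-a-b$, $s-b$, $s+a$, $s+a+b$, $s+b$ (the first three point to $s$, the others away from $s$); $7,\dots,12$ join the outer ends of $1,2$; $2,3$; $3,4$; $4,5$; $5,6$; $6,1$. The triangles $1,\dots,6$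 around $s$ have (first, second) edges $(7,1),(8,3),(3,4),(4,10),(6,11),(1,6)$. A *patch* $R$ consists of a finite set of triangles, with their edges, and a set of vertices, all of whose six surrounding triangles belong to the patch; an example is a whole torus. For a 3-cocycle $\omega:(\mathbb Z_2^n)^3\to U(1)$, the model $D^\omega(\mathbb Z_2^n)$ on $R$ has a basis $|x\rangle$ with $x_e\in\mathbb Z_2^n$ for each edge $e$, and $H=-\sum_sA^\omega(s)-\sum_pB(p)$, where $B(p)$ projects onto $x_i+x_j+x_k=0$ for the edges $i,j,k$ of $p$, $A^\omega(s)=2^{-n}\sum_tA^\omega_t(s)$, and $A_t^\omega(s)$ maps $|x\rangle$ to $f^\omega_t(x)\,|x_1+t,\dots,x_6+t,x_7,\dots\rangle$ (all other edges unchanged) with $$f_t^\omega(x)=\frac{\omega(t,x_4,x_{10})\,\omega(x_3+t,t,x_4)\,\omega(x_8,x_3+t,t)}{\omega(t,x_6,x_{11})\,\omega(x_1+t,t,x_6)\,\omega(x_7,x_1+t,t)} .$$ The ground space is the eigenspace of $H$ for its smallest real eigenvalue; the gauge-invariant subspace is the common $+1$ eigenspace of all $B(p)$. Use one qubit $x_{e,\sigma}$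 for each edge $e$ and layer $\sigma\in\{1,\dots,n\}$, and one ancilla qubit for each triangle $p$ and pair of layers $\sigma<\tau$. Let $V$ be the isometry mapping $|x\rangle$ to the bit string of $x$, with the ancilla $(p,\sigma,\tau)$ in the state $x_{i,\sigma}\oplus x_{j,\tau}$, where $i,j$ are the first and second edges of $p$. Given operators $\mathcal A_\sigma(s)$, let $G(\mathcal A)$ be the group generated by all $\mathcal A_\sigma(s)$, by $Z_{i,\sigma}Z_{j,\sigma}Z_{k,\sigma}$ for the edges of each triangle, and by $Z_{i,\sigma}Z_{j,\tau}\tilde Z_{p,\sigma\tau}$ for each ancilla (operators with a tilde act on ancillas). Say that $\mathcal A$ *describes* the model if each $\mathcal A_\sigma(s)$ is in the Pauli-S group generated by $\alpha I$ and by $X_q,S_q$ for the qubits $q$ on the twelve edges and six triangles around $s$; $\mathcal A_\sigma(s)V=VA^\omega_{t}(s)$ on the gauge-invariant subspace, for $t$ the $\sigma$-th standard generator of $\mathbb Z_2^n$; $G(\mathcal A)$ is an XS-stabilizer group; and $V$ maps the ground space onto the XS-stabilizer code of $G(\mathcal A)$. **Theorem.** 1. For every $n$, all products $\omega_0$ of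 the functions $(-1)^{a_ib_ic_i}$, $(-1)^{a_ib_jc_j}$ ($i<j$), $(-1)^{a_ib_jc_k}$ ($i<j<k$) are 3-cocycles, and every 3-cocycle $\omega$ of $\mathbb Z_2^n$ with values in $U(1)$ is of the form $\omega=\omega_0\,d\beta$, with $d\beta(a,b,c)=\beta(b,c)\beta(a,b+c)/(\beta(a+b,c)\beta(a,b))$. For every such product $\omega_0$ and every patch there is an $\mathcal A$ that describes the model $D^{\omega_0}(\mathbb Z_2^n)$. For every 2-cochain $\beta:(\mathbb Z_2^n)^2\to U(1)$, the same code $\mathcal L_{G(\mathcal A)}$ is the image of the ground space of $D^{\omega_0\,d\beta}(\mathbb Z_2^n)$ under $V$ after the diagonal local unitary that multiplies $|x\rangle$ by $\beta(x_i,x_j)^{\pm1}$ for each triangle ($i,j$ its first and second edges, with sign $+$ for positive and $-$ for negative triangles). 2. For $n=1$ and $\omega=(-1)^{abc}$, the operators $X_1\cdots X_6Z_1\cdots Z_6S_7\cdots S_{12}$ (without ancillas) describe the model on every patch, and the unitary $\bigotimes_qS_q$ maps the code onto the ground space of the doubled semion model on the dual honeycomb lattice, i.e. the space stabilized by $ZZZ$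 at every honeycomb vertex (triangle) and by $-X_1\cdots X_6S_7\cdots S_{12}$ at every honeycomb face (vertex of the patch). 3. For $n=3$ and $\omega_7=(-1)^{a_1b_2c_3}$, the twisted quantum double algebra has an irreducible representation of dimension greater than one, i.e. the model supports non-Abelian anyons. Writing $\tilde O_{p,1},\tilde O_{p,2},\tilde O_{p,3}$ for the ancillas of the triangle $p$ and the pairs of layers $(1,2),(1,3),(2,3)$, the model is described on every patch by $$\begin{aligned} &X_{1,1}\cdots X_{6,1}\prod_{p\in\{3,4,5,6\}}\tilde X_{p,1}\tilde X_{p,2}\;S^3_{4,2}S^3_{10,3}S^3_{6,2}S^3_{11,3}\tilde S_{4,3}\tilde S_{5,3},\\ &X_{1,2}\cdots X_{6,2}\prod_{p\in\{1,2,3,6\}}\tilde X_{p,1}\prod_{p\in\{3,4,5,6\}}\tilde X_{p,3}\;S^3_{1,1}S^3_{3,1}S^3_{4,3}S^3_{6,3}\tilde S_{3,2}\tilde S_{6,2},\\ &X_{1,3}\cdots X_{6,3}\prod_{p\in\{1,2,3,6\}}\tilde X_{p,2}\tilde X_{p,3}\;S^3_{1,2}S^3_{3,2}S^3_{7,1}S^3_{8,1}\tilde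 S_{1,1}\tilde S_{2,1}. \end{aligned}$$ On every torus $\mathbb Z_L\times\mathbb Z_M$ with $L,M\ge2$ the XS-stabilizer group generated in this way is not regular. -/

import Mathlib

noncomputable section

namespace TQD

/-! ### Qubit systems and the Pauli-S group -/

/-- The invertible operator `|x⟩ ↦ φ x |π x⟩` on the Hilbert space with orthonormal basis
`|x⟩`, `x : C`; a vector is the function of its amplitudes. -/
def monomial {C : Type*} (π : Equiv.Perm C) (φ : C → Circle) : (C → ℂ) ≃ₗ[ℂ] (C → ℂ) where
  toFun ψ := fun y => (φ (π.symm y) : ℂ) * ψ (π.symm y)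
  invFun ψ := fun x => (φ x : ℂ)⁻¹ * ψ (π x)
  map_add' ψ χ := by
    funext y
    simp [mul_add]
  map_smul' c ψ := by
    funext y
    simp [mul_left_comm]
  left_inv ψ := by
    funext x
    simp
  right_inv ψ := by
    funext y
    simp

/-- Invertible operators on the qubits labelled by `Q` (computational basis `Q → ZMod 2`). -/
abbrev Op (Q : Type*) : Type _ := ((Q → ZMod 2) → ℂ) ≃ₗ[ℂ] ((Q → ZMod 2) → ℂ)

section Qubits

variable {Q : Type*} [DecidableEq Q]

/-- The scalar operator `α I` with `α = exp (iπ/4)`. -/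
def alphaOp : Op Q := monomial 1 (fun _ => Circle.exp (Real.pi / 4))

/-- Pauli `X` on the qubit `q`. -/
def opX (q : Q) : Op Q := monomial (Equiv.addRight (Pi.single q 1)) (fun _ => 1)

/-- `S = diag (1, i)` on the qubit `q`. -/
def opS (q : Q) : Op Q :=
  monomial 1 (fun x => if x q = 0 then 1 else Circle.exp (Real.pi / 2))

/-- `Z = S²` on the qubit `q`. -/
def opZ (q : Q) : Op Q := opS q ^ 2

/-- The operators of the Pauli-S group `⟨α I, X, S⟩^{⊗ Q}` that are supported on the qubits
in `K`. -/
def pauliS (K : Set Q) : Subgroup (Op Q) :=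
  Subgroup.closure ({alphaOp} ∪ opX '' K ∪ opS '' K)

/-- The group `⟨α I, S_q⟩` of diagonal elements of the Pauli-S group. -/
def diagonalOps (Q : Type*) [DecidableEq Q] : Subgroup (Op Q) :=
  Subgroup.closure ({alphaOp} ∪ Set.range opS)

/-- The group `⟨α I, Z_q⟩`. -/
def zOps (Q : Type*) [DecidableEq Q] : Subgroup (Op Q) :=
  Subgroup.closure ({alphaOp} ∪ Set.range opZ)

/-- The space of all vectors stabilized by `G`. -/
def code (G : Subgroup (Op Q)) : Submodule ℂ ((Q → ZMod 2) → ℂ) where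
  carrier := {ψ | ∀ g ∈ G, g ψ = ψ}
  add_mem' := by
    intro ψ χ hψ hχ g hg
    rw [map_add, hψ g hg, hχ g hg]
  zero_mem' := by
    intro g _
    exact map_zero g
  smul_mem' := by
    intro c ψ hψ g hg
    rw [map_smul, hψ g hg]

/-- An XS-stabilizer group: a subgroup of the Pauli-S group which stabilizes a nonzero state. -/
def IsXSGroup (G : Subgroup (Op Q)) : Prop := G ≤ pauliS Set.univ ∧ code G ≠ ⊥

/-- A regular XS-stabilizer group: every diagonal element is of Z-type, `G_D = G_Z`. -/
def IsRegularXSGroup (G : Subgroup (Op Q)) : Prop :=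
  IsXSGroup G ∧ G ⊓ diagonalOps Q = G ⊓ zOps Q

end Qubits

/-! ### Three-cocycles of `ℤ₂ⁿ` -/

/-- The group `ℤ₂ⁿ`, written additively. -/
abbrev Z2 (n : ℕ) : Type := Fin n → ZMod 2

/-- The sign `(-1)^z`. -/
def sgn (z : ZMod 2) : Circle := (-1) ^ z.val

/-- Inhomogeneous 3-cochains with values in `U(1)` (trivial action). -/
abbrev Cochain3 (n : ℕ) : Type := Z2 n → Z2 n → Z2 n → Circle

/-- The 3-cocycle condition. -/
def IsCocycle {n : ℕ} (ω : Cochain3 n) : Prop :=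
  ∀ a b c d, ω b c d * ω a (b + c) d * ω a b c = ω (a + b) c d * ω a b (c + d)

/-- The coboundary of a 2-cochain. -/
def coboundary {n : ℕ} (β : Z2 n → Z2 n → Circle) : Cochain3 n :=
  fun a b c => β b c * β a (b + c) / (β (a + b) c * β a b)

/-- Exponents of a product of the cocycles `(-1)^(aᵢbᵢcᵢ)`, `(-1)^(aᵢbⱼcⱼ)` (`i < j`) and
`(-1)^(aᵢbⱼcₖ)` (`i < j < k`). -/
structure TwistData (n : ℕ) where
  one : Fin n → ZMod 2
  two : Fin n → Fin n → ZMod 2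
  three : Fin n → Fin n → Fin n → ZMod 2

/-- The corresponding product cocycle. -/
def TwistData.cocycle {n : ℕ} (κ : TwistData n) : Cochain3 n := fun a b c =>
  sgn ((∑ i, κ.one i * (a i * b i * c i))
    + (∑ i, ∑ j, if i < j then κ.two i j * (a i * b j * c j) else 0)
    + ∑ i, ∑ j, ∑ k, if i < j ∧ j < k then κ.three i j k * (a i * b j * c k) else 0)

/-- `ω(a,b,c) = (-1)^(abc)` on `ℤ₂`. -/
def omegaSemion : Cochain3 1 := fun a b c => sgn (a 0 * b 0 * c 0)

/-- `ω₇(a,b,c) = (-1)^(a₁b₂c₃)` on `ℤ₂³`. -/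
def omegaSeven : Cochain3 3 := fun a b c => sgn (a 0 * b 1 * c 2)

/-! ### Anyons

The anyon types of `D^ω(G)` are the irreducible representations of the twisted quantum double
algebra; for `G = ℤ₂ⁿ` the latter has a basis `(g, x)` with product
`(g, x)(h, y) = δ_{g,h} θ_g(x,y) (g, x + y)`.  The quantum dimension of an anyon is the dimension
of the representation, and an anyon is non-Abelian if this is larger than one. -/

/-- `θ_g(x,y) = ω(g,x,y) ω(x,y,g) / ω(x,g,y)`. -/
def slant {n : ℕ} (ω : Cochain3 n) (g x y : Z2 n) : Circle :=
  ω g x y * ω x y g / ω x g y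

/-- `ρ` is a `d`-dimensional (unital) representation of the twisted quantum double algebra of a
normalized cocycle `ω`; its unit is `∑ g, (g, 0)`. -/
def IsDoubleRep {n d : ℕ} (ω : Cochain3 n) (ρ : Z2 n → Z2 n → Matrix (Fin d) (Fin d) ℂ) : Prop :=
  (∀ g h x y, ρ g x * ρ h y =
    if g = h then ((slant ω g x y : Circle) : ℂ) • ρ g (x + y) else 0) ∧
  ∑ g, ρ g 0 = 1

/-- There is an anyon type of quantum dimension larger than one. -/
def SupportsNonAbelianAnyons {n : ℕ} (ω : Cochain3 n) : Prop :=
  ∃ d : ℕ, 1 < d ∧ ∃ ρ : Z2 n → Z2 n → Matrix (Fin d) (Fin d) ℂ, IsDoubleRep ω ρ ∧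
    ∀ W : Submodule ℂ (Fin d → ℂ), (∀ g x, ∀ v ∈ W, (ρ g x).mulVec v ∈ W) → W = ⊥ ∨ W = ⊤

/-! ### The triangular lattice

The vertices form `ℤ_L × ℤ_M`, with `L = 0` or `M = 0` for an infinite direction.  Each vertex `v`
is the source of three oriented edges `(v, 0) : v → v + (1,0)`, `(v, 1) : v → v + (0,1)` and
`(v, 2) : v → v + (1,1)`.  There are two triangles per vertex, `(v, true)` with vertices
`v → v + (1,0) → v + (1,1)` and `(v, false)` with vertices `v → v + (0,1) → v + (1,1)`. -/

abbrev Vert (L M : ℕ) : Type := ZMod L × ZMod M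
abbrev Edge (L M : ℕ) : Type := Vert L M × Fin 3
abbrev Tri (L M : ℕ) : Type := Vert L M × Bool

section Lattice

variable {L M : ℕ}

/-- The first edge of a triangle with vertices `u → v → w`, namely `u → v`. -/
def Tri.fst (p : Tri L M) : Edge L M := (p.1, if p.2 then 0 else 1)

/-- The second edge `v → w`. -/
def Tri.snd (p : Tri L M) : Edge L M :=
  if p.2 then (p.1 + (1, 0), 1) else (p.1 + (0, 1), 0)

/-- The third edge `u → w`. -/
def Tri.thd (p : Tri L M) : Edge L M := (p.1, 2)

/-! The edges around a vertex `s`: counterclockwise, `e1`, …, `e6` are the edges at `s` (the first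
three point towards `s`, the others away from it), and `e7`, …, `e12` form the surrounding hexagon,
`e7` joining the outer ends of `e1` and `e2`, and so on. -/

def e1 (s : Vert L M) : Edge L M := (s - (1, 0), 0)
def e2 (s : Vert L M) : Edge L M := (s - (1, 1), 2)
def e3 (s : Vert L M) : Edge L M := (s - (0, 1), 1)
def e4 (s : Vert L M) : Edge L M := (s, 0)
def e5 (s : Vert L M) : Edge L M := (s, 2)
def e6 (s : Vert L M) : Edge L M := (s, 1)
def e7 (s : Vert L M) : Edge L M := (s - (1, 1), 1)
def e8 (s : Vert L M) : Edge L M := (s - (1, 1), 0)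
def e9 (s : Vert L M) : Edge L M := (s - (0, 1), 2)
def e10 (s : Vert L M) : Edge L M := (s + (1, 0), 1)
def e11 (s : Vert L M) : Edge L M := (s + (0, 1), 0)
def e12 (s : Vert L M) : Edge L M := (s - (1, 0), 2)

/-! The triangles around `s`, with edges (first, second, third) equal to `(e7, e1, e2)`,
`(e8, e3, e2)`, `(e3, e4, e9)`, `(e4, e10, e5)`, `(e6, e11, e5)`, `(e1, e6, e12)`. -/

def p1 (s : Vert L M) : Tri L M := (s - (1, 1), false)
def p2 (s : Vert L M) : Tri L M := (s - (1, 1), true)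
def p3 (s : Vert L M) : Tri L M := (s - (0, 1), false)
def p4 (s : Vert L M) : Tri L M := (s, true)
def p5 (s : Vert L M) : Tri L M := (s, false)
def p6 (s : Vert L M) : Tri L M := (s - (1, 0), true)

def star (s : Vert L M) : Finset (Edge L M) := {e1 s, e2 s, e3 s, e4 s, e5 s, e6 s}
def link (s : Vert L M) : Finset (Edge L M) := {e7 s, e8 s, e9 s, e10 s, e11 s, e12 s}
def starTris (s : Vert L M) : Finset (Tri L M) := {p1 s, p2 s, p3 s, p4 s, p5 s, p6 s}

end Lattice

/-- A finite piece of the triangular lattice: the triangles it consists of, and the (interior)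
vertices that carry a vertex term; all six triangles around these belong to the piece. -/
structure Patch (L M : ℕ) where
  tris : Finset (Tri L M)
  verts : Finset (Vert L M)
  starTris_subset : ∀ s ∈ verts, starTris s ⊆ tris

/-- The whole torus `ℤ_L × ℤ_M`. -/
def torus (L M : ℕ) [NeZero L] [NeZero M] : Patch L M where
  tris := Finset.univ
  verts := Finset.univ
  starTris_subset := fun _ _ => Finset.subset_univ _

section Model

variable {L M : ℕ} (R : Patch L M)

/-- The edges of the triangles of the patch. -/
def Patch.edges : Finset (Edge L M) := R.tris.biUnion fun p => {p.fst, p.snd, p.thd}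

/-- Basis configurations: an element of `ℤ₂ⁿ` on each edge. -/
abbrev Config (n : ℕ) : Type := {e // e ∈ R.edges} → Z2 n

variable {R} {n : ℕ}

/-- The value of a configuration on an edge (`0` on edges outside of the patch). -/
def Config.at (x : Config R n) (e : Edge L M) : Z2 n := if h : e ∈ R.edges then x ⟨e, h⟩ else 0

/-- The phase `f_t^ω(x)` of the vertex operator at `s`. -/
def phase (ω : Cochain3 n) (s : Vert L M) (t : Z2 n) (x : Config R n) : Circle :=
  (ω t (x.at (e4 s)) (x.at (e10 s)) * ω (x.at (e3 s) + t) t (x.at (e4 s))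
      * ω (x.at (e8 s)) (x.at (e3 s) + t) t)
    / (ω t (x.at (e6 s)) (x.at (e11 s)) * ω (x.at (e1 s) + t) t (x.at (e6 s))
      * ω (x.at (e7 s)) (x.at (e1 s) + t) t)

variable (R)

/-- `x₁, …, x₆ ↦ x₁ + t, …, x₆ + t` around the vertex `s`. -/
def flip (s : Vert L M) (t : Z2 n) : Equiv.Perm (Config R n) :=
  Equiv.addRight fun e => if e.1 ∈ star s then t else 0

/-- `A_t^ω(s)`, mapping `|x⟩` to `f_t^ω(x) |x₁ + t, …, x₆ + t, x₇, …⟩`. -/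
def vertexTerm (ω : Cochain3 n) (s : Vert L M) (t : Z2 n) :
    (Config R n → ℂ) ≃ₗ[ℂ] (Config R n → ℂ) :=
  monomial (flip R s t) (phase ω s t)

/-- `A^ω(s) = 2⁻ⁿ ∑ₜ A_t^ω(s)`. -/
def vertexOp (ω : Cochain3 n) (s : Vert L M) : Module.End ℂ (Config R n → ℂ) :=
  ((2 : ℂ) ^ n)⁻¹ • ∑ t : Z2 n, (vertexTerm R ω s t).toLinearMap

/-- `B(p)`, the projector onto `x_i + x_j + x_k = 0` for the edges `i, j, k` of `p`. -/
def triangleOp (n : ℕ) (p : Tri L M) : Module.End ℂ (Config R n → ℂ) where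
  toFun ψ := fun x => if x.at p.fst + x.at p.snd + x.at p.thd = 0 then ψ x else 0
  map_add' ψ χ := by
    funext x
    by_cases h : x.at p.fst + x.at p.snd + x.at p.thd = 0 <;> simp [h]
  map_smul' c ψ := by
    funext x
    by_cases h : x.at p.fst + x.at p.snd + x.at p.thd = 0 <;> simp [h]

/-- The Hamiltonian `H = - ∑ₛ A^ω(s) - ∑ₚ B(p)` of `D^ω(ℤ₂ⁿ)`. -/
def hamiltonian (ω : Cochain3 n) : Module.End ℂ (Config R n → ℂ) :=
  -(∑ s ∈ R.verts, vertexOp R ω s) - ∑ p ∈ R.tris, triangleOp R n p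

/-- The eigenspace of the smallest real eigenvalue. -/
def groundSpace {W : Type*} [AddCommGroup W] [Module ℂ W] (H : Module.End ℂ W) : Submodule ℂ W :=
  H.eigenspace ((sInf {E : ℝ | H.HasEigenvalue (E : ℂ)} : ℝ) : ℂ)

/-- The common `+1` eigenspace of all `B(p)`. -/
def gaugeInvariant (n : ℕ) : Submodule ℂ (Config R n → ℂ) :=
  ⨅ p ∈ R.tris, (triangleOp R n p).eigenspace 1

/-- The diagonal unitary multiplying `|x⟩` by one phase `β(x_i, x_j)^{±1}` per triangle, where
`i` and `j` are its first and second edges and the sign is its orientation. -/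
def cochainUnitary (β : Z2 n → Z2 n → Circle) : (Config R n → ℂ) ≃ₗ[ℂ] (Config R n → ℂ) :=
  monomial 1 fun x =>
    ∏ p ∈ R.tris, β (x.at p.fst) (x.at p.snd) ^ (if p.2 then (1 : ℤ) else -1)

/-! ### Qubits, ancillas and stabilizers -/

/-- Unordered pairs of distinct layers. -/
abbrev LayerPair (n : ℕ) : Type := {q : Fin n × Fin n // q.1 < q.2}

/-- One qubit per edge and layer, and one ancilla qubit per triangle and pair of layers. -/
abbrev Qubits (n : ℕ) : Type :=
  ({e // e ∈ R.edges} × Fin n) ⊕ ({p // p ∈ R.tris} × LayerPair n)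

instance : DecidableEq (Qubits R n) := instDecidableEqSum

/-- The bit string of a configuration: the qubit `(e, σ)` is `x_{e,σ}`, and the ancilla of the
triangle `p` for the layers `σ < τ` is `x_{i,σ} ⊕ x_{j,τ}`, where `i` and `j` are the first and
second edges of `p`. -/
def encode (x : Config R n) : Qubits R n → ZMod 2 :=
  Sum.elim (fun q => x q.1 q.2) (fun q => x.at q.1.1.fst q.2.1.1 + x.at q.1.1.snd q.2.1.2)

/-- The isometry `|x⟩ ↦ |encode x⟩` which couples the ancillas. -/
def couple (n : ℕ) : (Config R n → ℂ) →ₗ[ℂ] ((Qubits R n → ZMod 2) → ℂ) where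
  toFun ψ := fun z => ∑ x : Config R n, if encode R x = z then ψ x else 0
  map_add' ψ χ := by
    funext z
    simp only [Pi.add_apply, ← Finset.sum_add_distrib]
    refine Finset.sum_congr rfl fun x _ => ?_
    split_ifs <;> simp
  map_smul' c ψ := by
    funext z
    simp only [Pi.smul_apply, smul_eq_mul, RingHom.id_apply, Finset.mul_sum]
    refine Finset.sum_congr rfl fun x _ => ?_
    split_ifs <;> simp

/-- `X` on layer `σ` of the edge `e`. -/
def edgeX (e : Edge L M) (σ : Fin n) : Op (Qubits R n) :=
  if h : e ∈ R.edges then opX (Sum.inl (⟨e, h⟩, σ)) else 1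

/-- `S` on layer `σ` of the edge `e`. -/
def edgeS (e : Edge L M) (σ : Fin n) : Op (Qubits R n) :=
  if h : e ∈ R.edges then opS (Sum.inl (⟨e, h⟩, σ)) else 1

/-- `Z` on layer `σ` of the edge `e`. -/
def edgeZ (e : Edge L M) (σ : Fin n) : Op (Qubits R n) := edgeS R e σ ^ 2

/-- `X` on the ancilla of the triangle `p` for the pair of layers `y`. -/
def ancX (p : Tri L M) (y : LayerPair n) : Op (Qubits R n) :=
  if h : p ∈ R.tris then opX (Sum.inr (⟨p, h⟩, y)) else 1

/-- `S` on the ancilla of the triangle `p` for the pair of layers `y`. -/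
def ancS (p : Tri L M) (y : LayerPair n) : Op (Qubits R n) :=
  if h : p ∈ R.tris then opS (Sum.inr (⟨p, h⟩, y)) else 1

/-- `Z` on the ancilla of the triangle `p` for the pair of layers `y`. -/
def ancZ (p : Tri L M) (y : LayerPair n) : Op (Qubits R n) := ancS R p y ^ 2

/-- The qubits on the twelve edges and the six triangles around `s`. -/
def near (n : ℕ) (s : Vert L M) : Set (Qubits R n) :=
  {q | Sum.elim (fun q => q.1.1 ∈ star s ∪ link s) (fun q => q.1.1 ∈ starTris s) q}

/-- The group generated by `Z_{i,σ} Z_{j,σ} Z_{k,σ}` for all triangles and layers, the Z-type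
operators that couple the ancillas, and vertex stabilizers `𝒜 s σ` for all vertices `s` and the
standard generators of `ℤ₂ⁿ`, indexed by the layers `σ`. -/
def stabilizerGroup (𝒜 : Vert L M → Fin n → Op (Qubits R n)) : Subgroup (Op (Qubits R n)) :=
  Subgroup.closure
    ({g | ∃ p ∈ R.tris, ∃ σ : Fin n,
        g = edgeZ R p.fst σ * edgeZ R p.snd σ * edgeZ R p.thd σ} ∪
     {g | ∃ p ∈ R.tris, ∃ y : LayerPair n,
        g = edgeZ R p.fst y.1.1 * edgeZ R p.snd y.1.2 * ancZ R p y} ∪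
     {g | ∃ s ∈ R.verts, ∃ σ : Fin n, g = 𝒜 s σ})

/-- The vertex stabilizers `𝒜` describe the ground space of `D^ω(ℤ₂ⁿ)`: they are Pauli-S operators
supported around their vertices, they coincide with the vertex operators `A_t^ω(s)` on the
gauge-invariant subspace, and the XS-stabilizer code which they generate together with the
Z-type stabilizers is the ground space (coupled to the ancillas). -/
structure Describes (ω : Cochain3 n) (𝒜 : Vert L M → Fin n → Op (Qubits R n)) : Prop where
  mem_pauliS : ∀ s ∈ R.verts, ∀ σ, 𝒜 s σ ∈ pauliS (near R n s)
  coincide : ∀ s ∈ R.verts, ∀ σ, ∀ ψ ∈ gaugeInvariant R n,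
    𝒜 s σ (couple R n ψ) = couple R n (vertexTerm R ω s (Pi.single σ 1) ψ)
  isXSGroup : IsXSGroup (stabilizerGroup R 𝒜)
  map_groundSpace :
    (groundSpace (hamiltonian R ω)).map (couple R n) = code (stabilizerGroup R 𝒜)

/-! ### The doubled semion model -/

/-- `X₁ ⋯ X₆ Z₁ ⋯ Z₆ S₇ ⋯ S₁₂`. -/
def semionStabilizer (s : Vert L M) (_ : Fin 1) : Op (Qubits R 1) :=
  edgeX R (e1 s) 0 * edgeX R (e2 s) 0 * edgeX R (e3 s) 0 *
  edgeX R (e4 s) 0 * edgeX R (e5 s) 0 * edgeX R (e6 s) 0 *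
  edgeZ R (e1 s) 0 * edgeZ R (e2 s) 0 * edgeZ R (e3 s) 0 *
  edgeZ R (e4 s) 0 * edgeZ R (e5 s) 0 * edgeZ R (e6 s) 0 *
  edgeS R (e7 s) 0 * edgeS R (e8 s) 0 * edgeS R (e9 s) 0 *
  edgeS R (e10 s) 0 * edgeS R (e11 s) 0 * edgeS R (e12 s) 0

/-- The stabilizer group of the doubled semion model on the dual honeycomb lattice: `Z Z Z` at each
vertex (dual to a triangle), and, on each face (dual to a vertex), minus the product of `X` over
its six edges and of `S` over its six legs. -/
def doubledSemionGroup : Subgroup (Op (Qubits R 1)) :=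
  Subgroup.closure
    ({g | ∃ p ∈ R.tris, g = edgeZ R p.fst 0 * edgeZ R p.snd 0 * edgeZ R p.thd 0} ∪
     {g | ∃ s ∈ R.verts, g = alphaOp ^ 4 *
        (edgeX R (e1 s) 0 * edgeX R (e2 s) 0 * edgeX R (e3 s) 0 *
         edgeX R (e4 s) 0 * edgeX R (e5 s) 0 * edgeX R (e6 s) 0 *
         edgeS R (e7 s) 0 * edgeS R (e8 s) 0 * edgeS R (e9 s) 0 *
         edgeS R (e10 s) 0 * edgeS R (e11 s) 0 * edgeS R (e12 s) 0)})

/-- The local unitary `⊗ S` over all qubits. -/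
def allS {Q : Type*} [Fintype Q] : Op Q :=
  monomial 1 fun x => ∏ q, if x q = 0 then 1 else Circle.exp (Real.pi / 2)

/-! ### The `ω₇` model -/

/-- The three pairs of layers for `n = 3`: `(1,2)`, `(1,3)` and `(2,3)`. -/
def y1 : LayerPair 3 := ⟨(0, 1), by decide⟩
def y2 : LayerPair 3 := ⟨(0, 2), by decide⟩
def y3 : LayerPair 3 := ⟨(1, 2), by decide⟩

/-- `X` on layer `σ` of the six edges at `s`. -/
def starX (s : Vert L M) (σ : Fin n) : Op (Qubits R n) :=
  edgeX R (e1 s) σ * edgeX R (e2 s) σ * edgeX R (e3 s) σ *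
  edgeX R (e4 s) σ * edgeX R (e5 s) σ * edgeX R (e6 s) σ

/-- `X` on the ancillas whose first edge is incident to `s`. -/
def ancXfst (s : Vert L M) (y : LayerPair n) : Op (Qubits R n) :=
  ancX R (p3 s) y * ancX R (p4 s) y * ancX R (p5 s) y * ancX R (p6 s) y

/-- `X` on the ancillas whose second edge is incident to `s`. -/
def ancXsnd (s : Vert L M) (y : LayerPair n) : Op (Qubits R n) :=
  ancX R (p1 s) y * ancX R (p2 s) y * ancX R (p3 s) y * ancX R (p6 s) y

/-- The vertex stabilizers of the `ω₇` model for the generators `(1,0,0)`, `(0,1,0)`, `(0,0,1)`.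
The ancilla `X` operators flip each ancilla along with the qubits to which it is coupled. -/
def sevenStabilizer (s : Vert L M) : Fin 3 → Op (Qubits R 3) :=
  ![starX R s 0 * ancXfst R s y1 * ancXfst R s y2 *
      edgeS R (e4 s) 1 ^ 3 * edgeS R (e10 s) 2 ^ 3 *
      edgeS R (e6 s) 1 ^ 3 * edgeS R (e11 s) 2 ^ 3 *
      ancS R (p4 s) y3 * ancS R (p5 s) y3,
    starX R s 1 * ancXsnd R s y1 * ancXfst R s y3 *
      edgeS R (e1 s) 0 ^ 3 * edgeS R (e3 s) 0 ^ 3 *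
      edgeS R (e4 s) 2 ^ 3 * edgeS R (e6 s) 2 ^ 3 *
      ancS R (p3 s) y2 * ancS R (p6 s) y2,
    starX R s 2 * ancXsnd R s y2 * ancXsnd R s y3 *
      edgeS R (e1 s) 1 ^ 3 * edgeS R (e3 s) 1 ^ 3 *
      edgeS R (e7 s) 0 ^ 3 * edgeS R (e8 s) 0 ^ 3 *
      ancS R (p1 s) y1 * ancS R (p2 s) y1]

end Model

end TQD

end

/-! ### Third cohomology of elementary abelian 2-groups -/

namespace TQD

section Cohomology

variable {G H A : Type*} [AddCommGroup G] [AddCommGroup H] [AddCommGroup A]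

/-- The 3-cocycle condition, with coefficients written additively. -/
def IsAddCocycle (f : G → G → G → A) : Prop :=
  ∀ a b c d, f b c d + f a (b + c) d + f a b c = f (a + b) c d + f a b (c + d)

/-- The coboundary of a 2-cochain, with coefficients written additively. -/
def addCoboundary (β : G → G → A) : G → G → G → A :=
  fun a b c => β b c + β a (b + c) - (β (a + b) c + β a b)

lemma IsAddCocycle.sub_addCoboundary {f : G → G → G → A} (hf : IsAddCocycle f) (β : G → G → A) :
    IsAddCocycle (f - addCoboundary β) := by
  intro a b c d
  have h := hf a b c d
  simp only [Pi.sub_apply, addCoboundary, ← add_assoc]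
  linear_combination (norm := abel) h

/-- A cochain is normalized in its middle argument. -/
def IsNormalized (f : G → G → G → A) : Prop := ∀ a c, f a 0 c = 0

lemma IsNormalized.sub_addCoboundary {f : G → G → G → A} (hf : IsNormalized f) {β : G → G → A}
    (hl : ∀ g, β 0 g = 0) (hr : ∀ g, β g 0 = 0) : IsNormalized (f - addCoboundary β) := by
  intro a c
  simp [addCoboundary, hf a c, hl, hr]

lemma IsAddCocycle.zero_left {f : G → G → G → A} (hf : IsAddCocycle f) (hn : IsNormalized f)
    (a b : G) : f 0 a b = 0 := by
  have h := hf 0 0 a b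
  simpa [hn 0 _] using h

lemma IsAddCocycle.zero_right {f : G → G → G → A} (hf : IsAddCocycle f) (hn : IsNormalized f)
    (a b : G) : f a b 0 = 0 := by
  have h := hf a b 0 0
  simpa [hn _ 0] using h

/-- Every cocycle is cohomologous to a normalized one, by a coboundary which is trivial on every
subgroup on which the cocycle is trivial. -/
lemma IsAddCocycle.exists_isNormalized {f : ZMod 2 × H → ZMod 2 × H → ZMod 2 × H → A}
    (hf : IsAddCocycle f) (hH : ∀ h k l : H, f (0, h) (0, k) (0, l) = 0) :
    ∃ β, IsNormalized (f - addCoboundary β) ∧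
      ∀ h k l : H, (f - addCoboundary β) (0, h) (0, k) (0, l) = 0 := by
  classical
  have h0 : f 0 0 0 = 0 := hH 0 0 0
  refine ⟨fun a b => if a = 0 then f 0 0 b else if b = 0 then - f a 0 0 else 0, ?_, ?_⟩
  · intro a c
    have h1 := hf a 0 0 c
    simp only [add_zero, zero_add] at h1
    simp only [Pi.sub_apply, addCoboundary, if_true, add_zero, zero_add]
    by_cases ha : a = 0
    · subst ha; simp [h0]
    · simp only [ha, if_false]
      linear_combination (norm := abel) -h1
  · intro h k l
    have e : (0 : ZMod 2 × H) = (0, 0) := rfl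
    simp only [Pi.sub_apply, addCoboundary, e, hH, Prod.mk_add_mk, add_zero]
    simp

/-- A 3-cocycle on `ℤ₂ × H`, trivial on `H`, is cohomologous to one which is trivial whenever its
first argument is in `H`. -/
lemma IsAddCocycle.exists_trivial_first {f : ZMod 2 × H → ZMod 2 × H → ZMod 2 × H → A}
    (hf : IsAddCocycle f) (hn : IsNormalized f)
    (hH : ∀ h k l : H, f (0, h) (0, k) (0, l) = 0) :
    ∃ β, IsNormalized (f - addCoboundary β) ∧
      ∀ (h : H) g g', (f - addCoboundary β) (0, h) g g' = 0 := by
  have two : (1 : ZMod 2) + 1 = 0 := by decide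
  have cases2 : ∀ a : ZMod 2, a = 0 ∨ a = 1 := by decide
  have hz := hf.zero_left hn
  have hr := hf.zero_right hn
  let β₁ : ZMod 2 × H → ZMod 2 × H → A := fun g g' =>
    if g.1 = 0 ∧ g'.1 = 1 then f g (0, g'.2) (1, 0) else 0
  obtain ⟨f₁, hf₁⟩ : ∃ f₁, f₁ = f - addCoboundary β₁ := ⟨_, rfl⟩
  have c₁ : IsAddCocycle f₁ := hf₁ ▸ hf.sub_addCoboundary β₁
  have n₁ : IsNormalized f₁ := by
    rw [hf₁]
    refine hn.sub_addCoboundary ?_ ?_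
    · intro g
      simp only [β₁]
      split_ifs
      · exact hz _ _
      · rfl
    · intro g
      simp [β₁]
  have t₁ : ∀ h k l : H, f₁ (0, h) (0, k) (0, l) = 0 := by
    intro h k l
    simp [hf₁, addCoboundary, β₁, hH]
  have u₁ : ∀ h k : H, f₁ (0, h) (0, k) (1, 0) = 0 := by
    intro h k
    have e : ∀ k : H, f (0, k) (0, 0) (1, 0) = 0 := fun _ => hn _ _
    simp [hf₁, addCoboundary, β₁, e]
  have v₁ : ∀ (h k : H) g, f₁ (0, h) (0, k) g = 0 := by
    rintro h k ⟨a, l⟩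
    rcases cases2 a with rfl | rfl
    · exact t₁ h k l
    · have e := c₁ (0, h) (0, k) (0, l) (1, 0)
      simpa [u₁, t₁] using e.symm
  let β₂ : ZMod 2 × H → ZMod 2 × H → A := fun g g' =>
    if g.1 = 1 then - f₁ (0, g.2) (1, 0) g' else 0
  obtain ⟨f₂, hf₂⟩ : ∃ f₂, f₂ = f₁ - addCoboundary β₂ := ⟨_, rfl⟩
  have c₂ : IsAddCocycle f₂ := hf₂ ▸ c₁.sub_addCoboundary β₂
  have n₂ : IsNormalized f₂ := by
    rw [hf₂]
    refine n₁.sub_addCoboundary ?_ ?_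
    · intro g
      simp [β₂]
    · intro g
      simp [β₂, c₁.zero_right n₁]
  have t₂ : ∀ (h k : H) g, f₂ (0, h) (0, k) g = 0 := by
    intro h k g
    simp [hf₂, addCoboundary, β₂, v₁]
  have u₂ : ∀ (h : H) g, f₂ (0, h) (1, 0) g = 0 := by
    intro h g
    have e : f₁ (0, 0) (1, 0) g = 0 := c₁.zero_left n₁ _ _
    simp [hf₂, addCoboundary, β₂, e]
  refine ⟨β₁ + β₂, ?_⟩
  have e : f - addCoboundary (β₁ + β₂) = f₂ := by
    funext a b c
    simp only [hf₂, hf₁, Pi.sub_apply, addCoboundary, Pi.add_apply]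
    abel
  rw [e]
  refine ⟨n₂, ?_⟩
  rintro h ⟨a, k⟩ g
  rcases cases2 a with rfl | rfl
  · exact t₂ h k g
  · have e := c₂ (0, h) (0, k) (1, 0) g
    simpa [u₂, t₂] using e

/-- A 3-cocycle on `ℤ₂ × H` which is trivial whenever its first argument is in `H` is cohomologous
to the product of a character of `ℤ₂` and a 2-cocycle whose coefficients have order two. -/
lemma IsAddCocycle.exists_normalForm (hdiv : ∀ a : A, ∃ b, b + b = a)
    {f : ZMod 2 × H → ZMod 2 × H → ZMod 2 × H → A}
    (hf : IsAddCocycle f) (hn : IsNormalized f) (h0 : ∀ (h : H) g g', f (0, h) g g' = 0) :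
    ∃ (β : ZMod 2 × H → ZMod 2 × H → A) (τ : A) (μ : H → H → A), τ + τ = 0 ∧
      (∀ h k, μ h k + μ h k = 0) ∧ (∀ h, μ 0 h = 0) ∧ (∀ h, μ h 0 = 0) ∧
      (∀ h k l, μ (h + k) l + μ h k = μ k l + μ h (k + l)) ∧
      (∀ h g g', (f - addCoboundary β) (0, h) g g' = 0) ∧
      ∀ h k l b c, (f - addCoboundary β) (1, h) (b, k) (c, l) =
        μ k l + if b = 1 ∧ c = 1 then τ else 0 := by
  classical
  have two : (1 : ZMod 2) + 1 = 0 := by decide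
  have cases2 : ∀ a : ZMod 2, a = 0 ∨ a = 1 := by decide
  -- gauge transformations which preserve the assumptions
  have gauge : ∀ γ : ZMod 2 × H → A, γ 0 = 0 →
      IsNormalized (f - addCoboundary fun a b => if a.1 = 1 then γ b else 0) ∧
      ∀ (h : H) g g',
        (f - addCoboundary fun a b => if a.1 = 1 then γ b else 0) (0, h) g g' = 0 := by
    intro γ hγ
    refine ⟨hn.sub_addCoboundary (by simp) (by simp [hγ]), ?_⟩
    rintro h ⟨a, k⟩ g'
    simp [addCoboundary, h0]
  -- the twisted 2-cocycle obtained from a cocycle which satisfies the assumptions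
  have twisted : ∀ F : ZMod 2 × H → ZMod 2 × H → ZMod 2 × H → A, IsAddCocycle F →
      (∀ (h : H) g g', F (0, h) g g' = 0) →
      (∀ h g g', F (1, h) g g' = F (1, 0) g g') ∧
      (∀ h c d, F (1, 0) ((0, h) + c) d + F (1, 0) (0, h) c
        = F (1, 0) c d + F (1, 0) (0, h) (c + d)) ∧
      (∀ h c d, F (1, 0) c d + F (1, 0) ((1, h) + c) d + F (1, 0) (1, h) c
        = F (1, 0) (1, h) (c + d)) := by
    intro F hF hF0
    have hs : ∀ h g g', F (1, h) g g' = F (1, 0) g g' := by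
      intro h g g'
      have e := hF (0, h) (1, 0) g g'
      simpa [hF0] using e.symm
    refine ⟨hs, ?_, ?_⟩
    · intro h c d
      have e := hF (1, 0) (0, h) c d
      simpa [hF0, hs h] using e
    · intro h c d
      have e := hF (1, 0) (1, h) c d
      simpa [hF0, hs h, two] using e
  obtain ⟨ν, hν⟩ : ∃ ν : H → A, ν 0 = 0 ∧ ∀ h, ν h + ν h =
      f (1, 0) (0, h) (1, 0) - f (1, 0) (1, 0) (0, h) := by
    choose s hs using hdiv
    refine ⟨fun h => if h = 0 then 0 else
      s (f (1, 0) (0, h) (1, 0) - f (1, 0) (1, 0) (0, h)), by simp, fun h => ?_⟩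
    by_cases hh : h = 0
    · subst hh
      have e1 : f (1, 0) (0, 0) (1, 0) = 0 := hn _ _
      have e2 : f (1, 0) (1, 0) (0, 0) = 0 := hf.zero_right hn _ _
      simp [e1, e2]
    · simp [hh, hs]
  let γ : ZMod 2 × H → A := fun g => if g.1 = 0 then - ν g.2 else f (1, 0) (1, 0) (0, g.2) + ν g.2
  have hγ : γ 0 = 0 := by simp [γ, hν.1]
  obtain ⟨n', h0'⟩ := gauge γ hγ
  let β : ZMod 2 × H → ZMod 2 × H → A := fun a b => if a.1 = 1 then γ b else 0
  obtain ⟨F, hF⟩ : ∃ F, F = f - addCoboundary β := ⟨_, rfl⟩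
  have cF : IsAddCocycle F := hF ▸ hf.sub_addCoboundary β
  replace n' : IsNormalized F := hF ▸ n'
  replace h0' : ∀ (h : H) g g', F (0, h) g g' = 0 := hF ▸ h0'
  have hl := fun g g' => cF.zero_left n' g g'
  have hr : ∀ g g', F g g' (0, 0) = 0 := fun g g' => cF.zero_right n' g g'
  have hm : ∀ g g', F g (0, 0) g' = 0 := n'
  have f00 : f (1, 0) (1, 0) (0, 0) = 0 := hf.zero_right hn _ _
  obtain ⟨hs, T0, T1⟩ := twisted F cF h0'
  have zh : ∀ h : H, F (1, 0) (1, 0) (0, h) = 0 := by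
    intro h
    simp [hF, addCoboundary, β, γ, two, f00, hν.1]
  have hz : ∀ h : H, F (1, 0) (0, h) (1, 0) = 0 := by
    intro h
    simp only [hF, addCoboundary, β, γ, Pi.sub_apply]
    simp only [Prod.mk_add_mk, add_zero, zero_add, if_true, zero_ne_one, one_ne_zero, if_false,
      hν.1, f00]
    linear_combination (norm := abel) - hν.2 h
  have e1 : ∀ h k : H, F (1, 0) (1, h) (0, k) = - F (1, 0) (0, h) (0, k) := by
    intro h k
    have e := T1 0 (0, h) (0, k)
    simp only [Prod.mk_add_mk, add_zero, zero_add, zh] at e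
    linear_combination (norm := abel) e
  have e2 : ∀ h : H, F (1, 0) (1, 0) (1, h) = F (1, 0) (1, 0) (1, 0) := by
    intro h
    have e := T1 0 (1, 0) (0, h)
    simp only [Prod.mk_add_mk, add_zero, zero_add, zh, two, hm] at e
    exact e.symm
  have e3 : F (1, 0) (1, 0) (1, 0) + F (1, 0) (1, 0) (1, 0) = 0 := by
    have e := T1 0 (1, 0) (1, 0)
    simpa only [Prod.mk_add_mk, add_zero, zero_add, two, hm, hr] using e
  have e4 : ∀ h k : H, F (1, 0) (0, h) (1, k) = F (1, 0) (0, h) (0, k) := by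
    intro h k
    have e := T0 h (0, k) (1, 0)
    simp only [Prod.mk_add_mk, add_zero, zero_add, hz] at e
    exact e.symm
  have e5 : ∀ h k : H, F (1, 0) (0, h) (0, k) + F (1, 0) (0, h) (0, k) = 0 := by
    intro h k
    have e := T0 h (1, 0) (0, k)
    simp only [Prod.mk_add_mk, add_zero, zero_add, hz, zh, e1, e4] at e
    linear_combination (norm := abel) -e
  have e6 : ∀ h k : H, F (1, 0) (1, h) (1, k)
      = F (1, 0) (0, h) (0, k) + F (1, 0) (1, 0) (1, 0) := by
    intro h k
    have e := T1 0 (0, h) (1, k)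
    simp only [Prod.mk_add_mk, add_zero, zero_add, zh, e2, e4] at e
    linear_combination (norm := abel) e - e5 h k
  refine ⟨β, F (1, 0) (1, 0) (1, 0), fun h k => F (1, 0) (0, h) (0, k), e3, e5,
    fun h => hm _ _, fun h => hr _ _, ?_, ?_, ?_⟩
  · intro h k l
    have e := T0 h (0, k) (0, l)
    simpa only [Prod.mk_add_mk, add_zero] using e
  · rw [← hF]
    exact h0'
  · intro h k l b c
    rw [← hF, hs h]
    rcases cases2 b with rfl | rfl <;> rcases cases2 c with rfl | rfl
    · simp
    · simp [e4]
    · simp only [e1, zero_ne_one, and_false, if_false, add_zero]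
      linear_combination (norm := abel) - e5 k l
    · simp only [and_self, if_true]
      exact e6 k l

end Cohomology

end TQD

namespace TQD

section SecondCohomology

/-- A normalized 2-cocycle with values in `ℤ₂`. -/
structure IsTwoCocycle {H : Type*} [AddCommGroup H] (m : H → H → ZMod 2) : Prop where
  zero_left : ∀ h, m 0 h = 0
  zero_right : ∀ h, m h 0 = 0
  assoc : ∀ h k l, m (h + k) l + m h k = m k l + m h (k + l)

variable {H : Type*} [AddCommGroup H]

lemma IsTwoCocycle.commutator_add_left {m : H → H → ZMod 2} (hm : IsTwoCocycle m) (h k l : H) :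
    m (h + k) l + m l (h + k) = m h l + m l h + (m k l + m l k) := by
  have e1 := hm.assoc h k l
  have e2 := hm.assoc l h k
  have e3 := hm.assoc h l k
  rw [add_comm l h] at e2
  rw [add_comm l k] at e3
  grind

/-- The extension of `H` by `ℤ₂` defined by a symmetric 2-cocycle. -/
structure Extension (m : H → H → ZMod 2) where
  fib : ZMod 2
  base : H

/-- The abelian group structure on the extension defined by a symmetric 2-cocycle. -/
abbrev extensionGroup (m : H → H → ZMod 2) (hm : IsTwoCocycle m) (hs : ∀ h k, m h k = m k h) :
    AddCommGroup (Extension m) where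
  add x y := ⟨x.fib + y.fib + m x.base y.base, x.base + y.base⟩
  zero := ⟨0, 0⟩
  neg x := ⟨x.fib + m x.base (-x.base), -x.base⟩
  nsmul := @nsmulRec _ ⟨⟨0, 0⟩⟩ ⟨fun x y => ⟨x.fib + y.fib + m x.base y.base, x.base + y.base⟩⟩
  zsmul := @zsmulRec _ ⟨⟨0, 0⟩⟩ ⟨fun x y => ⟨x.fib + y.fib + m x.base y.base, x.base + y.base⟩⟩
    ⟨fun x => ⟨x.fib + m x.base (-x.base), -x.base⟩⟩
    (@nsmulRec _ ⟨⟨0, 0⟩⟩ ⟨fun x y => ⟨x.fib + y.fib + m x.base y.base, x.base + y.base⟩⟩)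
  add_assoc := by
    rintro ⟨a, h⟩ ⟨b, k⟩ ⟨c, l⟩
    change Extension.mk (a + b + m h k + c + m (h + k) l) (h + k + l)
      = Extension.mk (a + (b + c + m k l) + m h (k + l)) (h + (k + l))
    rw [add_assoc h, Extension.mk.injEq]
    exact ⟨by linear_combination hm.assoc h k l, rfl⟩
  zero_add := by
    rintro ⟨a, h⟩
    change Extension.mk (0 + a + m 0 h) (0 + h) = Extension.mk a h
    simp [hm.zero_left]
  add_zero := by
    rintro ⟨a, h⟩
    change Extension.mk (a + 0 + m h 0) (h + 0) = Extension.mk a h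
    simp [hm.zero_right]
  neg_add_cancel := by
    rintro ⟨a, h⟩
    change Extension.mk _ _ = Extension.mk _ _
    congr 1
    · simp only [hs (-h) h]
      grind
    · exact neg_add_cancel _
  add_comm := by
    rintro ⟨a, h⟩ ⟨b, k⟩
    change Extension.mk _ _ = Extension.mk _ _
    congr 1
    · simp only [hs h k]
      ring
    · exact add_comm _ _

/-- A symmetric 2-cocycle which vanishes on the diagonal is a coboundary. -/
lemma IsTwoCocycle.exists_coboundary [Module (ZMod 2) H] {m : H → H → ZMod 2}
    (hm : IsTwoCocycle m) (hs : ∀ h k, m h k = m k h) (hd : ∀ h, m h h = 0) :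
    ∃ ν : H → ZMod 2, ∀ h k, m h k = ν (h + k) + ν h + ν k := by
  let := extensionGroup m hm hs
  have hadd : ∀ x y : Extension m,
    x + y = ⟨x.fib + y.fib + m x.base y.base, x.base + y.base⟩ := fun _ _ => rfl
  have hz : (0 : Extension m) = ⟨0, 0⟩ := rfl
  let : Module (ZMod 2) (Extension m) := AddCommGroup.zmodModule (n := 2) (by
    rintro ⟨a, h⟩
    have : h + h = 0 := by
      rw [← two_smul (ZMod 2), show (2 : ZMod 2) = 0 from rfl, zero_smul]
    rw [two_nsmul, hadd, hz]
    simp [hd, this, CharTwo.add_self_eq_zero])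
  let π : Extension m →ₗ[ZMod 2] H := AddMonoidHom.toZModLinearMap 2
    { toFun := Extension.base
      map_zero' := rfl
      map_add' := fun _ _ => rfl }
  have hπ : Function.Surjective π := fun h => ⟨⟨0, h⟩, rfl⟩
  obtain ⟨s, hsec⟩ := π.exists_rightInverse_of_surjective (LinearMap.range_eq_top.2 hπ)
  have hb : ∀ h, (s h).base = h := fun h => LinearMap.congr_fun hsec h
  refine ⟨fun h => (s h).fib, fun h k => ?_⟩
  have e := congrArg Extension.fib (s.map_add h k)
  rw [hadd] at e
  simp only [hb] at e
  grind

/-- The restriction of a 2-cocycle to the diagonal is additive if the cocycle is symmetric. -/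
lemma IsTwoCocycle.diagonal_add [Module (ZMod 2) H] {m : H → H → ZMod 2}
    (hm : IsTwoCocycle m) (hs : ∀ h k, m h k = m k h) (h k : H) :
    m (h + k) (h + k) = m h h + m k k := by
  have two : ∀ h : H, h + h = 0 := fun h => by
    rw [← two_smul (ZMod 2), show (2 : ZMod 2) = 0 from rfl, zero_smul]
  have e1 := hm.assoc h k (h + k)
  have e2 := hm.assoc k k h
  rw [show k + (h + k) = h by rw [add_left_comm, two, add_zero]] at e1
  rw [two, hm.zero_left, add_comm k h] at e2
  have e3 := hs h k
  grind

lemma eq_zero_of_single {n : ℕ} {B : Type*} [AddCommMonoid B] (q : Z2 n →+ B)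
    (h : ∀ i, q (Pi.single i 1) = 0) : q = 0 := by
  refine AddMonoidHom.ext fun x => ?_
  have e : ∑ i, Pi.single i (x i) = x := Finset.univ_sum_single x
  rw [← e, map_sum]
  refine Finset.sum_eq_zero fun i _ => ?_
  rcases (by decide : ∀ a : ZMod 2, a = 0 ∨ a = 1) (x i) with e | e <;> simp [e, h]

/-- Every normalized 2-cocycle of `ℤ₂ⁿ` with values in `ℤ₂` is the sum of a bilinear form and a
coboundary. -/
lemma IsTwoCocycle.exists_bilinear {n : ℕ} {m : Z2 n → Z2 n → ZMod 2} (hm : IsTwoCocycle m) :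
    ∃ (c : Fin n → Fin n → ZMod 2) (ν : Z2 n → ZMod 2), ∀ h k,
      m h k = (∑ i, ∑ j, if i ≤ j then c i j * (h i * k j) else 0) + (ν (h + k) + ν h + ν k) := by
  let c : Fin n → Fin n → ZMod 2 := fun i j =>
    if i = j then m (Pi.single i 1) (Pi.single i 1)
    else m (Pi.single i 1) (Pi.single j 1) + m (Pi.single j 1) (Pi.single i 1)
  let u : Z2 n → Z2 n → ZMod 2 := fun h k => ∑ i, ∑ j, if i ≤ j then c i j * (h i * k j) else 0
  have ul : ∀ h h' k, u (h + h') k = u h k + u h' k := by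
    intro h h' k
    simp only [u, ← Finset.sum_add_distrib]
    refine Finset.sum_congr rfl fun i _ => Finset.sum_congr rfl fun j _ => ?_
    split_ifs
    · simp only [Pi.add_apply]; ring
    · simp
  have ur : ∀ h k k', u h (k + k') = u h k + u h k' := by
    intro h k k'
    simp only [u, ← Finset.sum_add_distrib]
    refine Finset.sum_congr rfl fun i _ => Finset.sum_congr rfl fun j _ => ?_
    split_ifs
    · simp only [Pi.add_apply]; ring
    · simp
  have us : ∀ i j, u (Pi.single i 1) (Pi.single j 1) = if i ≤ j then c i j else 0 := by
    intro i j
    simp only [u]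
    rw [Finset.sum_eq_single i, Finset.sum_eq_single j]
    · simp
    · intro b _ hb; simp [hb]
    · simp
    · intro b _ hb; simp [hb]
    · simp
  have hu : IsTwoCocycle u := by
    refine ⟨fun h => ?_, fun h => ?_, fun h k l => ?_⟩
    · simpa using ul 0 0 h
    · simpa using ur h 0 0
    · rw [ul, ur]; ring
  have hw : IsTwoCocycle (m + u) := by
    refine ⟨fun h => ?_, fun h => ?_, fun h k l => ?_⟩
    · simp [hm.zero_left, hu.zero_left]
    · simp [hm.zero_right, hu.zero_right]
    · simp only [Pi.add_apply]
      linear_combination hm.assoc h k l + hu.assoc h k l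
  -- the commutator form of `m + u` vanishes on the basis
  let B : Z2 n →+ Z2 n →+ ZMod 2 := AddMonoidHom.mk'
    (fun h => AddMonoidHom.mk' (fun k => (m + u) h k + (m + u) k h) (fun k l => by
      have := hw.commutator_add_left k l h
      grind)) (fun h h' => by
      refine AddMonoidHom.ext fun k => ?_
      exact hw.commutator_add_left h h' k)
  have hB : B = 0 := by
    refine eq_zero_of_single _ fun i => eq_zero_of_single _ fun j => ?_
    change (m + u) (Pi.single i 1) (Pi.single j 1) + (m + u) (Pi.single j 1) (Pi.single i 1) = 0
    simp only [Pi.add_apply, us, c]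
    rcases lt_trichotomy i j with h | rfl | h
    · simp only [h.le, h.not_ge, h.ne, if_true, if_false]
      grind
    · grind
    · simp only [h.le, h.not_ge, h.ne, if_true, if_false]
      grind
  have hs : ∀ h k, (m + u) h k = (m + u) k h := by
    intro h k
    have e : (m + u) h k + (m + u) k h = 0 := DFunLike.congr_fun (DFunLike.congr_fun hB h) k
    grind
  let q : Z2 n →+ ZMod 2 := AddMonoidHom.mk' (fun h => (m + u) h h) (hw.diagonal_add hs)
  have hq : q = 0 := by
    refine eq_zero_of_single _ fun i => ?_
    change (m + u) (Pi.single i 1) (Pi.single i 1) = 0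
    simp only [Pi.add_apply, us, c, le_refl, if_true]
    grind
  obtain ⟨ν, hν⟩ := hw.exists_coboundary hs fun h => DFunLike.congr_fun hq h
  refine ⟨c, ν, fun h k => ?_⟩
  have e := hν h k
  change m h k = u h k + _
  rw [Pi.add_apply, Pi.add_apply] at e
  grind

end SecondCohomology

end TQD

namespace TQD

section Sign

lemma sgn_add (a b : ZMod 2) : sgn (a + b) = sgn a * sgn b := by
  have : ∀ a b : ZMod 2, (a + b).val % 2 = (a.val + b.val) % 2 := by decide
  have sq : (-1 : Circle) ^ 2 = 1 := by ext; simp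
  rw [sgn, sgn, sgn, ← pow_add, pow_eq_pow_mod (a + b).val sq, this, ← pow_eq_pow_mod _ sq]

@[simp] lemma sgn_zero : sgn 0 = 1 := by simp [sgn]

@[simp] lemma sgn_one : sgn 1 = -1 := by
  rw [sgn, show (1 : ZMod 2).val = 1 from rfl, pow_one]

lemma sgn_mul_self (a : ZMod 2) : sgn a * sgn a = 1 := by
  rw [← sgn_add, CharTwo.add_self_eq_zero, sgn_zero]

@[simp] lemma sgn_inv (a : ZMod 2) : (sgn a)⁻¹ = sgn a :=
  inv_eq_of_mul_eq_one_left (sgn_mul_self a)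

lemma neg_one_ne_one_circle : (-1 : Circle) ≠ 1 := by
  intro h
  have := congrArg (fun z : Circle => (z : ℂ)) h
  norm_num at this

lemma sgn_injective : Function.Injective sgn := by
  intro a b h
  have cases2 : ∀ a : ZMod 2, a = 0 ∨ a = 1 := by decide
  rcases cases2 a with rfl | rfl <;> rcases cases2 b with rfl | rfl
  · rfl
  · rw [sgn_zero, sgn_one] at h
    exact absurd h.symm neg_one_ne_one_circle
  · rw [sgn_zero, sgn_one] at h
    exact absurd h neg_one_ne_one_circle
  · rfl

lemma exists_sgn_eq {z : Circle} (h : z * z = 1) : ∃ a, sgn a = z := by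
  have h' : (z : ℂ) * z = 1 := by exact_mod_cast congrArg (fun z : Circle => (z : ℂ)) h
  rcases mul_self_eq_one_iff.1 h' with e | e
  · exact ⟨0, by ext; simp [e]⟩
  · exact ⟨1, by ext; simp [e]⟩

lemma exists_mul_self_eq (z : Circle) : ∃ w : Circle, w * w = z :=
  ⟨Circle.exp (Complex.arg z / 2), by rw [← Circle.exp_add, add_halves, Circle.exp_arg]⟩

end Sign

section Trilinear

variable {n : ℕ}

/-- The trilinear form with coefficients `τ`. -/
noncomputable def trilinear (τ : Fin n → Fin n → Fin n → ZMod 2) (a b c : Z2 n) : ZMod 2 :=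
  ∑ i, ∑ j, ∑ k, τ i j k * (a i * b j * c k)

/-- Functions of three arguments which are additive in each of them. -/
structure Triadditive {V : Type*} [AddCommGroup V] (T : V → V → V → ZMod 2) : Prop where
  add₁ : ∀ a a' b c, T (a + a') b c = T a b c + T a' b c
  add₂ : ∀ a b b' c, T a (b + b') c = T a b c + T a b' c
  add₃ : ∀ a b c c', T a b (c + c') = T a b c + T a b c'

lemma triadditive_trilinear (τ : Fin n → Fin n → Fin n → ZMod 2) :
    Triadditive (trilinear τ) := by
  constructor <;> intros <;> simp only [trilinear, ← Finset.sum_add_distrib] <;>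
    refine Finset.sum_congr rfl fun i _ => Finset.sum_congr rfl fun j _ =>
      Finset.sum_congr rfl fun k _ => ?_ <;> simp only [Pi.add_apply] <;> ring

lemma Triadditive.isCocycle {T : Z2 n → Z2 n → Z2 n → ZMod 2} (hT : Triadditive T) :
    IsCocycle fun a b c => sgn (T a b c) := by
  intro a b c d
  simp only [← sgn_add]
  congr 1
  simp only [hT.add₁, hT.add₂, hT.add₃]
  ring

/-- The coefficients of the exponent of a product cocycle. -/
noncomputable def TwistData.coeff (κ : TwistData n) (i j k : Fin n) : ZMod 2 :=
  if i = j ∧ j = k then κ.one i else if i < j ∧ j = k then κ.two i j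
  else if i < j ∧ j < k then κ.three i j k else 0

lemma TwistData.coeff_ne_zero {κ : TwistData n} {i j k : Fin n} (h : κ.coeff i j k ≠ 0) :
    i ≤ j ∧ j ≤ k := by
  unfold TwistData.coeff at h
  split_ifs at h with h1 h2 h3
  · exact ⟨h1.1.le, h1.2.le⟩
  · exact ⟨h2.1.le, h2.2.le⟩
  · exact ⟨h3.1.le, h3.2.le⟩
  · exact absurd rfl h

lemma TwistData.cocycle_eq (κ : TwistData n) :
    κ.cocycle = fun a b c => sgn (trilinear κ.coeff a b c) := by
  funext a b c
  have e1 : ∑ i, κ.one i * (a i * b i * c i) = ∑ i, ∑ j, ∑ k,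
      if k = j then (if i = j then κ.one i * (a i * b j * c k) else 0) else 0 := by
    simp
  have e2 : (∑ i, ∑ j, if i < j then κ.two i j * (a i * b j * c j) else 0) = ∑ i, ∑ j, ∑ k,
      if k = j then (if i < j then κ.two i j * (a i * b j * c k) else 0) else 0 := by
    simp
  rw [TwistData.cocycle, e1, e2]
  simp only [trilinear, ← Finset.sum_add_distrib]
  congr 1
  refine Finset.sum_congr rfl fun i _ => Finset.sum_congr rfl fun j _ =>
    Finset.sum_congr rfl fun k _ => ?_
  unfold TwistData.coeff
  grind

/-- Coefficients with prescribed support belong to a product cocycle. -/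
lemma exists_twistData (τ : Fin n → Fin n → Fin n → ZMod 2)
    (h : ∀ i j k, τ i j k ≠ 0 → (i = j ∧ j = k) ∨ (i < j ∧ j ≤ k)) :
    ∃ κ : TwistData n, κ.coeff = τ := by
  refine ⟨⟨fun i => τ i i i, fun i j => τ i j j, τ⟩, ?_⟩
  funext i j k
  have := h i j k
  unfold TwistData.coeff
  grind

end Trilinear

section Surjectivity

/-- Signs, as an additive function. -/
noncomputable def addSgn (a : ZMod 2) : Additive Circle := Additive.ofMul (sgn a)

lemma addSgn_add (a b : ZMod 2) : addSgn (a + b) = addSgn a + addSgn b :=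
  congrArg Additive.ofMul (sgn_add a b)

lemma neg_addSgn (a : ZMod 2) : -addSgn a = addSgn a :=
  congrArg Additive.ofMul (sgn_inv a)

lemma addSgn_zero : addSgn 0 = 0 := congrArg Additive.ofMul sgn_zero

lemma addSgn_injective : Function.Injective addSgn := Additive.ofMul.injective.comp sgn_injective

lemma exists_addSgn_eq {z : Additive Circle} (h : z + z = 0) : ∃ a, addSgn a = z :=
  (exists_sgn_eq (z := z.toMul) h).imp fun _ e => congrArg Additive.ofMul e

lemma Triadditive.isAddCocycle {V : Type*} [AddCommGroup V] {T : V → V → V → ZMod 2}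
    (hT : Triadditive T) : IsAddCocycle fun a b c => addSgn (T a b c) := by
  intro a b c d
  simp only [← addSgn_add]
  congr 1
  simp only [hT.add₁, hT.add₂, hT.add₃]
  ring

/-- The form `a₀ (t b₀ c₀ + ∑_{j ≤ k} c_{jk} b_{j+1} c_{k+1}) + τ (tail a) (tail b) (tail c)`. -/
noncomputable def consCoeff {n : ℕ} (t : ZMod 2) (c : Fin n → Fin n → ZMod 2)
    (τ : Fin n → Fin n → Fin n → ZMod 2) : Fin (n + 1) → Fin (n + 1) → Fin (n + 1) → ZMod 2 :=
  Fin.cons (Fin.cons (Fin.cons t 0) fun j => Fin.cons 0 fun k => if j ≤ k then c j k else 0)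
    fun i => Fin.cons 0 fun j => Fin.cons 0 fun k => τ i j k

lemma consCoeff_support {n : ℕ} (t : ZMod 2) (c : Fin n → Fin n → ZMod 2)
    {τ : Fin n → Fin n → Fin n → ZMod 2}
    (hτ : ∀ i j k, τ i j k ≠ 0 → (i = j ∧ j = k) ∨ (i < j ∧ j ≤ k)) (i j k : Fin (n + 1))
    (h : consCoeff t c τ i j k ≠ 0) : (i = j ∧ j = k) ∨ (i < j ∧ j ≤ k) := by
  obtain rfl | ⟨i, rfl⟩ := i.eq_zero_or_eq_succ <;> obtain rfl | ⟨j, rfl⟩ := j.eq_zero_or_eq_succ <;>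
    obtain rfl | ⟨k, rfl⟩ := k.eq_zero_or_eq_succ <;>
    simp only [consCoeff, Fin.cons_zero, Fin.cons_succ, Pi.zero_apply, ne_eq, not_true_eq_false] at h
  · simp
  · refine Or.inr ⟨Fin.succ_pos j, ?_⟩
    rw [Fin.succ_le_succ_iff]
    by_contra hjk
    simp [hjk] at h
  · simpa using hτ i j k h

lemma trilinear_consCoeff {n : ℕ} (t : ZMod 2) (m : Fin n → Fin n → ZMod 2)
    (τ : Fin n → Fin n → Fin n → ZMod 2) (a b c : Z2 (n + 1)) :
    trilinear (consCoeff t m τ) a b c =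
      a 0 * (t * (b 0 * c 0) +
        ∑ j, ∑ k, if j ≤ k then m j k * (Fin.tail b j * Fin.tail c k) else 0)
      + trilinear τ (Fin.tail a) (Fin.tail b) (Fin.tail c) := by
  simp only [trilinear, consCoeff, Fin.sum_univ_succ, Fin.cons_zero, Fin.cons_succ, Fin.tail,
    Pi.zero_apply, zero_mul, Finset.sum_const_zero, add_zero, zero_add, mul_add, Finset.mul_sum,
    ite_mul, mul_ite, mul_zero]
  congr 1
  congr 1
  · ring
  · refine Finset.sum_congr rfl fun j _ => Finset.sum_congr rfl fun k _ => ?_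
    split_ifs
    · ring
    · rfl

/-- Every 3-cocycle of `ℤ₂ⁿ` with values in `U(1)` is cohomologous to a product cocycle. -/
lemma exists_trilinear_add_coboundary (n : ℕ) (f : Z2 n → Z2 n → Z2 n → Additive Circle)
    (hf : IsAddCocycle f) :
    ∃ (τ : Fin n → Fin n → Fin n → ZMod 2) (β : Z2 n → Z2 n → Additive Circle),
      (∀ i j k, τ i j k ≠ 0 → (i = j ∧ j = k) ∨ (i < j ∧ j ≤ k)) ∧
      f = (fun a b c => addSgn (trilinear τ a b c)) + addCoboundary β := by
  induction n with
  | zero =>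
    refine ⟨fun i => i.elim0, 0, fun i => i.elim0, ?_⟩
    funext a b c
    have e := hf 0 0 0 0
    simp only [add_zero] at e
    have e0 : f 0 0 0 = 0 := by simpa using e
    have h : ∀ a : Z2 0, a = 0 := fun a => Subsingleton.elim _ _
    rw [h a, h b, h c, e0]
    simp [trilinear, addCoboundary, addSgn_zero]
  | succ n ih =>
    have cases2 : ∀ a : ZMod 2, a = 0 ∨ a = 1 := by decide
    let e : ZMod 2 × Z2 n → Z2 (n + 1) := fun g => Fin.cons g.1 g.2
    have he : ∀ g g', e (g + g') = e g + e g' := by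
      intro g g'
      funext i
      refine Fin.cases ?_ (fun i => ?_) i <;> simp [e]
    let r : Z2 (n + 1) → ZMod 2 × Z2 n := fun x => (x 0, Fin.tail x)
    have her : ∀ x, e (r x) = x := fun x => Fin.cons_self_tail x
    have hr : ∀ x y, r (x + y) = r x + r y := fun _ _ => rfl
    obtain ⟨τ, β₀, hτ, h₀⟩ := ih (fun a b c => f (e (0, a)) (e (0, b)) (e (0, c)))
      (fun a b c d => by
        have := hf (e (0, a)) (e (0, b)) (e (0, c)) (e (0, d))
        simpa only [← he, Prod.mk_add_mk, add_zero] using this)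
    -- the cocycle divided by its restriction to the last `n` layers
    let f₁ : ZMod 2 × Z2 n → ZMod 2 × Z2 n → ZMod 2 × Z2 n → Additive Circle := fun a b c =>
      f (e a) (e b) (e c) - addSgn (trilinear τ a.2 b.2 c.2)
    have c₁ : IsAddCocycle f₁ := by
      intro a b c d
      have e1 := hf (e a) (e b) (e c) (e d)
      have e2 := (triadditive_trilinear τ).isAddCocycle a.2 b.2 c.2 d.2
      simp only [f₁, he, Prod.snd_add]
      linear_combination (norm := abel) e1 - e2
    let f₂ := f₁ - addCoboundary fun a b => β₀ a.2 b.2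
    have c₂ : IsAddCocycle f₂ := c₁.sub_addCoboundary _
    have t₂ : ∀ h k l, f₂ (0, h) (0, k) (0, l) = 0 := by
      intro h k l
      have := congrFun (congrFun (congrFun h₀ h) k) l
      simp only [f₂, f₁, Pi.sub_apply, this]
      simp [addCoboundary]
    obtain ⟨β₁, n₃, t₃⟩ := c₂.exists_isNormalized t₂
    have c₃ := c₂.sub_addCoboundary β₁
    obtain ⟨β₂, n₄, t₄⟩ := c₃.exists_trivial_first n₃ t₃
    have c₄ := c₃.sub_addCoboundary β₂
    obtain ⟨β₃, t, μ, ht, hμ, hμl, hμr, hμa, t₅, h₅⟩ := c₄.exists_normalForm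
      (fun a => exists_mul_self_eq a.toMul) n₄ t₄
    obtain ⟨t, rfl⟩ := exists_addSgn_eq ht
    choose m hm using fun h k => exists_addSgn_eq (hμ h k)
    have m2 : IsTwoCocycle m := by
      refine ⟨fun h => addSgn_injective ?_, fun h => addSgn_injective ?_,
        fun h k l => addSgn_injective ?_⟩
      · rw [hm, hμl, addSgn_zero]
      · rw [hm, hμr, addSgn_zero]
      · simp only [addSgn_add, hm, hμa]
    obtain ⟨c, ν, hc⟩ := m2.exists_bilinear
    let β₄ : ZMod 2 × Z2 n → ZMod 2 × Z2 n → Additive Circle := fun a b => addSgn (a.1 * ν b.2)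
    have key : ∀ a b c', f₂ a b c' = addSgn (a.1 * (t * (b.1 * c'.1) +
          ∑ j, ∑ k, if j ≤ k then c j k * (b.2 j * c'.2 k) else 0))
        + addCoboundary (β₁ + β₂ + β₃ + β₄) a b c' := by
      intro x y z
      have split : addCoboundary (β₁ + β₂ + β₃ + β₄) x y z = addCoboundary β₁ x y z
          + addCoboundary β₂ x y z + addCoboundary β₃ x y z + addCoboundary β₄ x y z := by
        simp only [addCoboundary, Pi.add_apply]
        abel
      obtain ⟨a, h⟩ := x
      obtain ⟨b, k⟩ := y
      obtain ⟨d, l⟩ := z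
      have e4 : addCoboundary β₄ (a, h) (b, k) (d, l)
          = addSgn (a * (ν (k + l) + ν k + ν l)) := by
        simp only [addCoboundary, β₄, Prod.mk_add_mk, sub_eq_add_neg, neg_addSgn,
          ← addSgn_add]
        congr 1
        grind
      rw [split, e4]
      rcases cases2 a with rfl | rfl
      · have := t₅ h (b, k) (d, l)
        simp only [Pi.sub_apply] at this
        simp only [zero_mul, addSgn_zero]
        linear_combination (norm := abel) this
      · have := h₅ h k l b d
        simp only [Pi.sub_apply, ← hm, hc] at this
        have e5 : (if b = 1 ∧ d = 1 then addSgn t else 0) = addSgn (t * (b * d)) := by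
          rcases cases2 b with rfl | rfl <;> rcases cases2 d with rfl | rfl <;>
            simp [addSgn_zero]
        rw [e5, addSgn_add] at this
        simp only [one_mul, addSgn_add]
        simp only [addSgn_add] at this
        linear_combination (norm := abel) this
    refine ⟨consCoeff t c τ, fun x y => (β₁ + β₂ + β₃ + β₄) (r x) (r y)
      + β₀ (Fin.tail x) (Fin.tail y), ?_, ?_⟩
    · exact consCoeff_support t c hτ
    · funext x y z
      change _ = addSgn (trilinear (consCoeff t c τ) x y z) + addCoboundary _ x y z
      have e1 := key (r x) (r y) (r z)
      simp only [f₂, f₁, Pi.sub_apply, her] at e1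
      rw [trilinear_consCoeff, addSgn_add]
      simp only [Pi.add_apply, addCoboundary, hr] at e1 ⊢
      have : ∀ x y : Z2 (n + 1), Fin.tail (x + y) = Fin.tail x + Fin.tail y := fun _ _ => rfl
      simp only [this]
      simp only [r, Prod.mk_add_mk] at e1 ⊢
      linear_combination (norm := abel) e1

/-- Every 3-cocycle of `ℤ₂ⁿ` with values in `U(1)` is the product of a product cocycle and a
coboundary. -/
lemma IsCocycle.exists_eq_mul_coboundary {n : ℕ} {ω : Cochain3 n} (hω : IsCocycle ω) :
    ∃ (κ : TwistData n) (β : Z2 n → Z2 n → Circle), ω = κ.cocycle * coboundary β := by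
  obtain ⟨τ, β, hτ, h⟩ := exists_trilinear_add_coboundary n
    (fun a b c => Additive.ofMul (ω a b c)) hω
  obtain ⟨κ, hκ⟩ := exists_twistData τ hτ
  refine ⟨κ, fun a b => (β a b).toMul, ?_⟩
  funext a b c
  have e := congrArg Additive.toMul (congrFun (congrFun (congrFun h a) b) c)
  rw [κ.cocycle_eq, hκ]
  exact e

lemma TwistData.isCocycle {n : ℕ} (κ : TwistData n) : IsCocycle κ.cocycle :=
  κ.cocycle_eq ▸ (triadditive_trilinear κ.coeff).isCocycle

end Surjectivity

end TQD

namespace TQD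

section GroundSpace

variable {C : Type*} [Fintype C]

/-- The squared Hilbert space norm. -/
noncomputable def normSqSum (ψ : C → ℂ) : ℝ := ∑ x, ‖ψ x‖ ^ 2

lemma normSqSum_nonneg (ψ : C → ℂ) : 0 ≤ normSqSum ψ :=
  Finset.sum_nonneg fun _ _ => by positivity

lemma normSqSum_eq_zero {ψ : C → ℂ} : normSqSum ψ = 0 ↔ ψ = 0 := by
  rw [normSqSum, Finset.sum_eq_zero_iff_of_nonneg fun _ _ => by positivity]
  simp [funext_iff]

/-- The real part of the inner product with a vector, as a linear form. -/
noncomputable def reInner (ψ : C → ℂ) : (C → ℂ) →ₗ[ℝ] ℝ where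
  toFun χ := ∑ x, (starRingEnd ℂ (ψ x) * χ x).re
  map_add' χ χ' := by simp [mul_add, Finset.sum_add_distrib]
  map_smul' c χ := by simp [Finset.mul_sum, mul_left_comm, mul_add]

lemma reInner_self (ψ : C → ℂ) : reInner ψ ψ = normSqSum ψ := by
  refine Finset.sum_congr rfl fun x _ => ?_
  rw [← Complex.normSq_eq_conj_mul_self, Complex.ofReal_re,
    Complex.normSq_eq_norm_sq]

lemma normSqSum_sub (ψ χ : C → ℂ) :
    normSqSum (χ - ψ) = normSqSum χ + normSqSum ψ - 2 * reInner ψ χ := by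
  simp only [normSqSum, reInner, LinearMap.coe_mk, AddHom.coe_mk, Finset.mul_sum,
    ← Finset.sum_add_distrib, ← Finset.sum_sub_distrib]
  refine Finset.sum_congr rfl fun x _ => ?_
  simp only [← Complex.normSq_eq_norm_sq, Complex.normSq_apply, Pi.sub_apply, Complex.sub_re,
    Complex.sub_im, Complex.mul_re, Complex.conj_re, Complex.conj_im]
  ring

lemma normSqSum_monomial (π : Equiv.Perm C) (φ : C → Circle) (ψ : C → ℂ) :
    normSqSum (monomial π φ ψ) = normSqSum ψ := by
  change ∑ y, ‖(φ (π.symm y) : ℂ) * ψ (π.symm y)‖ ^ 2 = _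
  simp only [norm_mul, Circle.norm_coe, one_mul]
  exact Equiv.sum_comp π.symm fun x => ‖ψ x‖ ^ 2

variable {L M n : ℕ} (R : Patch L M)

/-- The triangles of the patch carry no flux. -/
def IsFlat (x : Config R n) : Prop :=
  ∀ p ∈ R.tris, x.at p.fst + x.at p.snd + x.at p.thd = 0

lemma triangleOp_apply (p : Tri L M) (ψ : Config R n → ℂ) (x : Config R n) :
    triangleOp R n p ψ x = if x.at p.fst + x.at p.snd + x.at p.thd = 0 then ψ x else 0 := rfl

lemma mem_gaugeInvariant {ψ : Config R n → ℂ} :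
    ψ ∈ gaugeInvariant R n ↔ ∀ p ∈ R.tris, triangleOp R n p ψ = ψ := by
  simp [gaugeInvariant, Submodule.mem_iInf]

lemma mem_gaugeInvariant_iff_isFlat {ψ : Config R n → ℂ} :
    ψ ∈ gaugeInvariant R n ↔ ∀ x, ψ x ≠ 0 → IsFlat R x := by
  rw [mem_gaugeInvariant]
  constructor
  · intro h x hx p hp
    have := congrFun (h p hp) x
    rw [triangleOp_apply] at this
    by_contra h'
    rw [if_neg h'] at this
    exact hx this.symm
  · intro h p hp
    funext x
    rw [triangleOp_apply]
    by_cases hx : ψ x = 0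
    · simp [hx]
    · rw [if_pos (h x hx p hp)]

/-- Vectors which are fixed by all terms of the Hamiltonian. -/
def IsFrustrationFree (ω : Cochain3 n) (ψ : Config R n → ℂ) : Prop :=
  ψ ∈ gaugeInvariant R n ∧ ∀ s ∈ R.verts, ∀ t, vertexTerm R ω s t ψ = ψ

lemma card_Z2 : (Fintype.card (Z2 n) : ℂ) = 2 ^ n := by
  simp [ZMod.card]

lemma IsFrustrationFree.hamiltonian_apply {ω : Cochain3 n} {ψ : Config R n → ℂ}
    (h : IsFrustrationFree R ω ψ) :
    hamiltonian R ω ψ = ((-(R.verts.card + R.tris.card : ℝ) : ℝ) : ℂ) • ψ := by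
  have hA : ∀ s ∈ R.verts, vertexOp R ω s ψ = ψ := by
    intro s hs
    have : ∑ t : Z2 n, vertexTerm R ω s t ψ = (2 : ℂ) ^ n • ψ := by
      rw [Finset.sum_congr rfl fun t _ => h.2 s hs t, Finset.sum_const, Finset.card_univ,
        ← card_Z2, Nat.cast_smul_eq_nsmul]
    simp [vertexOp, this]
  have hB := (mem_gaugeInvariant R).1 h.1
  simp only [hamiltonian, LinearMap.sub_apply, LinearMap.neg_apply, LinearMap.sum_apply]
  rw [Finset.sum_congr rfl hA, Finset.sum_congr rfl hB, Finset.sum_const, Finset.sum_const]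
  simp only [← Nat.cast_smul_eq_nsmul ℂ]
  push_cast
  module

lemma normSqSum_triangleOp (p : Tri L M) (ψ : Config R n → ℂ) :
    reInner ψ (triangleOp R n p ψ) = normSqSum ψ - normSqSum (triangleOp R n p ψ - ψ) := by
  simp only [normSqSum, reInner, LinearMap.coe_mk, AddHom.coe_mk, ← Finset.sum_sub_distrib]
  refine Finset.sum_congr rfl fun x _ => ?_
  rw [Pi.sub_apply, triangleOp_apply]
  split_ifs
  · rw [← Complex.normSq_eq_conj_mul_self, Complex.ofReal_re,
      Complex.normSq_eq_norm_sq]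
    simp
  · simp

/-- The energy of an eigenvector above the lower bound measures how far it is from being fixed by
all terms of the Hamiltonian. -/
lemma energy_eq {ω : Cochain3 n} {ψ : Config R n → ℂ} {E : ℝ}
    (h : hamiltonian R ω ψ = (E : ℂ) • ψ) :
    (E + (R.verts.card + R.tris.card)) * normSqSum ψ =
      (∑ s ∈ R.verts, ((2 : ℝ) ^ n)⁻¹ * ∑ t, normSqSum (vertexTerm R ω s t ψ - ψ) / 2) +
        ∑ p ∈ R.tris, normSqSum (triangleOp R n p ψ - ψ) := by
  have e := congrArg (reInner ψ) h
  have e1 : ∀ s, reInner ψ (vertexOp R ω s ψ) =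
      normSqSum ψ - ((2 : ℝ) ^ n)⁻¹ * ∑ t, normSqSum (vertexTerm R ω s t ψ - ψ) / 2 := by
    intro s
    have : vertexOp R ω s ψ = ((2 : ℝ) ^ n)⁻¹ • ∑ t : Z2 n, vertexTerm R ω s t ψ := by
      funext x
      simp [vertexOp]
    rw [this, map_smul, map_sum]
    have e2 : ∀ t, reInner ψ (vertexTerm R ω s t ψ)
        = normSqSum ψ - normSqSum (vertexTerm R ω s t ψ - ψ) / 2 := by
      intro t
      rw [normSqSum_sub, vertexTerm, normSqSum_monomial]
      ring
    rw [Finset.sum_congr rfl fun t _ => e2 t, Finset.sum_sub_distrib, Finset.sum_const,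
      Finset.card_univ, nsmul_eq_mul, smul_eq_mul, mul_sub]
    have : (Fintype.card (Z2 n) : ℝ) = 2 ^ n := by simp [ZMod.card]
    rw [this, ← mul_assoc, inv_mul_cancel₀ (by positivity), one_mul]
  have e3 : (E : ℂ) • ψ = E • ψ := by
    funext x
    simp
  rw [e3, map_smul, reInner_self] at e
  simp only [hamiltonian, LinearMap.sub_apply, LinearMap.neg_apply, LinearMap.sum_apply,
    map_sub, map_neg, map_sum, e1, normSqSum_triangleOp, Finset.sum_sub_distrib, Finset.sum_const,
    nsmul_eq_mul, smul_eq_mul] at e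
  linear_combination -e

/-- A Hamiltonian which fixes some nonzero vector termwise is frustration-free. -/
lemma mem_groundSpace_iff {ω : Cochain3 n} (h : ∃ ψ ≠ 0, IsFrustrationFree R ω ψ)
    (ψ : Config R n → ℂ) :
    ψ ∈ groundSpace (hamiltonian R ω) ↔ IsFrustrationFree R ω ψ := by
  have hpos : ∀ χ : Config R n → ℂ, 0 ≤
      (∑ s ∈ R.verts, ((2 : ℝ) ^ n)⁻¹ * ∑ t, normSqSum (vertexTerm R ω s t χ - χ) / 2) :=
    fun χ => Finset.sum_nonneg fun s _ => mul_nonneg (by positivity) <|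
      Finset.sum_nonneg fun t _ => div_nonneg (normSqSum_nonneg _) zero_le_two
  have hpos' : ∀ χ : Config R n → ℂ, 0 ≤
      ∑ p ∈ R.tris, normSqSum (triangleOp R n p χ - χ) :=
    fun χ => Finset.sum_nonneg fun s _ => normSqSum_nonneg _
  have hmin : IsLeast {E : ℝ | (hamiltonian R ω).HasEigenvalue (E : ℂ)}
      (-(R.verts.card + R.tris.card : ℝ)) := by
    constructor
    · obtain ⟨ψ₀, h₀, hf⟩ := h
      exact Module.End.hasEigenvalue_of_hasEigenvector
        ⟨Module.End.mem_eigenspace_iff.2 hf.hamiltonian_apply, h₀⟩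
    · intro E hE
      obtain ⟨χ, hχ, hχ0⟩ := hE.exists_hasEigenvector
      have e := energy_eq R (Module.End.mem_eigenspace_iff.1 hχ)
      have hN : 0 < normSqSum χ := (normSqSum_nonneg χ).lt_of_ne fun h0 =>
        hχ0 (normSqSum_eq_zero.1 h0.symm)
      have := nonneg_of_mul_nonneg_left (e ▸ add_nonneg (hpos χ) (hpos' χ)) hN
      linarith
  rw [groundSpace, hmin.csInf_eq, Module.End.mem_eigenspace_iff]
  refine ⟨fun hψ => ?_, fun hψ => hψ.hamiltonian_apply⟩
  have e := energy_eq R hψ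
  rw [neg_add_cancel, zero_mul] at e
  have e1 : (∑ s ∈ R.verts, ((2 : ℝ) ^ n)⁻¹ *
      ∑ t, normSqSum (vertexTerm R ω s t ψ - ψ) / 2) = 0 :=
    le_antisymm (by linarith [hpos' ψ]) (hpos ψ)
  have e2 : ∑ p ∈ R.tris, normSqSum (triangleOp R n p ψ - ψ) = 0 :=
    le_antisymm (by linarith [hpos ψ]) (hpos' ψ)
  refine ⟨(mem_gaugeInvariant R).2 fun p hp => ?_, fun s hs t => ?_⟩
  · have := (Finset.sum_eq_zero_iff_of_nonneg fun p _ => normSqSum_nonneg _).1 e2 p hp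
    exact sub_eq_zero.1 (normSqSum_eq_zero.1 this)
  · have := (Finset.sum_eq_zero_iff_of_nonneg fun s _ => mul_nonneg (by positivity) <|
      Finset.sum_nonneg fun t _ => div_nonneg (normSqSum_nonneg _) zero_le_two).1 e1 s hs
    rw [mul_eq_zero, or_iff_right (by positivity), Finset.sum_eq_zero_iff_of_nonneg fun t _ =>
      div_nonneg (normSqSum_nonneg _) zero_le_two] at this
    have := this t (Finset.mem_univ t)
    rw [div_eq_zero_iff, or_iff_left two_ne_zero] at this
    exact sub_eq_zero.1 (normSqSum_eq_zero.1 this)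

end GroundSpace

end TQD

namespace TQD

section Geometry

variable {L M n : ℕ}

/-- The displacement of the edges with a given direction. -/
def edgeDir (L M : ℕ) : Fin 3 → Vert L M := ![(1, 0), (0, 1), (1, 1)]

/-- The middle vertex of a triangle. -/
def Tri.mid (p : Tri L M) : Vert L M := p.1 + if p.2 then (1, 0) else (0, 1)

/-- The difference of a function of the vertices along an edge. -/
def edgeDiff (g : Vert L M → Z2 n) (e : Edge L M) : Z2 n := g e.1 + g (e.1 + edgeDir L M e.2)

lemma add_self_Z2 (a : Z2 n) : a + a = 0 := funext fun _ => CharTwo.add_self_eq_zero _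

lemma eq_add_of_add_add_eq_zero {a b c : Z2 n} (h : a + b + c = 0) : a = b + c := by
  have : a = (a + b + c) + (b + c) := by
    have hb := add_self_Z2 b
    have hc := add_self_Z2 c
    calc a = a + (b + b) + (c + c) := by rw [hb, hc, add_zero, add_zero]
      _ = _ := by abel
  rw [this, h, zero_add]

lemma edgeDiff_fst (g : Vert L M → Z2 n) (p : Tri L M) :
    edgeDiff g p.fst = g p.1 + g p.mid := by
  obtain ⟨v, b⟩ := p
  cases b <;> simp [edgeDiff, Tri.fst, Tri.mid, edgeDir]

lemma edgeDiff_snd (g : Vert L M → Z2 n) (p : Tri L M) :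
    edgeDiff g p.snd = g p.mid + g (p.1 + (1, 1)) := by
  obtain ⟨v, b⟩ := p
  cases b <;> simp [edgeDiff, Tri.snd, Tri.mid, edgeDir, add_assoc]

lemma edgeDiff_thd (g : Vert L M → Z2 n) (p : Tri L M) :
    edgeDiff g p.thd = g p.1 + g (p.1 + (1, 1)) := by
  simp [edgeDiff, Tri.thd, edgeDir]

lemma edgeDiff_flat (g : Vert L M → Z2 n) (p : Tri L M) :
    edgeDiff g p.fst + edgeDiff g p.snd + edgeDiff g p.thd = 0 := by
  rw [edgeDiff_fst, edgeDiff_snd, edgeDiff_thd]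
  have h1 := add_self_Z2 (g p.1)
  have h2 := add_self_Z2 (g p.mid)
  have h3 := add_self_Z2 (g (p.1 + (1, 1)))
  linear_combination (norm := abel) h1 + h2 + h3

section Local

variable (s : Vert L M)

lemma p1_fst : (p1 s).fst = e7 s := rfl
lemma p2_fst : (p2 s).fst = e8 s := rfl
lemma p3_fst : (p3 s).fst = e3 s := rfl
lemma p4_fst : (p4 s).fst = e4 s := rfl
lemma p5_fst : (p5 s).fst = e6 s := rfl
lemma p6_fst : (p6 s).fst = e1 s := rfl

lemma p1_snd : (p1 s).snd = e1 s := by simp [p1, Tri.snd, e1, Prod.ext_iff]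
lemma p2_snd : (p2 s).snd = e3 s := by simp [p2, Tri.snd, e3, Prod.ext_iff]
lemma p3_snd : (p3 s).snd = e4 s := by simp [p3, Tri.snd, e4]
lemma p4_snd : (p4 s).snd = e10 s := rfl
lemma p5_snd : (p5 s).snd = e11 s := rfl
lemma p6_snd : (p6 s).snd = e6 s := by simp [p6, Tri.snd, e6]

lemma p1_thd : (p1 s).thd = e2 s := rfl
lemma p2_thd : (p2 s).thd = e2 s := rfl
lemma p3_thd : (p3 s).thd = e9 s := rfl
lemma p4_thd : (p4 s).thd = e5 s := rfl
lemma p5_thd : (p5 s).thd = e5 s := rfl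
lemma p6_thd : (p6 s).thd = e12 s := rfl

lemma vertices_ne_of_notMem_starTris {p : Tri L M} (h : p ∉ starTris s) :
    p.1 ≠ s ∧ p.mid ≠ s ∧ p.1 + (1, 1) ≠ s := by
  obtain ⟨v, b⟩ := p
  cases b <;> simp_all [starTris, p1, p2, p3, p4, p5, p6, Tri.mid, eq_sub_iff_add_eq]

variable [Nontrivial (ZMod L)] [Nontrivial (ZMod M)]

/-- The edges of the star are those with exactly one end equal to `s`. -/
lemma edgeDiff_single (t : Z2 n) (e : Edge L M) :
    edgeDiff (Pi.single s t) e = if e ∈ star s then t else 0 := by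
  obtain ⟨v, k⟩ := e
  obtain ⟨v1, v2⟩ := v
  obtain ⟨s1, s2⟩ := s
  fin_cases k <;>
  · simp only [edgeDiff, star, e1, e2, e3, e4, e5, e6, edgeDir, Pi.single_apply,
      Finset.mem_insert, Finset.mem_singleton, Prod.ext_iff]
    simp [eq_sub_iff_add_eq]
    have h1 : v1 + 1 ≠ v1 := by simp
    have h2 : v2 + 1 ≠ v2 := by simp
    split_ifs <;> grind

@[to_additive]
lemma prod_star {A : Type*} [CommMonoid A] (F : Edge L M → A) :
    ∏ e ∈ star s, F e = F (e1 s) * F (e2 s) * F (e3 s) * F (e4 s) * F (e5 s) * F (e6 s) := by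
  rw [star, Finset.prod_insert, Finset.prod_insert, Finset.prod_insert, Finset.prod_insert,
    Finset.prod_insert, Finset.prod_singleton]
  · simp only [mul_assoc]
  all_goals simp [e1, e2, e3, e4, e5, e6, Prod.ext_iff]

@[to_additive]
lemma prod_starTris {A : Type*} [CommMonoid A] (F : Tri L M → A) :
    ∏ p ∈ starTris s, F p =
      F (p1 s) * F (p2 s) * F (p3 s) * F (p4 s) * F (p5 s) * F (p6 s) := by
  rw [starTris, Finset.prod_insert, Finset.prod_insert, Finset.prod_insert, Finset.prod_insert,
    Finset.prod_insert, Finset.prod_singleton]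
  · simp only [mul_assoc]
  all_goals simp [p1, p2, p3, p4, p5, p6, Prod.ext_iff, eq_sub_iff_add_eq]

end Local

end Geometry

end TQD

namespace TQD

section Gauge

variable {L M n : ℕ} {R : Patch L M}

lemma Patch.fst_mem {p : Tri L M} (hp : p ∈ R.tris) : p.fst ∈ R.edges :=
  Finset.mem_biUnion.2 ⟨p, hp, by simp⟩

lemma Patch.snd_mem {p : Tri L M} (hp : p ∈ R.tris) : p.snd ∈ R.edges :=
  Finset.mem_biUnion.2 ⟨p, hp, by simp⟩

lemma Patch.thd_mem {p : Tri L M} (hp : p ∈ R.tris) : p.thd ∈ R.edges :=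
  Finset.mem_biUnion.2 ⟨p, hp, by simp⟩

lemma Patch.tri_mem {s : Vert L M} (hs : s ∈ R.verts) :
    p1 s ∈ R.tris ∧ p2 s ∈ R.tris ∧ p3 s ∈ R.tris ∧ p4 s ∈ R.tris ∧ p5 s ∈ R.tris ∧
      p6 s ∈ R.tris := by
  have h := R.starTris_subset s hs
  refine ⟨?_, ?_, ?_, ?_, ?_, ?_⟩ <;> exact h (by simp [starTris])

lemma Patch.edge_mem {s : Vert L M} (hs : s ∈ R.verts) :
    (e1 s ∈ R.edges ∧ e2 s ∈ R.edges ∧ e3 s ∈ R.edges ∧ e4 s ∈ R.edges ∧ e5 s ∈ R.edges ∧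
      e6 s ∈ R.edges) ∧ e7 s ∈ R.edges ∧ e8 s ∈ R.edges ∧ e9 s ∈ R.edges ∧
      e10 s ∈ R.edges ∧ e11 s ∈ R.edges ∧ e12 s ∈ R.edges := by
  obtain ⟨h1, h2, h3, h4, h5, h6⟩ := R.tri_mem hs
  exact ⟨⟨R.fst_mem h6, R.thd_mem h1, R.fst_mem h3, R.fst_mem h4, R.thd_mem h4, R.fst_mem h5⟩,
    R.fst_mem h1, R.fst_mem h2, R.thd_mem h3, R.snd_mem h4, R.snd_mem h5, R.thd_mem h6⟩

/-- The configuration which is the gauge transform of the vacuum. -/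
def gradient (R : Patch L M) (g : Vert L M → Z2 n) : Config R n := fun e => edgeDiff g e.1

lemma gradient_at (g : Vert L M → Z2 n) {e : Edge L M} (he : e ∈ R.edges) :
    (gradient R g).at e = edgeDiff g e := by
  rw [Config.at, dif_pos he, gradient]

lemma Config.at_add (x y : Config R n) (e : Edge L M) : (x + y).at e = x.at e + y.at e := by
  unfold Config.at
  split_ifs <;> simp

lemma edgeDiff_add (g h : Vert L M → Z2 n) (e : Edge L M) :
    edgeDiff (g + h) e = edgeDiff g e + edgeDiff h e := by
  simp only [edgeDiff, Pi.add_apply]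
  abel

lemma gradient_add (g h : Vert L M → Z2 n) :
    gradient R (g + h) = gradient R g + gradient R h :=
  funext fun e => edgeDiff_add g h e.1

lemma gradient_flat (g : Vert L M → Z2 n) : IsFlat R (gradient R g) := fun p hp => by
  rw [gradient_at _ (R.fst_mem hp), gradient_at _ (R.snd_mem hp), gradient_at _ (R.thd_mem hp),
    edgeDiff_flat]

section Flip

variable [Nontrivial (ZMod L)] [Nontrivial (ZMod M)]

lemma flip_apply (s : Vert L M) (t : Z2 n) (x : Config R n) :
    flip R s t x = x + gradient R (Pi.single s t) := by
  funext e
  simp only [flip, Equiv.coe_addRight, Pi.add_apply, gradient, edgeDiff_single]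

lemma flip_at (s : Vert L M) (t : Z2 n) (x : Config R n) {e : Edge L M} (he : e ∈ R.edges) :
    (flip R s t x).at e = x.at e + if e ∈ star s then t else 0 := by
  rw [flip_apply, Config.at_add, gradient_at _ he, edgeDiff_single]

lemma isFlat_flip {s : Vert L M} {t : Z2 n} {x : Config R n} :
    IsFlat R (flip R s t x) ↔ IsFlat R x := by
  refine forall₂_congr fun p hp => ?_
  have := edgeDiff_flat (Pi.single s t) p
  rw [flip_apply]
  simp only [Config.at_add, gradient_at _ (R.fst_mem hp), gradient_at _ (R.snd_mem hp),
    gradient_at _ (R.thd_mem hp)]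
  rw [add_add_add_comm (x.at p.fst), add_add_add_comm (x.at p.fst + x.at p.snd), this, add_zero]

end Flip

lemma IsFlat.star {x : Config R n} (hx : IsFlat R x) {s : Vert L M} (hs : s ∈ R.verts) :
    x.at (e7 s) = x.at (e1 s) + x.at (e2 s) ∧ x.at (e8 s) = x.at (e3 s) + x.at (e2 s) ∧
    x.at (e10 s) = x.at (e4 s) + x.at (e5 s) ∧ x.at (e11 s) = x.at (e6 s) + x.at (e5 s) ∧
    x.at (e9 s) = x.at (e3 s) + x.at (e4 s) ∧ x.at (e12 s) = x.at (e1 s) + x.at (e6 s) := by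
  obtain ⟨h1, h2, h3, h4, h5, h6⟩ := R.tri_mem hs
  have f1 := hx _ h1
  have f2 := hx _ h2
  have f3 := hx _ h3
  have f4 := hx _ h4
  have f5 := hx _ h5
  have f6 := hx _ h6
  rw [p1_fst, p1_snd, p1_thd] at f1
  rw [p2_fst, p2_snd, p2_thd] at f2
  rw [p3_fst, p3_snd, p3_thd] at f3
  rw [p4_fst, p4_snd, p4_thd] at f4
  rw [p5_fst, p5_snd, p5_thd] at f5
  rw [p6_fst, p6_snd, p6_thd] at f6
  refine ⟨eq_add_of_add_add_eq_zero f1, eq_add_of_add_add_eq_zero f2,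
    eq_add_of_add_add_eq_zero ?_, eq_add_of_add_add_eq_zero ?_,
    eq_add_of_add_add_eq_zero ?_, eq_add_of_add_add_eq_zero ?_⟩
  · rw [add_comm (x.at (e10 s)), f4]
  · rw [add_comm (x.at (e11 s)), f5]
  · rw [add_assoc, add_comm, f3]
  · rw [add_assoc, add_comm, f6]

/-- The exponent of the phase `f_t^ω` for a cocycle with values `±1`. -/
def phaseExp (T : Z2 n → Z2 n → Z2 n → ZMod 2) (s : Vert L M) (t : Z2 n) (x : Config R n) :
    ZMod 2 :=
  T t (x.at (e4 s)) (x.at (e10 s)) + T (x.at (e3 s) + t) t (x.at (e4 s))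
    + T (x.at (e8 s)) (x.at (e3 s) + t) t
    + (T t (x.at (e6 s)) (x.at (e11 s)) + T (x.at (e1 s) + t) t (x.at (e6 s))
      + T (x.at (e7 s)) (x.at (e1 s) + t) t)

lemma phase_sgn (T : Z2 n → Z2 n → Z2 n → ZMod 2) (s : Vert L M) (t : Z2 n) (x : Config R n) :
    phase (fun a b c => sgn (T a b c)) s t x = sgn (phaseExp T s t x) := by
  simp only [phase, phaseExp, sgn_add, div_eq_mul_inv, mul_inv_rev, sgn_inv]
  simp only [mul_comm, mul_left_comm]

lemma vertexTerm_eq_self_iff {ω : Cochain3 n} {s : Vert L M} {t : Z2 n} {ψ : Config R n → ℂ} :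
    vertexTerm R ω s t ψ = ψ ↔ ∀ x, (phase ω s t x : ℂ) * ψ x = ψ (flip R s t x) := by
  rw [funext_iff, ← (flip R s t).forall_congr_right]
  refine forall_congr' fun x => ?_
  change (phase ω s t ((flip R s t).symm (flip R s t x)) : ℂ) *
    ψ ((flip R s t).symm (flip R s t x)) = _ ↔ _
  rw [Equiv.symm_apply_apply]

/-- The exponent of the amplitudes of the ground state with trivial holonomies. -/
def amplitudeExp (R : Patch L M) (T : Z2 n → Z2 n → Z2 n → ZMod 2) (g : Vert L M → Z2 n) :
    ZMod 2 :=
  ∑ p ∈ R.tris, T (g p.1) (edgeDiff g p.fst) (edgeDiff g p.snd)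

/-- The ground state with trivial holonomies. -/
noncomputable def vacuum (R : Patch L M) (T : Z2 n → Z2 n → Z2 n → ZMod 2) : Config R n → ℂ :=
  fun x => ∑ g : {v // v ∈ R.verts} → Z2 n,
    if gradient R (fun v => if h : v ∈ R.verts then g ⟨v, h⟩ else 0) = x then
      (sgn (amplitudeExp R T (fun v => if h : v ∈ R.verts then g ⟨v, h⟩ else 0)) : ℂ) else 0

lemma vacuum_ne_zero {T : Z2 n → Z2 n → Z2 n → ZMod 2} (hT : Triadditive T) : vacuum R T ≠ 0 := by
  intro h0
  have h := congrFun h0 0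
  have e : vacuum R T 0 = ∑ g : {v // v ∈ R.verts} → Z2 n,
      if gradient R (fun v => if h : v ∈ R.verts then g ⟨v, h⟩ else 0) = 0 then (1 : ℂ) else 0 := by
    refine Finset.sum_congr rfl fun g _ => ?_
    split_ifs with hg
    · have : amplitudeExp R T (fun v => if h : v ∈ R.verts then g ⟨v, h⟩ else 0) = 0 := by
        refine Finset.sum_eq_zero fun p hp => ?_
        rw [← gradient_at _ (R.fst_mem hp), hg, Config.at, dif_pos (R.fst_mem hp), Pi.zero_apply]
        have := hT.add₂ (if h : p.1 ∈ R.verts then g ⟨p.1, h⟩ else 0) 0 0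
          (edgeDiff (fun v => if h : v ∈ R.verts then g ⟨v, h⟩ else 0) p.snd)
        simpa using this
      rw [this, sgn_zero, Circle.coe_one]
    · rfl
  rw [e, Pi.zero_apply, Finset.sum_boole, Nat.cast_eq_zero, Finset.card_eq_zero,
    Finset.filter_eq_empty_iff] at h
  refine h (x := 0) (Finset.mem_univ _) ?_
  funext e
  simp [gradient, edgeDiff]

section Main

variable [Nontrivial (ZMod L)] [Nontrivial (ZMod M)] {T : Z2 n → Z2 n → Z2 n → ZMod 2}

lemma amplitudeExp_add_single (hT : Triadditive T) {s : Vert L M} (hs : s ∈ R.verts) (t : Z2 n)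
    (g : Vert L M → Z2 n) :
    amplitudeExp R T (g + Pi.single s t) = amplitudeExp R T g + phaseExp T s t (gradient R g) := by
  obtain ⟨⟨h1, h2, h3, h4, h5, h6⟩, h7, h8, h9, h10, h11, h12⟩ := R.edge_mem hs
  have key : amplitudeExp R T (g + Pi.single s t) - amplitudeExp R T g =
      ∑ p ∈ starTris s, (T ((g + Pi.single s t : Vert L M → Z2 n) p.1) (edgeDiff (g + Pi.single s t) p.fst)
        (edgeDiff (g + Pi.single s t) p.snd)
        - T (g p.1) (edgeDiff g p.fst) (edgeDiff g p.snd)) := by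
    rw [amplitudeExp, amplitudeExp, ← Finset.sum_sub_distrib]
    refine (Finset.sum_subset (R.starTris_subset s hs) fun p _ hp => ?_).symm
    obtain ⟨k1, k2, k3⟩ := vertices_ne_of_notMem_starTris s hp
    rw [edgeDiff_add, edgeDiff_add, edgeDiff_fst (Pi.single s t), edgeDiff_snd (Pi.single s t),
      Pi.add_apply, Pi.single_eq_of_ne k1, Pi.single_eq_of_ne k2, Pi.single_eq_of_ne k3]
    simp
  rw [← sub_eq_iff_eq_add', key, sum_starTris]
  have m1 : (p1 s).mid = s - (1, 0) := by simp [p1, Tri.mid, Prod.ext_iff]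
  have m2 : (p2 s).mid = s - (0, 1) := by simp [p2, Tri.mid, Prod.ext_iff]
  have m3 : (p3 s).mid = s := by simp [p3, Tri.mid]
  have m4 : (p4 s).mid = s + (1, 0) := rfl
  have m5 : (p5 s).mid = s + (0, 1) := rfl
  have m6 : (p6 s).mid = s := by simp [p6, Tri.mid]
  have w1 : (p1 s).1 + (1, 1) = s := by simp [p1]
  have w2 : (p2 s).1 + (1, 1) = s := by simp [p2]
  have w3 : (p3 s).1 + (1, 1) = s + (1, 0) := by simp [p3, Prod.ext_iff]
  have w4 : (p4 s).1 + (1, 1) = s + (1, 1) := rfl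
  have w5 : (p5 s).1 + (1, 1) = s + (1, 1) := rfl
  have w6 : (p6 s).1 + (1, 1) = s + (0, 1) := by simp [p6, Prod.ext_iff]
  have n1 : s - (1, 0) ≠ s := by simp [Prod.ext_iff]
  have n2 : s - (0, 1) ≠ s := by simp [Prod.ext_iff]
  have n3 : s - (1, 1) ≠ s := by simp [Prod.ext_iff]
  have n4 : s + (1, 0) ≠ s := by simp [Prod.ext_iff]
  have n5 : s + (0, 1) ≠ s := by simp [Prod.ext_iff]
  have n6 : s + (1, 1) ≠ s := by simp [Prod.ext_iff]
  have v1 : (p1 s).1 = s - (1, 1) := rfl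
  have v2 : (p2 s).1 = s - (1, 1) := rfl
  have v3 : (p3 s).1 = s - (0, 1) := rfl
  have v4 : (p4 s).1 = s := rfl
  have v5 : (p5 s).1 = s := rfl
  have v6 : (p6 s).1 = s - (1, 0) := rfl
  rw [phaseExp, gradient_at _ h1, gradient_at _ h3, gradient_at _ h4, gradient_at _ h6,
    gradient_at _ h7, gradient_at _ h8, gradient_at _ h10, gradient_at _ h11,
    ← p1_fst, ← p2_fst, ← p3_fst, ← p4_fst, ← p5_fst, ← p6_fst, ← p4_snd, ← p5_snd]
  simp only [edgeDiff_fst, edgeDiff_snd, m1, m2, m3, m4, m5, m6, w1, w2, w3, w4, w5, w6]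
  simp only [v1, v2, v3, v4, v5, v6, Pi.add_apply, Pi.single_eq_same, Pi.single_eq_of_ne n1,
    Pi.single_eq_of_ne n2, Pi.single_eq_of_ne n3, Pi.single_eq_of_ne n4, Pi.single_eq_of_ne n5,
    Pi.single_eq_of_ne n6, add_zero]
  generalize g s = c, g (s - (1, 1)) = o, g (s - (1, 0)) = l, g (s - (0, 1)) = d,
    g (s + (1, 0)) = r, g (s + (0, 1)) = u, g (s + (1, 1)) = w
  simp only [hT.add₁, hT.add₂, hT.add₃]
  grind

lemma phaseExp_add (hT : Triadditive T) {s : Vert L M} (hs : s ∈ R.verts) (t t' : Z2 n)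
    {x : Config R n} (hx : IsFlat R x) :
    phaseExp T s (t + t') x = phaseExp T s t' x + phaseExp T s t (flip R s t' x) := by
  obtain ⟨⟨h1, h2, h3, h4, h5, h6⟩, h7, h8, h9, h10, h11, h12⟩ := R.edge_mem hs
  have hx' : IsFlat R (flip R s t' x) := isFlat_flip.2 hx
  obtain ⟨f7, f8, f10, f11, -, -⟩ := hx.star hs
  obtain ⟨f7', f8', f10', f11', -, -⟩ := hx'.star hs
  simp only [phaseExp, f7, f8, f10, f11, f7', f8', f10', f11', flip_at _ _ _ h1, flip_at _ _ _ h2,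
    flip_at _ _ _ h3, flip_at _ _ _ h4, flip_at _ _ _ h5, flip_at _ _ _ h6]
  have k1 : e1 s ∈ star s := by simp [star]
  have k2 : e2 s ∈ star s := by simp [star]
  have k3 : e3 s ∈ star s := by simp [star]
  have k4 : e4 s ∈ star s := by simp [star]
  have k5 : e5 s ∈ star s := by simp [star]
  have k6 : e6 s ∈ star s := by simp [star]
  simp only [k1, k2, k3, k4, k5, k6, if_true]
  simp only [hT.add₁, hT.add₂, hT.add₃]
  grind

lemma vacuum_isFrustrationFree (hT : Triadditive T) :
    IsFrustrationFree R (fun a b c => sgn (T a b c)) (vacuum R T) := by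
  refine ⟨(mem_gaugeInvariant_iff_isFlat R).2 fun x hx => ?_, fun s hs t =>
    vertexTerm_eq_self_iff.2 fun x => ?_⟩
  · obtain ⟨g, -, hg⟩ := Finset.exists_ne_zero_of_sum_ne_zero hx
    rw [ite_ne_right_iff] at hg
    rw [← hg.1]
    exact gradient_flat _
  · rw [phase_sgn, vacuum, vacuum, Finset.mul_sum]
    refine Fintype.sum_equiv (Equiv.addRight (Pi.single ⟨s, hs⟩ t)) _ _ fun g => ?_
    have : (fun v => if h : v ∈ R.verts then
          (Equiv.addRight (Pi.single (⟨s, hs⟩ : {v // v ∈ R.verts}) t)) g ⟨v, h⟩ else 0)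
        = (fun v => if h : v ∈ R.verts then g ⟨v, h⟩ else 0) + Pi.single s t := by
      funext v
      by_cases hv : v ∈ R.verts
      · simp [hv, Pi.single_apply]
      · have : v ≠ s := fun h => hv (h ▸ hs)
        simp [hv, this]
    rw [this, amplitudeExp_add_single hT hs, gradient_add, flip_apply]
    simp only [add_left_inj]
    split_ifs with h
    · rw [h, sgn_add, mul_comm]
      push_cast
      rfl
    · rw [mul_zero]

lemma mem_groundSpace_sgn_iff (hT : Triadditive T) (ψ : Config R n → ℂ) :
    ψ ∈ groundSpace (hamiltonian R fun a b c => sgn (T a b c)) ↔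
      IsFrustrationFree R (fun a b c => sgn (T a b c)) ψ :=
  mem_groundSpace_iff R ⟨_, vacuum_ne_zero hT, vacuum_isFrustrationFree hT⟩ ψ

/-- It suffices to check the vertex terms of the standard generators. -/
lemma isFrustrationFree_of_single (hT : Triadditive T) {ψ : Config R n → ℂ}
    (hψ : ψ ∈ gaugeInvariant R n)
    (h : ∀ s ∈ R.verts, ∀ σ, vertexTerm R (fun a b c => sgn (T a b c)) s (Pi.single σ 1) ψ = ψ) :
    IsFrustrationFree R (fun a b c => sgn (T a b c)) ψ := by
  refine ⟨hψ, fun s hs t => ?_⟩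
  have hflat := (mem_gaugeInvariant_iff_isFlat R).1 hψ
  have e : ∑ σ, Pi.single σ (t σ) = t := Finset.univ_sum_single t
  have h0 : ∀ x : Config R n, flip R s 0 x = x := fun x => by
    rw [flip_apply, Pi.single_zero]
    funext e
    simp [gradient, edgeDiff]
  have hadd : ∀ (t t' : Z2 n) (x : Config R n), flip R s (t + t') x = flip R s t (flip R s t' x) := by
    intro t t' x
    rw [flip_apply, flip_apply, flip_apply, add_comm t, Pi.single_add, gradient_add, add_assoc]
  have T0 : ∀ a b, T 0 a b = 0 := fun a b => by simpa using hT.add₁ 0 0 a b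
  have T0' : ∀ a b, T a 0 b = 0 := fun a b => by simpa using hT.add₂ a 0 0 b
  have T0'' : ∀ a b, T a b 0 = 0 := fun a b => by simpa using hT.add₃ a b 0 0
  have hz : vertexTerm R (fun a b c => sgn (T a b c)) s 0 ψ = ψ := by
    rw [vertexTerm_eq_self_iff]
    intro x
    rw [h0, phase_sgn]
    simp [phaseExp, T0, T0', T0'']
  rw [← e]
  refine Finset.sum_induction _ (fun t => vertexTerm R (fun a b c => sgn (T a b c)) s t ψ = ψ)
    ?_ hz ?_
  · intro t t' ht ht'
    rw [vertexTerm_eq_self_iff] at ht ht' ⊢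
    intro x
    by_cases hx : ψ x = 0
    · have := ht' x
      rw [hx, mul_zero] at this
      rw [hadd, hx, mul_zero, ← ht, ← this, mul_zero]
    · rw [hadd, ← ht, ← ht', phase_sgn, phase_sgn, phase_sgn, phaseExp_add hT hs t t' (hflat x hx),
        sgn_add, Circle.coe_mul]
      ring
  · intro σ _
    rcases (by decide : ∀ a : ZMod 2, a = 0 ∨ a = 1) (t σ) with e | e
    · rw [e, Pi.single_zero, hz]
    · rw [e, h s hs]

end Main

end Gauge

end TQD

namespace TQD

section Coboundary

variable {L M n : ℕ} {R : Patch L M}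

/-- The phase by which `cochainUnitary` multiplies a configuration. -/
noncomputable def cochainPhase (R : Patch L M) (β : Z2 n → Z2 n → Circle) (x : Config R n) :
    Circle :=
  ∏ p ∈ R.tris, β (x.at p.fst) (x.at p.snd) ^ (if p.2 then (1 : ℤ) else -1)

lemma phase_mul (ω ω' : Cochain3 n) (s : Vert L M) (t : Z2 n) (x : Config R n) :
    phase (ω * ω') s t x = phase ω s t x * phase ω' s t x := by
  apply Additive.ofMul.injective
  simp only [phase, Pi.mul_apply, ofMul_mul, ofMul_div]
  abel

lemma cochainUnitary_apply (β : Z2 n → Z2 n → Circle) (ψ : Config R n → ℂ) (x : Config R n) :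
    cochainUnitary R β ψ x = cochainPhase R β x * ψ x := rfl

variable [Nontrivial (ZMod L)] [Nontrivial (ZMod M)]

lemma phase_coboundary (β : Z2 n → Z2 n → Circle) {s : Vert L M} (hs : s ∈ R.verts) (t : Z2 n)
    {x : Config R n} (hx : IsFlat R x) :
    phase (coboundary β) s t x * cochainPhase R β (flip R s t x) = cochainPhase R β x := by
  obtain ⟨⟨h1, h2, h3, h4, h5, h6⟩, h7, h8, h9, h10, h11, h12⟩ := R.edge_mem hs
  rw [← eq_div_iff_mul_eq', ← inv_inj, inv_div]
  have key : cochainPhase R β (flip R s t x) / cochainPhase R β x =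
      ∏ p ∈ starTris s, (β ((flip R s t x).at p.fst) ((flip R s t x).at p.snd)
          ^ (if p.2 then (1 : ℤ) else -1) /
        β (x.at p.fst) (x.at p.snd) ^ (if p.2 then (1 : ℤ) else -1)) := by
    rw [cochainPhase, cochainPhase, ← Finset.prod_div_distrib]
    refine (Finset.prod_subset (R.starTris_subset s hs) fun p hp hps => ?_).symm
    obtain ⟨k1, k2, k3⟩ := vertices_ne_of_notMem_starTris s hps
    rw [flip_apply, Config.at_add, Config.at_add, gradient_at _ (R.fst_mem hp),
      gradient_at _ (R.snd_mem hp), edgeDiff_fst, edgeDiff_snd, Pi.single_eq_of_ne k1,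
      Pi.single_eq_of_ne k2, Pi.single_eq_of_ne k3]
    simp
  rw [key, prod_starTris]
  obtain ⟨f7, f8, f10, f11, -, -⟩ := hx.star hs
  have hx' : IsFlat R (flip R s t x) := isFlat_flip.2 hx
  obtain ⟨f7', f8', f10', f11', -, -⟩ := hx'.star hs
  have b1 : (p1 s).2 = false := rfl
  have b2 : (p2 s).2 = true := rfl
  have b3 : (p3 s).2 = false := rfl
  have b4 : (p4 s).2 = true := rfl
  have b5 : (p5 s).2 = false := rfl
  have b6 : (p6 s).2 = true := rfl
  have k1 : e1 s ∈ star s := by simp [star]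
  have k2 : e2 s ∈ star s := by simp [star]
  have k3 : e3 s ∈ star s := by simp [star]
  have k4 : e4 s ∈ star s := by simp [star]
  have k5 : e5 s ∈ star s := by simp [star]
  have k6 : e6 s ∈ star s := by simp [star]
  have t0 := add_self_Z2 t
  have c1 := flip_at s t x h1
  have c2 := flip_at s t x h2
  have c3 := flip_at s t x h3
  have c4 := flip_at s t x h4
  have c5 := flip_at s t x h5
  have c6 := flip_at s t x h6
  rw [if_pos (by assumption)] at c1 c2 c3 c4 c5 c6
  have c7 : (flip R s t x).at (e7 s) = x.at (e7 s) := by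
    rw [f7', c1, c2, f7]
    linear_combination (norm := abel) t0
  have c8 : (flip R s t x).at (e8 s) = x.at (e8 s) := by
    rw [f8', c3, c2, f8]
    linear_combination (norm := abel) t0
  have c10 : (flip R s t x).at (e10 s) = x.at (e10 s) := by
    rw [f10', c4, c5, f10]
    linear_combination (norm := abel) t0
  have c11 : (flip R s t x).at (e11 s) = x.at (e11 s) := by
    rw [f11', c6, c5, f11]
    linear_combination (norm := abel) t0
  have d1 : x.at (e7 s) + (x.at (e1 s) + t) = x.at (e2 s) + t := by
    rw [f7]
    linear_combination (norm := abel) add_self_Z2 (x.at (e1 s))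
  have d2 : x.at (e8 s) + (x.at (e3 s) + t) = x.at (e2 s) + t := by
    rw [f8]
    linear_combination (norm := abel) add_self_Z2 (x.at (e3 s))
  have d4 : x.at (e4 s) + x.at (e10 s) = x.at (e5 s) := by
    rw [f10]
    linear_combination (norm := abel) add_self_Z2 (x.at (e4 s))
  have d5 : x.at (e6 s) + x.at (e11 s) = x.at (e5 s) := by
    rw [f11]
    linear_combination (norm := abel) add_self_Z2 (x.at (e6 s))
  have tt : ∀ a : Z2 n, a + t + t = a := fun a => by rw [add_assoc, t0, add_zero]
  simp only [b1, b2, b3, b4, b5, b6, p1_fst, p2_fst, p3_fst, p4_fst, p5_fst, p6_fst, p1_snd,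
    p2_snd, p3_snd, p4_snd, p5_snd, p6_snd, phase, c1, c3, c4, c6, c7, c8, c10, c11, if_true,
    Bool.false_eq_true, if_false, zpow_one, zpow_neg, coboundary, d1, d2, d4, d5, tt,
    add_comm t (x.at (e4 s)), add_comm t (x.at (e6 s))]
  apply Additive.ofMul.injective
  simp only [ofMul_mul, ofMul_div, ofMul_inv]
  abel

/-- Multiplying the cocycle by a coboundary conjugates the model by a diagonal local unitary. -/
lemma isFrustrationFree_mul_coboundary (ω : Cochain3 n) (β : Z2 n → Z2 n → Circle)
    (ψ : Config R n → ℂ) :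
    IsFrustrationFree R (ω * coboundary β) ψ ↔
      IsFrustrationFree R ω (cochainUnitary R β ψ) := by
  have hne : ∀ x, (cochainPhase R β x : ℂ) ≠ 0 := fun x => Circle.coe_ne_zero _
  have hg : ψ ∈ gaugeInvariant R n ↔ cochainUnitary R β ψ ∈ gaugeInvariant R n := by
    simp only [mem_gaugeInvariant_iff_isFlat, cochainUnitary_apply, mul_ne_zero_iff, ne_eq, hne,
      not_false_eq_true, true_and]
  rw [IsFrustrationFree, IsFrustrationFree, ← hg]
  refine and_congr_right fun hψ => forall₃_congr fun s hs t => ?_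
  rw [mem_gaugeInvariant_iff_isFlat] at hψ
  rw [vertexTerm_eq_self_iff, vertexTerm_eq_self_iff]
  refine forall_congr' fun x => ?_
  rw [cochainUnitary_apply, cochainUnitary_apply]
  by_cases hx : IsFlat R x
  · have e := congrArg (fun z : Circle => (z : ℂ)) (phase_coboundary β hs t hx)
    simp only [Circle.coe_mul] at e
    rw [phase_mul, Circle.coe_mul, ← e, ← mul_right_inj' (hne (flip R s t x))]
    ring_nf
  · have h0 : ψ x = 0 := by
      by_contra h
      exact hx (hψ x h)
    have h1 : ψ (flip R s t x) = 0 := by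
      by_contra h
      exact hx (isFlat_flip.1 (hψ _ h))
    simp [h0, h1]

/-- The image of the ground space of a model whose cocycle is multiplied by a coboundary. -/
lemma map_groundSpace_mul_coboundary {T : Z2 n → Z2 n → Z2 n → ZMod 2} (hT : Triadditive T)
    (β : Z2 n → Z2 n → Circle) :
    (groundSpace (hamiltonian R ((fun a b c => sgn (T a b c)) * coboundary β))).map
        (couple R n ∘ₗ (cochainUnitary R β).toLinearMap) =
      (groundSpace (hamiltonian R fun a b c => sgn (T a b c))).map (couple R n) := by
  rw [Submodule.map_comp]
  congr 1
  have hex : ∃ ψ ≠ 0, IsFrustrationFree R ((fun a b c => sgn (T a b c)) * coboundary β) ψ := by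
    refine ⟨(cochainUnitary R β).symm (vacuum R T), ?_, ?_⟩
    · simpa using vacuum_ne_zero hT
    · rw [isFrustrationFree_mul_coboundary, LinearEquiv.apply_symm_apply]
      exact vacuum_isFrustrationFree hT
  ext ψ
  rw [mem_groundSpace_sgn_iff hT, Submodule.mem_map_equiv, mem_groundSpace_iff R hex,
    isFrustrationFree_mul_coboundary, LinearEquiv.apply_symm_apply]

end Coboundary

end TQD

namespace TQD

section Operators

lemma monomial_apply {C : Type*} (π : Equiv.Perm C) (φ : C → Circle) (ψ : C → ℂ) (y : C) :
    monomial π φ ψ y = (φ (π.symm y) : ℂ) * ψ (π.symm y) := rfl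

lemma monomial_mul {C : Type*} (π π' : Equiv.Perm C) (φ φ' : C → Circle) :
    monomial π φ * monomial π' φ' = monomial (π * π') fun x => φ' x * φ (π' x) := by
  refine LinearEquiv.ext fun ψ => funext fun y => ?_
  change (φ (π.symm y) : ℂ) * ((φ' (π'.symm (π.symm y)) : ℂ) * ψ (π'.symm (π.symm y))) =
    ((φ' (π'.symm (π.symm y)) * φ (π' (π'.symm (π.symm y))) : Circle) : ℂ) *
      ψ (π'.symm (π.symm y))
  rw [Equiv.apply_symm_apply, Circle.coe_mul]
  ring

lemma monomial_one_one {C : Type*} : monomial (1 : Equiv.Perm C) 1 = 1 := by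
  refine LinearEquiv.ext fun ψ => funext fun y => ?_
  change ((1 : Circle) : ℂ) * ψ y = ψ y
  rw [Circle.coe_one, one_mul]

variable {Q : Type*}

/-- The product of the operators `X` on all qubits where `v` does not vanish. -/
noncomputable def shiftX (v : Q → ZMod 2) : Op Q := monomial (Equiv.addRight v) 1

/-- The diagonal operator with the given phases. -/
noncomputable def diagOp (φ : (Q → ZMod 2) → Circle) : Op Q := monomial 1 φ

lemma diagOp_mul (φ φ' : (Q → ZMod 2) → Circle) : diagOp φ * diagOp φ' = diagOp (φ * φ') := by
  rw [diagOp, diagOp, monomial_mul, mul_one]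
  congr 1
  funext x
  exact mul_comm _ _

lemma diagOp_one : diagOp (1 : (Q → ZMod 2) → Circle) = 1 := monomial_one_one

lemma diagOp_inv (φ : (Q → ZMod 2) → Circle) : (diagOp φ)⁻¹ = diagOp φ⁻¹ :=
  inv_eq_of_mul_eq_one_right (by rw [diagOp_mul, mul_inv_cancel, diagOp_one])

lemma diagOp_pow (φ : (Q → ZMod 2) → Circle) (k : ℕ) : diagOp φ ^ k = diagOp (φ ^ k) := by
  induction k with
  | zero => rw [pow_zero, pow_zero, diagOp_one]
  | succ k ih => rw [pow_succ, ih, diagOp_mul, pow_succ]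

lemma diagOp_apply (φ : (Q → ZMod 2) → Circle) (χ : (Q → ZMod 2) → ℂ) (z : Q → ZMod 2) :
    diagOp φ χ z = φ z * χ z := rfl

lemma diagOp_eq_self_iff {φ : (Q → ZMod 2) → Circle} {χ : (Q → ZMod 2) → ℂ} :
    diagOp φ χ = χ ↔ ∀ z, χ z ≠ 0 → φ z = 1 := by
  rw [funext_iff]
  refine forall_congr' fun z => ?_
  rw [diagOp_apply]
  by_cases h : χ z = 0
  · simp [h]
  · simp [h, mul_eq_right₀ h, Circle.coe_eq_one]

lemma shiftX_mul (v w : Q → ZMod 2) : shiftX v * shiftX w = shiftX (v + w) := by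
  rw [shiftX, shiftX, monomial_mul, shiftX]
  congr 1
  · ext1 x
    simp only [Equiv.Perm.mul_apply, Equiv.coe_addRight]
    abel
  · funext x
    simp

lemma shiftX_zero : shiftX (0 : Q → ZMod 2) = 1 := by
  rw [shiftX, ← monomial_one_one]
  congr 1
  ext1 x
  simp

lemma shiftX_mul_diagOp (v : Q → ZMod 2) (φ : (Q → ZMod 2) → Circle) :
    shiftX v * diagOp φ = monomial (Equiv.addRight v) φ := by
  rw [shiftX, diagOp, monomial_mul, mul_one]
  congr 1
  funext x
  simp

lemma diagOp_mul_shiftX (v : Q → ZMod 2) (φ : (Q → ZMod 2) → Circle) :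
    diagOp φ * shiftX v = shiftX v * diagOp fun x => φ (x + v) := by
  rw [shiftX_mul_diagOp, shiftX, diagOp, monomial_mul, one_mul]
  congr 1
  funext x
  simp

/-- The phase `i^a`. -/
noncomputable def iPow (a : ZMod 2) : Circle := if a = 0 then 1 else Circle.exp (Real.pi / 2)

lemma iPow_zero : iPow 0 = 1 := if_pos rfl

lemma iPow_one_mul_self : iPow 1 * iPow 1 = -1 := by
  ext
  simp [iPow, Complex.exp_pi_div_two_mul_I]

lemma iPow_mul_self (a : ZMod 2) : iPow a * iPow a = sgn a := by
  rcases (by decide : ∀ a : ZMod 2, a = 0 ∨ a = 1) a with rfl | rfl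
  · simp [iPow_zero]
  · rw [iPow_one_mul_self, sgn_one]

lemma iPow_pow_three (a : ZMod 2) : iPow a ^ 3 = sgn a * iPow a := by
  rw [pow_succ, pow_two, iPow_mul_self]

lemma iPow_add (a b : ZMod 2) : iPow (a + b) = iPow a * iPow b * sgn (a * b) := by
  rcases (by decide : ∀ a : ZMod 2, a = 0 ∨ a = 1) a with rfl | rfl <;>
    rcases (by decide : ∀ a : ZMod 2, a = 0 ∨ a = 1) b with rfl | rfl
  · simp [iPow_zero]
  · simp [iPow_zero]
  · simp [iPow_zero]
  · rw [iPow_one_mul_self, mul_one, sgn_one, CharTwo.add_self_eq_zero, iPow_zero]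
    ext
    simp

/-- A controlled sign in terms of phases `i`. -/
lemma iPow_cube_mul (a b : ZMod 2) : iPow a ^ 3 * iPow b ^ 3 * iPow (a + b) = sgn (a * b) := by
  rw [iPow_add, iPow_pow_three, iPow_pow_three]
  calc _ = (sgn a * (iPow a * iPow a)) * (sgn b * (iPow b * iPow b)) * sgn (a * b) := by
        apply Additive.ofMul.injective
        simp only [ofMul_mul]
        abel
    _ = _ := by rw [iPow_mul_self, iPow_mul_self, sgn_mul_self, sgn_mul_self, one_mul, one_mul]

lemma opS_eq (q : Q) : opS q = diagOp fun z => iPow (z q) := rfl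

lemma opZ_eq (q : Q) : opS q ^ 2 = diagOp fun z => sgn (z q) := by
  rw [opS_eq, diagOp_pow]
  congr 1
  funext z
  rw [Pi.pow_apply, pow_two, iPow_mul_self]

lemma mem_code_closure {S : Set (Op Q)} {χ : (Q → ZMod 2) → ℂ} :
    χ ∈ code (Subgroup.closure S) ↔ ∀ g ∈ S, g χ = χ := by
  refine ⟨fun h g hg => h g (Subgroup.subset_closure hg), fun h g hg => ?_⟩
  induction hg using Subgroup.closure_induction with
  | mem g hg => exact h g hg
  | one => rfl
  | mul g g' _ _ hg hg' =>
    change g (g' χ) = χ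
    rw [hg', hg]
  | inv g _ hg =>
    change g.symm χ = χ
    rw [LinearEquiv.symm_apply_eq, hg]

variable [DecidableEq Q]

lemma opX_eq (q : Q) : opX q = shiftX (Pi.single q 1) := rfl

lemma pauliS_mono {K K' : Set Q} (h : K ⊆ K') : pauliS K ≤ pauliS K' :=
  Subgroup.closure_mono (by gcongr)

lemma opX_mem_pauliS {K : Set Q} {q : Q} (h : q ∈ K) : opX q ∈ pauliS K :=
  Subgroup.subset_closure (Or.inl (Or.inr ⟨q, h, rfl⟩))

lemma opS_mem_pauliS {K : Set Q} {q : Q} (h : q ∈ K) : opS q ∈ pauliS K :=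
  Subgroup.subset_closure (Or.inr ⟨q, h, rfl⟩)

lemma shiftX_mem_pauliS [Fintype Q] {K : Set Q} {v : Q → ZMod 2} (h : ∀ q, v q ≠ 0 → q ∈ K) :
    shiftX v ∈ pauliS K := by
  have e : ∑ q, Pi.single q (v q) = v := Finset.univ_sum_single v
  rw [← e]
  refine Finset.sum_induction _ (fun v => shiftX v ∈ pauliS K) (fun v w hv hw => ?_) ?_
    fun q _ => ?_
  · rw [← shiftX_mul]
    exact mul_mem hv hw
  · rw [shiftX_zero]
    exact one_mem _
  · rcases (by decide : ∀ a : ZMod 2, a = 0 ∨ a = 1) (v q) with e | e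
    · rw [e, Pi.single_zero, shiftX_zero]
      exact one_mem _
    · rw [e, ← opX_eq]
      exact opX_mem_pauliS (h q (by rw [e]; decide))

end Operators

section Describe

variable {L M n : ℕ} {R : Patch L M}

/-- The change of a configuration by the vertex operators. -/
def flipVec (R : Patch L M) (s : Vert L M) (t : Z2 n) : Config R n :=
  fun e => if e.1 ∈ star s then t else 0

lemma encode_add (x y : Config R n) : encode R (x + y) = encode R x + encode R y := by
  funext q
  rcases q with q | q
  · rfl
  · simp only [encode, Sum.elim_inr, Config.at_add, Pi.add_apply]
    ring

lemma encode_sub (x y : Config R n) : encode R (x - y) = encode R x - encode R y := by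
  rw [eq_sub_iff_add_eq, ← encode_add, sub_add_cancel]

lemma encode_injective : Function.Injective (encode R (n := n)) := fun _ _ h =>
  funext fun e => funext fun σ => congrFun h (Sum.inl (e, σ))

lemma couple_encode (ψ : Config R n → ℂ) (x : Config R n) : couple R n ψ (encode R x) = ψ x := by
  change ∑ y : Config R n, (if encode R y = encode R x then ψ y else 0) = ψ x
  simp [encode_injective.eq_iff]

lemma couple_eq_zero (ψ : Config R n → ℂ) {z : Qubits R n → ZMod 2}
    (hz : z ∉ Set.range (encode R)) : couple R n ψ z = 0 :=
  Finset.sum_eq_zero fun x _ => if_neg fun h => hz ⟨x, h⟩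

lemma couple_injective : Function.Injective (couple R n) := fun ψ ψ' h => funext fun x => by
  rw [← couple_encode ψ, h, couple_encode]

lemma exists_of_couple_ne_zero {ψ : Config R n → ℂ} {z : Qubits R n → ZMod 2}
    (h : couple R n ψ z ≠ 0) : ∃ x, encode R x = z ∧ ψ x ≠ 0 := by
  by_cases hz : z ∈ Set.range (encode R)
  · obtain ⟨x, rfl⟩ := hz
    exact ⟨x, rfl, by rwa [couple_encode] at h⟩
  · exact absurd (couple_eq_zero ψ hz) h

lemma couple_eq_of_support {χ : (Qubits R n → ZMod 2) → ℂ}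
    (h : ∀ z, χ z ≠ 0 → z ∈ Set.range (encode R)) : couple R n (fun x => χ (encode R x)) = χ := by
  funext z
  by_cases hz : z ∈ Set.range (encode R)
  · obtain ⟨x, rfl⟩ := hz
    rw [couple_encode]
  · rw [couple_eq_zero _ hz]
    by_contra h'
    exact hz (h z (Ne.symm h'))

/-- A product of `X` operators and phases acts as the vertex operators do if it has the same
phases on flat configurations. -/
lemma shiftX_mul_diagOp_couple {ω : Cochain3 n} {s : Vert L M} {t : Z2 n}
    {φ : (Qubits R n → ZMod 2) → Circle}
    (h : ∀ x : Config R n, IsFlat R x → φ (encode R x) = phase ω s t x) {ψ : Config R n → ℂ}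
    (hψ : ψ ∈ gaugeInvariant R n) :
    (shiftX (encode R (flipVec R s t)) * diagOp φ) (couple R n ψ) =
      couple R n (vertexTerm R ω s t ψ) := by
  rw [mem_gaugeInvariant_iff_isFlat] at hψ
  rw [shiftX_mul_diagOp]
  funext z
  rw [monomial_apply]
  have e : (Equiv.addRight (encode R (flipVec R s t))).symm z = z - encode R (flipVec R s t) := by
    rw [Equiv.symm_apply_eq]
    exact (sub_add_cancel z _).symm
  rw [e]
  by_cases hz : z ∈ Set.range (encode R)
  · obtain ⟨w, rfl⟩ := hz
    rw [couple_encode, ← encode_sub, couple_encode, vertexTerm, monomial_apply]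
    have e' : (flip R s t).symm w = w - flipVec R s t := by
      rw [Equiv.symm_apply_eq]
      exact (sub_add_cancel w (flipVec R s t)).symm
    rw [e']
    by_cases hx : ψ (w - flipVec R s t) = 0
    · rw [hx, mul_zero, mul_zero]
    · rw [h _ (hψ _ hx)]
  · rw [couple_eq_zero _ hz, couple_eq_zero, mul_zero]
    rintro ⟨w, hw⟩
    exact hz ⟨w + flipVec R s t, by rw [encode_add, hw, sub_add_cancel]⟩

lemma edgeZ_eq {e : Edge L M} (he : e ∈ R.edges) (σ : Fin n) :
    edgeZ R e σ = diagOp fun z => sgn (z (Sum.inl (⟨e, he⟩, σ))) := by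
  rw [edgeZ, edgeS, dif_pos he, opZ_eq]

lemma ancZ_eq {p : Tri L M} (hp : p ∈ R.tris) (y : LayerPair n) :
    ancZ R p y = diagOp fun z => sgn (z (Sum.inr (⟨p, hp⟩, y))) := by
  rw [ancZ, ancS, dif_pos hp, opZ_eq]

lemma edgeZ_mem (e : Edge L M) (σ : Fin n) : edgeZ R e σ ∈ pauliS Set.univ := by
  rw [edgeZ, edgeS]
  split_ifs
  · exact pow_mem (opS_mem_pauliS (Set.mem_univ _)) _
  · simp

lemma ancZ_mem (p : Tri L M) (y : LayerPair n) : ancZ R p y ∈ pauliS Set.univ := by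
  rw [ancZ, ancS]
  split_ifs
  · exact pow_mem (opS_mem_pauliS (Set.mem_univ _)) _
  · simp

lemma sgn_eq_one_iff {a : ZMod 2} : sgn a = 1 ↔ a = 0 := by
  rw [← sgn_zero, sgn_injective.eq_iff]

lemma edgeZ_mul_eq_self_iff {p : Tri L M} (hp : p ∈ R.tris) {σ : Fin n}
    {χ : (Qubits R n → ZMod 2) → ℂ} :
    (edgeZ R p.fst σ * edgeZ R p.snd σ * edgeZ R p.thd σ) χ = χ ↔
      ∀ z, χ z ≠ 0 → z (Sum.inl (⟨p.fst, R.fst_mem hp⟩, σ)) + z (Sum.inl (⟨p.snd, R.snd_mem hp⟩, σ))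
        + z (Sum.inl (⟨p.thd, R.thd_mem hp⟩, σ)) = 0 := by
  rw [edgeZ_eq (R.fst_mem hp), edgeZ_eq (R.snd_mem hp), edgeZ_eq (R.thd_mem hp), diagOp_mul,
    diagOp_mul, diagOp_eq_self_iff]
  simp only [Pi.mul_apply, ← sgn_add, sgn_eq_one_iff]

lemma ancZ_mul_eq_self_iff {p : Tri L M} (hp : p ∈ R.tris) {y : LayerPair n}
    {χ : (Qubits R n → ZMod 2) → ℂ} :
    (edgeZ R p.fst y.1.1 * edgeZ R p.snd y.1.2 * ancZ R p y) χ = χ ↔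
      ∀ z, χ z ≠ 0 → z (Sum.inl (⟨p.fst, R.fst_mem hp⟩, y.1.1))
        + z (Sum.inl (⟨p.snd, R.snd_mem hp⟩, y.1.2)) + z (Sum.inr (⟨p, hp⟩, y)) = 0 := by
  rw [edgeZ_eq (R.fst_mem hp), edgeZ_eq (R.snd_mem hp), ancZ_eq hp, diagOp_mul,
    diagOp_mul, diagOp_eq_self_iff]
  simp only [Pi.mul_apply, ← sgn_add, sgn_eq_one_iff]

lemma Config.at_mem (x : Config R n) {e : Edge L M} (he : e ∈ R.edges) : x.at e = x ⟨e, he⟩ :=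
  dif_pos he

/-- The Z-type stabilizers single out the coupled gauge-invariant subspace. -/
lemma exists_gaugeInvariant_of_zType {χ : (Qubits R n → ZMod 2) → ℂ}
    (h : ∀ p ∈ R.tris, ∀ σ, (edgeZ R p.fst σ * edgeZ R p.snd σ * edgeZ R p.thd σ) χ = χ)
    (h' : ∀ p ∈ R.tris, ∀ y : LayerPair n,
      (edgeZ R p.fst y.1.1 * edgeZ R p.snd y.1.2 * ancZ R p y) χ = χ) :
    ∃ ψ ∈ gaugeInvariant R n, couple R n ψ = χ := by
  refine ⟨fun x => χ (encode R x), (mem_gaugeInvariant_iff_isFlat R).2 fun x hx p hp => ?_,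
    couple_eq_of_support fun z hz => ⟨fun e σ => z (Sum.inl (e, σ)), ?_⟩⟩
  · funext σ
    have := (edgeZ_mul_eq_self_iff hp).1 (h p hp σ) _ hx
    rw [x.at_mem (R.fst_mem hp), x.at_mem (R.snd_mem hp), x.at_mem (R.thd_mem hp)]
    exact this
  · funext q
    rcases q with q | ⟨⟨p, hp⟩, y⟩
    · rfl
    · have := (ancZ_mul_eq_self_iff hp).1 (h' p hp y) z hz
      change Config.at _ p.fst y.1.1 + Config.at _ p.snd y.1.2 = _
      rw [Config.at_mem _ (R.fst_mem hp), Config.at_mem _ (R.snd_mem hp)]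
      grind

lemma zType_couple {ψ : Config R n → ℂ} (hψ : ψ ∈ gaugeInvariant R n) {p : Tri L M}
    (hp : p ∈ R.tris) (σ : Fin n) :
    (edgeZ R p.fst σ * edgeZ R p.snd σ * edgeZ R p.thd σ) (couple R n ψ) = couple R n ψ := by
  rw [edgeZ_mul_eq_self_iff hp]
  intro z hz
  obtain ⟨x, rfl, hx⟩ := exists_of_couple_ne_zero hz
  have := congrFun ((mem_gaugeInvariant_iff_isFlat R).1 hψ x hx p hp) σ
  rw [x.at_mem (R.fst_mem hp), x.at_mem (R.snd_mem hp), x.at_mem (R.thd_mem hp)] at this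
  exact this

lemma ancZ_couple (ψ : Config R n → ℂ) {p : Tri L M} (hp : p ∈ R.tris) (y : LayerPair n) :
    (edgeZ R p.fst y.1.1 * edgeZ R p.snd y.1.2 * ancZ R p y) (couple R n ψ) = couple R n ψ := by
  rw [ancZ_mul_eq_self_iff hp]
  intro z hz
  obtain ⟨x, rfl, hx⟩ := exists_of_couple_ne_zero hz
  change x ⟨_, _⟩ _ + x ⟨_, _⟩ _ + (x.at p.fst y.1.1 + x.at p.snd y.1.2) = 0
  rw [x.at_mem (R.fst_mem hp), x.at_mem (R.snd_mem hp)]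
  grind

/-- Vertex stabilizers describe a model as soon as they belong to the Pauli-S group and coincide
with the vertex operators on gauge-invariant states. -/
lemma describes_of_coincide [Nontrivial (ZMod L)] [Nontrivial (ZMod M)]
    {T : Z2 n → Z2 n → Z2 n → ZMod 2} (hT : Triadditive T)
    {𝒜 : Vert L M → Fin n → Op (Qubits R n)}
    (h1 : ∀ s ∈ R.verts, ∀ σ, 𝒜 s σ ∈ pauliS (near R n s))
    (h2 : ∀ s ∈ R.verts, ∀ σ, ∀ ψ ∈ gaugeInvariant R n, 𝒜 s σ (couple R n ψ) =
      couple R n (vertexTerm R (fun a b c => sgn (T a b c)) s (Pi.single σ 1) ψ)) :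
    Describes R (fun a b c => sgn (T a b c)) 𝒜 := by
  have hmap : (groundSpace (hamiltonian R fun a b c => sgn (T a b c))).map (couple R n) =
      code (stabilizerGroup R 𝒜) := by
    ext χ
    rw [stabilizerGroup, mem_code_closure, Submodule.mem_map]
    constructor
    · rintro ⟨ψ, hψ, rfl⟩
      rw [mem_groundSpace_sgn_iff hT] at hψ
      rintro g ((⟨p, hp, σ, rfl⟩ | ⟨p, hp, y, rfl⟩) | ⟨s, hs, σ, rfl⟩)
      · exact zType_couple hψ.1 hp σ
      · exact ancZ_couple ψ hp y
      · rw [h2 s hs σ ψ hψ.1, hψ.2 s hs]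
    · intro h
      obtain ⟨ψ, hψ, rfl⟩ := exists_gaugeInvariant_of_zType
        (fun p hp σ => h _ (Or.inl (Or.inl ⟨p, hp, σ, rfl⟩)))
        (fun p hp y => h _ (Or.inl (Or.inr ⟨p, hp, y, rfl⟩)))
      refine ⟨ψ, (mem_groundSpace_sgn_iff hT ψ).2 (isFrustrationFree_of_single hT hψ
        fun s hs σ => couple_injective ?_), rfl⟩
      rw [← h2 s hs σ ψ hψ]
      exact h _ (Or.inr ⟨s, hs, σ, rfl⟩)
  refine ⟨h1, h2, ⟨?_, ?_⟩, hmap⟩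
  · rw [stabilizerGroup, Subgroup.closure_le]
    rintro g ((⟨p, hp, σ, rfl⟩ | ⟨p, hp, y, rfl⟩) | ⟨s, hs, σ, rfl⟩)
    · exact mul_mem (mul_mem (edgeZ_mem _ _) (edgeZ_mem _ _)) (edgeZ_mem _ _)
    · exact mul_mem (mul_mem (edgeZ_mem _ _) (edgeZ_mem _ _)) (ancZ_mem _ _)
    · exact pauliS_mono (Set.subset_univ _) (h1 s hs σ)
  · rw [← hmap, Submodule.ne_bot_iff]
    refine ⟨couple R n (vacuum R T), Submodule.mem_map_of_mem
      ((mem_groundSpace_sgn_iff hT _).2 (vacuum_isFrustrationFree hT)), ?_⟩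
    exact (map_ne_zero_iff _ couple_injective).2 (vacuum_ne_zero hT)

end Describe

end TQD

namespace TQD

section Realize

variable {L M n : ℕ} {R : Patch L M} {s : Vert L M}

lemma edges_of_mem_starTris {p : Tri L M} (hp : p ∈ starTris s) :
    p.fst ∈ star s ∪ link s ∧ p.snd ∈ star s ∪ link s ∧ p.thd ∈ star s ∪ link s := by
  simp only [starTris, Finset.mem_insert, Finset.mem_singleton] at hp
  rcases hp with rfl | rfl | rfl | rfl | rfl | rfl
  · rw [p1_fst, p1_snd, p1_thd]; simp [star, link]
  · rw [p2_fst, p2_snd, p2_thd]; simp [star, link]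
  · rw [p3_fst, p3_snd, p3_thd]; simp [star, link]
  · rw [p4_fst, p4_snd, p4_thd]; simp [star, link]
  · rw [p5_fst, p5_snd, p5_thd]; simp [star, link]
  · rw [p6_fst, p6_snd, p6_thd]; simp [star, link]

/-- The sign `(-1)^A` on flat configurations is the action of a diagonal Pauli-S operator on the
qubits around `s`. -/
def IsRealizable (R : Patch L M) (s : Vert L M) (A : Config R n → ZMod 2) : Prop :=
  ∃ φ : (Qubits R n → ZMod 2) → Circle, diagOp φ ∈ pauliS (near R n s) ∧
    ∀ x, IsFlat R x → φ (encode R x) = sgn (A x)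

lemma IsRealizable.add {A A' : Config R n → ZMod 2} (h : IsRealizable R s A)
    (h' : IsRealizable R s A') : IsRealizable R s fun x => A x + A' x := by
  obtain ⟨φ, hφ, e⟩ := h
  obtain ⟨φ', hφ', e'⟩ := h'
  exact ⟨φ * φ', diagOp_mul φ φ' ▸ mul_mem hφ hφ', fun x hx => by
    rw [Pi.mul_apply, e x hx, e' x hx, sgn_add]⟩

lemma isRealizable_zero : IsRealizable R s (fun _ : Config R n => 0) :=
  ⟨1, diagOp_one (Q := Qubits R n) ▸ one_mem _, fun x _ => by rw [Pi.one_apply, sgn_zero]⟩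

lemma IsRealizable.const_mul {A : Config R n → ZMod 2} (h : IsRealizable R s A) (c : ZMod 2) :
    IsRealizable R s fun x => c * A x := by
  rcases (by decide : ∀ a : ZMod 2, a = 0 ∨ a = 1) c with rfl | rfl
  · simpa using isRealizable_zero
  · simpa using h

lemma IsRealizable.sum {ι : Type*} (S : Finset ι) {A : ι → Config R n → ZMod 2}
    (h : ∀ i ∈ S, IsRealizable R s (A i)) : IsRealizable R s fun x => ∑ i ∈ S, A i x := by
  have := Finset.sum_induction A (IsRealizable R s) (fun _ _ => IsRealizable.add)
    isRealizable_zero h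
  convert this using 1
  funext x
  rw [Finset.sum_apply]

lemma isRealizable_edge {e : Edge L M} (he : e ∈ R.edges) (hs : e ∈ star s ∪ link s) (σ : Fin n) :
    IsRealizable R s fun x : Config R n => x.at e σ := by
  refine ⟨fun z => sgn (z (Sum.inl (⟨e, he⟩, σ))), ?_, fun x _ => ?_⟩
  · rw [← opZ_eq]
    exact pow_mem (opS_mem_pauliS (show Sum.inl (⟨e, he⟩, σ) ∈ near R n s from hs)) 2
  · simp only [x.at_mem he]
    rfl

lemma isRealizable_mul {p : Tri L M} (hp : p ∈ R.tris) (hs : p ∈ starTris s) {σ τ : Fin n}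
    (h : σ ≤ τ) : IsRealizable R s fun x : Config R n => x.at p.fst σ * x.at p.snd τ := by
  obtain ⟨k1, k2, k3⟩ := edges_of_mem_starTris hs
  have m1 := R.fst_mem hp
  have m2 := R.snd_mem hp
  have m3 := R.thd_mem hp
  have key : ∀ q : Qubits R n, q ∈ near R n s →
      (∀ x, IsFlat R x → encode R x q = x.at p.fst σ + x.at p.snd τ) →
      IsRealizable R s fun x : Config R n => x.at p.fst σ * x.at p.snd τ := by
    intro q hq hx
    refine ⟨(fun z => iPow (z (Sum.inl (⟨p.fst, m1⟩, σ)))) ^ 3 *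
      (fun z => iPow (z (Sum.inl (⟨p.snd, m2⟩, τ)))) ^ 3 * fun z => iPow (z q), ?_, ?_⟩
    · rw [← diagOp_mul, ← diagOp_mul, ← diagOp_pow, ← diagOp_pow]
      exact mul_mem (mul_mem
        (pow_mem (opS_mem_pauliS (show Sum.inl (⟨p.fst, m1⟩, σ) ∈ near R n s from k1)) 3)
        (pow_mem (opS_mem_pauliS (show Sum.inl (⟨p.snd, m2⟩, τ) ∈ near R n s from k2)) 3))
        (opS_mem_pauliS hq)
    · intro x hf
      rw [← iPow_cube_mul, ← hx x hf, x.at_mem m1, x.at_mem m2]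
      rfl
  rcases h.lt_or_eq with h | rfl
  · exact key (Sum.inr (⟨p, hp⟩, ⟨(σ, τ), h⟩)) hs fun x _ => rfl
  · refine key (Sum.inl (⟨p.thd, m3⟩, σ)) k3 fun x hx => ?_
    have e := congrFun (hx p hp) σ
    change x ⟨p.thd, m3⟩ σ = _
    rw [← x.at_mem m3]
    simp only [Pi.add_apply, Pi.zero_apply] at e
    grind

/-- The phases of the vertex operators are realized by Pauli-S operators if the cocycle only
involves increasing triples of layers. -/
lemma isRealizable_phaseExp {τ : Fin n → Fin n → Fin n → ZMod 2}
    (hτ : ∀ i j k, τ i j k ≠ 0 → i ≤ j ∧ j ≤ k) (hs : s ∈ R.verts) (t : Z2 n) :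
    IsRealizable R s fun x : Config R n => phaseExp (trilinear τ) s t x := by
  obtain ⟨h1, h2, h3, h4, h5, h6⟩ := R.tri_mem hs
  have m1 : p1 s ∈ starTris s := by simp [starTris]
  have m2 : p2 s ∈ starTris s := by simp [starTris]
  have m3 : p3 s ∈ starTris s := by simp [starTris]
  have m4 : p4 s ∈ starTris s := by simp [starTris]
  have m5 : p5 s ∈ starTris s := by simp [starTris]
  have m6 : p6 s ∈ starTris s := by simp [starTris]
  have first : ∀ p ∈ R.tris, p ∈ starTris s →
      IsRealizable R s fun x : Config R n => trilinear τ t (x.at p.fst) (x.at p.snd) := by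
    intro p hp hps
    refine .sum _ fun i _ => .sum _ fun j _ => .sum _ fun k _ => ?_
    by_cases h : τ i j k = 0
    · simpa [h] using isRealizable_zero
    · convert (isRealizable_mul hp hps (hτ i j k h).2).const_mul (τ i j k * t i) using 2
      ring
  have second : ∀ p ∈ R.tris, p ∈ starTris s →
      IsRealizable R s fun x : Config R n => trilinear τ (x.at p.fst + t) t (x.at p.snd) := by
    intro p hp hps
    refine .sum _ fun i _ => .sum _ fun j _ => .sum _ fun k _ => ?_
    by_cases h : τ i j k = 0
    · simpa [h] using isRealizable_zero
    · convert ((isRealizable_mul hp hps ((hτ i j k h).1.trans (hτ i j k h).2)).const_mul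
        (τ i j k * t j)).add ((isRealizable_edge (R.snd_mem hp) (edges_of_mem_starTris hps).2.1
          k).const_mul (τ i j k * t i * t j)) using 2
      rw [Pi.add_apply]
      ring
  have third : ∀ p ∈ R.tris, p ∈ starTris s →
      IsRealizable R s fun x : Config R n => trilinear τ (x.at p.fst) (x.at p.snd + t) t := by
    intro p hp hps
    refine .sum _ fun i _ => .sum _ fun j _ => .sum _ fun k _ => ?_
    by_cases h : τ i j k = 0
    · simpa [h] using isRealizable_zero
    · convert ((isRealizable_mul hp hps (hτ i j k h).1).const_mul
        (τ i j k * t k)).add ((isRealizable_edge (R.fst_mem hp) (edges_of_mem_starTris hps).1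
          i).const_mul (τ i j k * t j * t k)) using 2
      rw [Pi.add_apply]
      ring
  have r1 := third _ h1 m1
  have r2 := third _ h2 m2
  have r3 := second _ h3 m3
  have r4 := first _ h4 m4
  have r5 := first _ h5 m5
  have r6 := second _ h6 m6
  simp only [p1_fst, p2_fst, p3_fst, p4_fst, p5_fst, p6_fst, p1_snd, p2_snd, p3_snd, p4_snd,
    p5_snd, p6_snd] at r1 r2 r3 r4 r5 r6
  exact ((r4.add r3).add r2).add ((r5.add r6).add r1)

lemma mem_starTris_of_fst_mem {p : Tri L M} (h : p.fst ∈ star s) : p ∈ starTris s := by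
  obtain ⟨v, b⟩ := p
  cases b <;> simp_all [starTris, star, Tri.fst, p1, p2, p3, p4, p5, p6, e1, e2, e3, e4, e5, e6]
  all_goals tauto

lemma mem_starTris_of_snd_mem {p : Tri L M} (h : p.snd ∈ star s) : p ∈ starTris s := by
  obtain ⟨v, b⟩ := p
  cases b <;> simp_all [starTris, star, Tri.snd, p1, p2, p3, p4, p5, p6, e1, e2, e3, e4, e5, e6,
    eq_sub_iff_add_eq]
  all_goals
    simp only [add_assoc, Prod.mk_add_mk, zero_add, add_zero] at h
    tauto

lemma shiftX_encode_mem (t : Z2 n) : shiftX (encode R (flipVec R s t)) ∈ pauliS (near R n s) := by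
  refine shiftX_mem_pauliS (Q := Qubits R n) fun q hq => ?_
  have h0 : ∀ e : Edge L M, e ∉ star s → (flipVec R s t).at e = 0 := by
    intro e he
    unfold Config.at
    split_ifs
    · exact if_neg he
    · rfl
  rcases q with ⟨⟨e, he⟩, σ⟩ | ⟨⟨p, hp⟩, y⟩
  · change e ∈ star s ∪ link s
    refine Finset.mem_union_left _ ?_
    by_contra h
    have := h0 e h
    rw [Config.at_mem _ he] at this
    exact hq (congrFun this σ)
  · change p ∈ starTris s
    by_contra h
    have k1 := h0 p.fst fun h' => h (mem_starTris_of_fst_mem h')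
    have k2 := h0 p.snd fun h' => h (mem_starTris_of_snd_mem h')
    refine hq ?_
    change (flipVec R s t).at p.fst _ + (flipVec R s t).at p.snd _ = 0
    rw [k1, k2]
    rfl

/-- XS-stabilizers for all products of the generating cocycles. -/
lemma exists_describes [Nontrivial (ZMod L)] [Nontrivial (ZMod M)] (κ : TwistData n)
    (R : Patch L M) : ∃ 𝒜 : Vert L M → Fin n → Op (Qubits R n), Describes R κ.cocycle 𝒜 := by
  have hreal : ∀ s (σ : Fin n), ∃ φ : (Qubits R n → ZMod 2) → Circle, s ∈ R.verts →
      diagOp φ ∈ pauliS (near R n s) ∧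
      ∀ x, IsFlat R x → φ (encode R x) = sgn (phaseExp (trilinear κ.coeff) s (Pi.single σ 1) x) := by
    intro s σ
    by_cases hs : s ∈ R.verts
    · obtain ⟨φ, hφ⟩ := isRealizable_phaseExp (fun i j k => κ.coeff_ne_zero) hs (Pi.single σ 1)
      exact ⟨φ, fun _ => hφ⟩
    · exact ⟨1, fun h => absurd h hs⟩
  choose φ hφ using hreal
  refine ⟨fun s σ => shiftX (encode R (flipVec R s (Pi.single σ 1))) * diagOp (φ s σ), ?_⟩
  rw [κ.cocycle_eq]
  refine describes_of_coincide (triadditive_trilinear κ.coeff)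
    (fun s hs σ => mul_mem (shiftX_encode_mem _) (hφ s σ hs).1) fun s hs σ ψ hψ =>
      shiftX_mul_diagOp_couple (fun x hx => ?_) hψ
  rw [phase_sgn]
  exact (hφ s σ hs).2 x hx

end Realize

end TQD

namespace TQD

section Explicit

variable {L M n : ℕ} {R : Patch L M} {s : Vert L M}

lemma edgeX_eq {e : Edge L M} (he : e ∈ R.edges) (σ : Fin n) :
    edgeX R e σ = shiftX (Pi.single (Sum.inl (⟨e, he⟩, σ)) 1) := dif_pos he

lemma edgeS_eq {e : Edge L M} (he : e ∈ R.edges) (σ : Fin n) :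
    edgeS R e σ = diagOp fun z => iPow (z (Sum.inl (⟨e, he⟩, σ))) := dif_pos he

lemma ancX_eq {p : Tri L M} (hp : p ∈ R.tris) (y : LayerPair n) :
    ancX R p y = shiftX (Pi.single (Sum.inr (⟨p, hp⟩, y)) 1) := dif_pos hp

lemma ancS_eq {p : Tri L M} (hp : p ∈ R.tris) (y : LayerPair n) :
    ancS R p y = diagOp fun z => iPow (z (Sum.inr (⟨p, hp⟩, y))) := dif_pos hp

lemma edgeS_mem {e : Edge L M} (h : e ∈ star s ∪ link s) (σ : Fin n) :
    edgeS R e σ ∈ pauliS (near R n s) := by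
  rw [edgeS]
  split_ifs with he
  · exact opS_mem_pauliS (show Sum.inl (⟨e, he⟩, σ) ∈ near R n s from h)
  · exact one_mem _

lemma edgeZ_mem_near {e : Edge L M} (h : e ∈ star s ∪ link s) (σ : Fin n) :
    edgeZ R e σ ∈ pauliS (near R n s) := pow_mem (edgeS_mem h σ) 2

lemma ancS_mem {p : Tri L M} (h : p ∈ starTris s) (y : LayerPair n) :
    ancS R p y ∈ pauliS (near R n s) := by
  rw [ancS]
  split_ifs with hp
  · exact opS_mem_pauliS (show Sum.inr (⟨p, hp⟩, y) ∈ near R n s from h)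
  · exact one_mem _

/-- The indicator function of layer `σ` of the star of `s`. -/
def edgeIndicator (R : Patch L M) (s : Vert L M) (σ : Fin n) : Qubits R n → ZMod 2 :=
  Sum.elim (fun q => if q.1.1 ∈ star s ∧ q.2 = σ then 1 else 0) 0

/-- The indicator function of the ancillas for a pair of layers on a set of triangles. -/
def ancIndicator (R : Patch L M) (F : Tri L M → Prop) [DecidablePred F] (y : LayerPair n) :
    Qubits R n → ZMod 2 :=
  Sum.elim 0 (fun q => if F q.1.1 ∧ q.2 = y then 1 else 0)

lemma fst_mem_star_iff {p : Tri L M} :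
    p.fst ∈ star s ↔ p ∈ ({p3 s, p4 s, p5 s, p6 s} : Finset (Tri L M)) := by
  obtain ⟨v, b⟩ := p
  cases b <;> simp [star, Tri.fst, p3, p4, p5, p6, e1, e2, e3, e4, e5, e6, or_comm]

lemma snd_mem_star_iff {p : Tri L M} :
    p.snd ∈ star s ↔ p ∈ ({p1 s, p2 s, p3 s, p6 s} : Finset (Tri L M)) := by
  obtain ⟨v, b⟩ := p
  cases b <;> simp [star, Tri.snd, p1, p2, p3, p6, e1, e2, e3, e4, e5, e6, eq_sub_iff_add_eq,
    add_assoc]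

lemma encode_flipVec_inl (t : Z2 n) (e : {e // e ∈ R.edges}) (τ : Fin n) :
    encode R (flipVec R s t) (Sum.inl (e, τ)) = if e.1 ∈ star s then t τ else 0 := by
  change (flipVec R s t) e τ = _
  rw [flipVec]
  split_ifs <;> rfl

lemma encode_flipVec_inr (t : Z2 n) (p : {p // p ∈ R.tris}) (y : LayerPair n) :
    encode R (flipVec R s t) (Sum.inr (p, y)) = (if p.1.fst ∈ star s then t y.1.1 else 0)
      + if p.1.snd ∈ star s then t y.1.2 else 0 := by
  change (flipVec R s t).at p.1.fst y.1.1 + (flipVec R s t).at p.1.snd y.1.2 = _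
  rw [Config.at_mem _ (R.fst_mem p.2), Config.at_mem _ (R.snd_mem p.2)]
  simp only [flipVec]
  congr 1 <;> split_ifs <;> rfl

variable [Nontrivial (ZMod L)] [Nontrivial (ZMod M)]

lemma starX_eq (hs : s ∈ R.verts) (σ : Fin n) : starX R s σ = shiftX (edgeIndicator R s σ) := by
  obtain ⟨⟨h1, h2, h3, h4, h5, h6⟩, -⟩ := R.edge_mem hs
  rw [starX, edgeX_eq h1, edgeX_eq h2, edgeX_eq h3, edgeX_eq h4, edgeX_eq h5, edgeX_eq h6]
  simp only [shiftX_mul]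
  congr 1
  funext q
  rcases q with ⟨⟨e, he⟩, τ⟩ | q
  · have := sum_star s fun e' => if e = e' ∧ τ = σ then (1 : ZMod 2) else 0
    simp only [Pi.add_apply, Pi.single_apply, Sum.inl.injEq, Prod.mk.injEq, Subtype.mk.injEq]
    rw [← this, edgeIndicator, Sum.elim_inl]
    by_cases hτ : τ = σ <;> simp [hτ]
  · simp [edgeIndicator]

lemma ancXfst_eq (hs : s ∈ R.verts) (y : LayerPair n) :
    ancXfst R s y = shiftX (ancIndicator R (fun p => p.fst ∈ star s) y) := by
  obtain ⟨h1, h2, h3, h4, h5, h6⟩ := R.tri_mem hs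
  rw [ancXfst, ancX_eq h3, ancX_eq h4, ancX_eq h5, ancX_eq h6]
  simp only [shiftX_mul]
  congr 1
  funext q
  rcases q with q | ⟨⟨p, hp⟩, y'⟩
  · simp [ancIndicator]
  · have : ∑ p' ∈ ({p3 s, p4 s, p5 s, p6 s} : Finset (Tri L M)),
        (if p = p' ∧ y' = y then (1 : ZMod 2) else 0) = (if p = p3 s ∧ y' = y then 1 else 0)
        + (if p = p4 s ∧ y' = y then 1 else 0) + (if p = p5 s ∧ y' = y then 1 else 0)
        + (if p = p6 s ∧ y' = y then 1 else 0) := by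
      rw [Finset.sum_insert, Finset.sum_insert, Finset.sum_insert, Finset.sum_singleton]
      · simp only [add_assoc]
      all_goals simp [p3, p4, p5, p6, Prod.ext_iff, eq_sub_iff_add_eq]
    simp only [Pi.add_apply, Pi.single_apply, Sum.inr.injEq, Prod.mk.injEq, Subtype.mk.injEq]
    rw [← this, ancIndicator, Sum.elim_inr]
    simp only [fst_mem_star_iff]
    by_cases hy : y' = y <;> simp [hy]

lemma ancXsnd_eq (hs : s ∈ R.verts) (y : LayerPair n) :
    ancXsnd R s y = shiftX (ancIndicator R (fun p => p.snd ∈ star s) y) := by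
  obtain ⟨h1, h2, h3, h4, h5, h6⟩ := R.tri_mem hs
  rw [ancXsnd, ancX_eq h1, ancX_eq h2, ancX_eq h3, ancX_eq h6]
  simp only [shiftX_mul]
  congr 1
  funext q
  rcases q with q | ⟨⟨p, hp⟩, y'⟩
  · simp [ancIndicator]
  · have : ∑ p' ∈ ({p1 s, p2 s, p3 s, p6 s} : Finset (Tri L M)),
        (if p = p' ∧ y' = y then (1 : ZMod 2) else 0) = (if p = p1 s ∧ y' = y then 1 else 0)
        + (if p = p2 s ∧ y' = y then 1 else 0) + (if p = p3 s ∧ y' = y then 1 else 0)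
        + (if p = p6 s ∧ y' = y then 1 else 0) := by
      rw [Finset.sum_insert, Finset.sum_insert, Finset.sum_insert, Finset.sum_singleton]
      · simp only [add_assoc]
      all_goals simp [p1, p2, p3, p6, Prod.ext_iff, eq_sub_iff_add_eq]
    simp only [Pi.add_apply, Pi.single_apply, Sum.inr.injEq, Prod.mk.injEq, Subtype.mk.injEq]
    rw [← this, ancIndicator, Sum.elim_inr]
    simp only [snd_mem_star_iff]
    by_cases hy : y' = y <;> simp [hy]

end Explicit

section Semion

variable {L M : ℕ} {R : Patch L M} {s : Vert L M}
lemma isEmpty_layerPair_one : IsEmpty (LayerPair 1) :=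
  ⟨fun y => by
    have := y.2
    rw [Subsingleton.elim y.1.1 y.1.2] at this
    exact lt_irrefl _ this⟩

lemma edgeIndicator_eq_encode : edgeIndicator R s (0 : Fin 1)
    = encode R (flipVec R s (Pi.single 0 1)) := by
  funext q
  rcases q with ⟨e, τ⟩ | ⟨p, y⟩
  · rw [encode_flipVec_inl, Subsingleton.elim τ 0]
    simp [edgeIndicator]
  · exact isEmpty_layerPair_one.elim y

lemma encode_edge {n : ℕ} (x : Config R n) {e : Edge L M} (he : e ∈ R.edges) (σ : Fin n) :
    encode R x (Sum.inl (⟨e, he⟩, σ)) = x.at e σ := (congrFun (x.at_mem he) σ).symm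

lemma allS_eq : (allS : Op (Qubits R 1)) = diagOp fun z => ∏ q, iPow (z q) := rfl

lemma prod_qubits_one {f : Qubits R 1 → Circle} (hs : s ∈ R.verts)
    (hf : ∀ e : {e // e ∈ R.edges}, e.1 ∉ star s → f (Sum.inl (e, 0)) = 1) :
    ∏ q, f q = ∏ e ∈ star s, if he : e ∈ R.edges then f (Sum.inl (⟨e, he⟩, 0)) else 1 := by
  obtain ⟨⟨h1, h2, h3, h4, h5, h6⟩, -⟩ := R.edge_mem hs
  have hsub : star s ⊆ R.edges := by
    intro e he
    simp only [star, Finset.mem_insert, Finset.mem_singleton] at he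
    rcases he with rfl | rfl | rfl | rfl | rfl | rfl <;> assumption
  have : IsEmpty ({p // p ∈ R.tris} × LayerPair 1) := ⟨fun q => isEmpty_layerPair_one.elim q.2⟩
  rw [Fintype.prod_sum_type, Fintype.prod_empty fun q => f (Sum.inr q), mul_one, Fintype.prod_prod_type,
    Finset.prod_subset hsub fun e he hes => ?_, ← Finset.prod_coe_sort R.edges]
  · refine Finset.prod_congr rfl fun e _ => ?_
    rw [dif_pos e.2]
    simp
  · rw [dif_pos he]
    exact hf ⟨e, he⟩ hes

variable [Nontrivial (ZMod L)] [Nontrivial (ZMod M)]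

lemma triadditive_semion :
    Triadditive fun a b c : Z2 1 => a 0 * b 0 * c 0 := by
  constructor <;> intros <;> simp only [Pi.add_apply] <;> ring

lemma semion_phase (x1 x2 x3 x4 x5 x6 : ZMod 2) :
    sgn x1 * sgn x2 * sgn x3 * sgn x4 * sgn x5 * sgn x6 * iPow (x1 + x2) * iPow (x3 + x2)
      * iPow (x3 + x4) * iPow (x4 + x5) * iPow (x6 + x5) * iPow (x1 + x6) =
    sgn (x4 * (x4 + x5) + (x3 + 1) * x4 + (x3 + x2) * (x3 + 1) + (x6 * (x6 + x5) + (x1 + 1) * x6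
      + (x1 + x2) * (x1 + 1))) := by
  have h : ∀ a : ZMod 2, sgn a * (iPow a * iPow a) = 1 := fun a => by
    rw [iPow_mul_self, sgn_mul_self]
  calc _ = (sgn x1 * (iPow x1 * iPow x1)) * (sgn x2 * (iPow x2 * iPow x2))
        * (sgn x3 * (iPow x3 * iPow x3)) * (sgn x4 * (iPow x4 * iPow x4))
        * (sgn x5 * (iPow x5 * iPow x5)) * (sgn x6 * (iPow x6 * iPow x6))
        * (sgn (x1 * x2) * sgn (x3 * x2) * sgn (x3 * x4) * sgn (x4 * x5) * sgn (x6 * x5)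
        * sgn (x1 * x6)) := by
        simp only [iPow_add]
        apply Additive.ofMul.injective
        simp only [ofMul_mul]
        abel
    _ = _ := by
        simp only [h, one_mul, ← sgn_add]
        congr 1
        have q : ∀ a : ZMod 2, a * a = a := by decide
        have q1 := q x1
        have q3 := q x3
        have q4 := q x4
        have q6 := q x6
        grind

lemma semionStabilizer_eq (hs : s ∈ R.verts) : semionStabilizer R s 0 =
    shiftX (encode R (flipVec R s (Pi.single 0 1))) *
      (edgeZ R (e1 s) 0 * edgeZ R (e2 s) 0 * edgeZ R (e3 s) 0 * edgeZ R (e4 s) 0 *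
        edgeZ R (e5 s) 0 * edgeZ R (e6 s) 0 * edgeS R (e7 s) 0 * edgeS R (e8 s) 0 *
        edgeS R (e9 s) 0 * edgeS R (e10 s) 0 * edgeS R (e11 s) 0 * edgeS R (e12 s) 0) := by
  rw [← edgeIndicator_eq_encode, ← starX_eq hs]
  simp only [semionStabilizer, starX, mul_assoc]

/-- The semion stabilizers describe the model with `ω(a,b,c) = (-1)^(abc)`. -/
lemma semion_describes (R : Patch L M) : Describes R omegaSemion (semionStabilizer R) := by
  refine describes_of_coincide triadditive_semion (fun s hs σ => ?_) fun s hs σ ψ hψ => ?_ <;>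
    obtain rfl : σ = 0 := Subsingleton.elim _ _ <;> rw [semionStabilizer_eq hs]
  · refine mul_mem (shiftX_encode_mem _) ?_
    refine mul_mem (mul_mem (mul_mem (mul_mem (mul_mem (mul_mem (mul_mem (mul_mem (mul_mem
      (mul_mem (mul_mem (edgeZ_mem_near ?_ 0) (edgeZ_mem_near ?_ 0)) (edgeZ_mem_near ?_ 0))
      (edgeZ_mem_near ?_ 0)) (edgeZ_mem_near ?_ 0)) (edgeZ_mem_near ?_ 0)) (edgeS_mem ?_ 0))
      (edgeS_mem ?_ 0)) (edgeS_mem ?_ 0)) (edgeS_mem ?_ 0)) (edgeS_mem ?_ 0)) (edgeS_mem ?_ 0) <;>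
      simp [star, link]
  · obtain ⟨⟨h1, h2, h3, h4, h5, h6⟩, h7, h8, h9, h10, h11, h12⟩ := R.edge_mem hs
    rw [edgeZ_eq h1, edgeZ_eq h2, edgeZ_eq h3, edgeZ_eq h4, edgeZ_eq h5, edgeZ_eq h6, edgeS_eq h7,
      edgeS_eq h8, edgeS_eq h9, edgeS_eq h10, edgeS_eq h11, edgeS_eq h12]
    simp only [diagOp_mul]
    refine shiftX_mul_diagOp_couple (fun x hx => ?_) hψ
    obtain ⟨f7, f8, f10, f11, f9, f12⟩ := hx.star hs
    rw [phase_sgn]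
    simp only [Pi.mul_apply, encode_edge, phaseExp, f7, f8, f9, f10, f11, f12, Pi.add_apply,
      Pi.single_eq_same, one_mul, mul_one]
    exact semion_phase _ _ _ _ _ _

lemma iPow_add_one_div (a : ZMod 2) : iPow (a + 1) / iPow a = iPow 1 * sgn a := by
  rw [iPow_add, mul_one, mul_assoc, mul_div_cancel_left]

lemma iPow_one_pow_six : iPow 1 * iPow 1 * (iPow 1 * iPow 1) * (iPow 1 * iPow 1) = -1 := by
  rw [iPow_one_mul_self]
  ext
  simp

lemma prod_iPow_add (hs : s ∈ R.verts) (h1 : e1 s ∈ R.edges) (h2 : e2 s ∈ R.edges)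
    (h3 : e3 s ∈ R.edges) (h4 : e4 s ∈ R.edges) (h5 : e5 s ∈ R.edges) (h6 : e6 s ∈ R.edges)
    (z : Qubits R 1 → ZMod 2) :
    ∏ q, iPow (z q + encode R (flipVec R s (Pi.single 0 1)) q) =
      -1 * (sgn (z (Sum.inl (⟨e1 s, h1⟩, 0))) * sgn (z (Sum.inl (⟨e2 s, h2⟩, 0))) *
        sgn (z (Sum.inl (⟨e3 s, h3⟩, 0))) * sgn (z (Sum.inl (⟨e4 s, h4⟩, 0))) *
        sgn (z (Sum.inl (⟨e5 s, h5⟩, 0))) * sgn (z (Sum.inl (⟨e6 s, h6⟩, 0)))) *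
        ∏ q, iPow (z q) := by
  rw [← div_eq_iff_eq_mul, ← Finset.prod_div_distrib, prod_qubits_one hs, prod_star]
  · have k1 : e1 s ∈ star s := by simp [star]
    have k2 : e2 s ∈ star s := by simp [star]
    have k3 : e3 s ∈ star s := by simp [star]
    have k4 : e4 s ∈ star s := by simp [star]
    have k5 : e5 s ∈ star s := by simp [star]
    have k6 : e6 s ∈ star s := by simp [star]
    simp only [dif_pos h1, dif_pos h2, dif_pos h3, dif_pos h4, dif_pos h5, dif_pos h6,
      encode_flipVec_inl, k1, k2, k3, k4, k5, k6, if_true, Pi.single_eq_same, iPow_add_one_div]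
    rw [← iPow_one_pow_six]
    apply Additive.ofMul.injective
    simp only [ofMul_mul]
    abel
  · intro e he
    rw [encode_flipVec_inl, if_neg he, add_zero, div_self']

lemma alphaOp_pow_four {Q : Type*} : (alphaOp : Op Q) ^ 4 = diagOp fun _ => -1 := by
  rw [show (alphaOp : Op Q) = diagOp fun _ => Circle.exp (Real.pi / 4) from rfl, diagOp_pow]
  congr 1
  funext z
  ext
  rw [Pi.pow_apply, Circle.coe_pow, Circle.coe_exp, ← Complex.exp_nat_mul]
  have : ((4 : ℕ) : ℂ) * (((Real.pi / 4 : ℝ) : ℂ) * Complex.I) = Real.pi * Complex.I := by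
    push_cast
    ring
  rw [this, Complex.exp_pi_mul_I]
  simp

lemma allS_mul_semionStabilizer (hs : s ∈ R.verts) :
    alphaOp ^ 4 *
        (edgeX R (e1 s) 0 * edgeX R (e2 s) 0 * edgeX R (e3 s) 0 *
         edgeX R (e4 s) 0 * edgeX R (e5 s) 0 * edgeX R (e6 s) 0 *
         edgeS R (e7 s) 0 * edgeS R (e8 s) 0 * edgeS R (e9 s) 0 *
         edgeS R (e10 s) 0 * edgeS R (e11 s) 0 * edgeS R (e12 s) 0) * allS =
      allS * semionStabilizer R s 0 := by
  obtain ⟨⟨h1, h2, h3, h4, h5, h6⟩, h7, h8, h9, h10, h11, h12⟩ := R.edge_mem hs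
  have e : edgeX R (e1 s) (0 : Fin 1) * edgeX R (e2 s) 0 * edgeX R (e3 s) 0 *
         edgeX R (e4 s) 0 * edgeX R (e5 s) 0 * edgeX R (e6 s) 0 *
         edgeS R (e7 s) 0 * edgeS R (e8 s) 0 * edgeS R (e9 s) 0 *
         edgeS R (e10 s) 0 * edgeS R (e11 s) 0 * edgeS R (e12 s) 0 =
      starX R s 0 * (edgeS R (e7 s) 0 * edgeS R (e8 s) 0 * edgeS R (e9 s) 0 *
         edgeS R (e10 s) 0 * edgeS R (e11 s) 0 * edgeS R (e12 s) 0) := by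
    simp only [starX, mul_assoc]
  rw [e, starX_eq hs, edgeIndicator_eq_encode, semionStabilizer_eq hs, allS_eq, alphaOp_pow_four,
    edgeZ_eq h1, edgeZ_eq h2, edgeZ_eq h3, edgeZ_eq h4, edgeZ_eq h5, edgeZ_eq h6, edgeS_eq h7,
    edgeS_eq h8, edgeS_eq h9, edgeS_eq h10, edgeS_eq h11, edgeS_eq h12]
  simp only [diagOp_mul]
  rw [← mul_assoc, ← mul_assoc, diagOp_mul_shiftX, diagOp_mul_shiftX]
  simp only [mul_assoc, diagOp_mul]
  congr 2
  funext z
  simp only [Pi.mul_apply, Pi.add_apply, prod_iPow_add hs h1 h2 h3 h4 h5 h6]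
  have hz : ∀ q, Additive.ofMul (sgn (z q)) + Additive.ofMul (sgn (z q)) = 0 :=
    fun q => congrArg Additive.ofMul (sgn_mul_self _)
  apply Additive.ofMul.injective
  simp only [ofMul_mul]
  linear_combination (norm := abel) - hz (Sum.inl (⟨e1 s, h1⟩, 0)) - hz (Sum.inl (⟨e2 s, h2⟩, 0))
    - hz (Sum.inl (⟨e3 s, h3⟩, 0)) - hz (Sum.inl (⟨e4 s, h4⟩, 0)) - hz (Sum.inl (⟨e5 s, h5⟩, 0))
    - hz (Sum.inl (⟨e6 s, h6⟩, 0))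

/-- The unitary `⊗ S` maps the semion code onto the doubled semion ground space. -/
lemma map_allS_code (R : Patch L M) :
    (code (stabilizerGroup R (semionStabilizer R))).map
        (allS : Op (Qubits R 1)).toLinearMap = code (doubledSemionGroup R) := by
  ext χ
  obtain ⟨ψ, rfl⟩ := (allS : Op (Qubits R 1)).surjective χ
  have hmem : allS ψ ∈ (code (stabilizerGroup R (semionStabilizer R))).map
      (allS : Op (Qubits R 1)).toLinearMap ↔ ψ ∈ code (stabilizerGroup R (semionStabilizer R)) := by
    rw [Submodule.mem_map_equiv, LinearEquiv.symm_apply_apply]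
  have conj : ∀ {g g' : Op (Qubits R 1)}, g' * allS = allS * g →
      (g' (allS ψ) = allS ψ ↔ g ψ = ψ) := by
    intro g g' h
    have : g' (allS ψ) = allS (g ψ) := LinearEquiv.congr_fun h ψ
    rw [this, EmbeddingLike.apply_eq_iff_eq]
  have hA : ∀ p ∈ R.tris, (edgeZ R p.fst (0 : Fin 1) * edgeZ R p.snd 0 * edgeZ R p.thd 0) * allS =
      allS * (edgeZ R p.fst 0 * edgeZ R p.snd 0 * edgeZ R p.thd 0) := by
    intro p hp
    rw [edgeZ_eq (R.fst_mem hp), edgeZ_eq (R.snd_mem hp), edgeZ_eq (R.thd_mem hp), allS_eq]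
    simp only [diagOp_mul]
    rw [mul_comm]
  rw [hmem, stabilizerGroup, doubledSemionGroup, mem_code_closure, mem_code_closure]
  constructor
  · rintro h g (⟨p, hp, rfl⟩ | ⟨s, hs, rfl⟩)
    · exact (conj (hA p hp)).2 (h _ (Or.inl (Or.inl ⟨p, hp, 0, rfl⟩)))
    · exact (conj (allS_mul_semionStabilizer hs)).2 (h _ (Or.inr ⟨s, hs, 0, rfl⟩))
  · rintro h g ((⟨p, hp, σ, rfl⟩ | ⟨p, hp, y, rfl⟩) | ⟨s, hs, σ, rfl⟩)
    · obtain rfl : σ = 0 := Subsingleton.elim _ _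
      exact (conj (hA p hp)).1 (h _ (Or.inl ⟨p, hp, rfl⟩))
    · exact isEmpty_layerPair_one.elim y
    · obtain rfl : σ = 0 := Subsingleton.elim _ _
      exact (conj (allS_mul_semionStabilizer hs)).1 (h _ (Or.inr ⟨s, hs, rfl⟩))

end Semion

end TQD

namespace TQD

section Seven

lemma triadditive_seven : Triadditive fun a b c : Z2 3 => a 0 * b 1 * c 2 := by
  constructor <;> intros <;> simp only [Pi.add_apply] <;> ring

lemma layerPair_three (y : LayerPair 3) : y = y1 ∨ y = y2 ∨ y = y3 := by
  revert y
  decide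

variable {L M : ℕ} {R : Patch L M} {s : Vert L M}

lemma encode_flipVec_zero : edgeIndicator R s (0 : Fin 3) +
    ancIndicator R (fun p => p.fst ∈ star s) y1 + ancIndicator R (fun p => p.fst ∈ star s) y2 =
      encode R (flipVec R s (Pi.single 0 1)) := by
  funext q
  rcases q with ⟨e, τ⟩ | ⟨p, y⟩
  · rw [encode_flipVec_inl]
    by_cases h : τ = 0 <;> simp [edgeIndicator, ancIndicator, h]
  · rw [encode_flipVec_inr]
    rcases layerPair_three y with rfl | rfl | rfl <;>
      simp [edgeIndicator, ancIndicator, y1, y2, y3]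

lemma encode_flipVec_one : edgeIndicator R s (1 : Fin 3) +
    ancIndicator R (fun p => p.snd ∈ star s) y1 + ancIndicator R (fun p => p.fst ∈ star s) y3 =
      encode R (flipVec R s (Pi.single 1 1)) := by
  funext q
  rcases q with ⟨e, τ⟩ | ⟨p, y⟩
  · rw [encode_flipVec_inl]
    by_cases h : τ = 1 <;> simp [edgeIndicator, ancIndicator, h]
  · rw [encode_flipVec_inr]
    rcases layerPair_three y with rfl | rfl | rfl <;>
      simp [edgeIndicator, ancIndicator, y1, y2, y3]

lemma encode_flipVec_two : edgeIndicator R s (2 : Fin 3) +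
    ancIndicator R (fun p => p.snd ∈ star s) y2 + ancIndicator R (fun p => p.snd ∈ star s) y3 =
      encode R (flipVec R s (Pi.single 2 1)) := by
  funext q
  rcases q with ⟨e, τ⟩ | ⟨p, y⟩
  · rw [encode_flipVec_inl]
    by_cases h : τ = 2 <;> simp [edgeIndicator, ancIndicator, h]
  · rw [encode_flipVec_inr]
    rcases layerPair_three y with rfl | rfl | rfl <;>
      simp [edgeIndicator, ancIndicator, y1, y2, y3]

/-- The diagonal parts of the vertex stabilizers of the `ω₇` model. -/
noncomputable def sevenDiagonal (R : Patch L M) (s : Vert L M) : Fin 3 → Op (Qubits R 3) :=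
  ![edgeS R (e4 s) 1 ^ 3 * edgeS R (e10 s) 2 ^ 3 * edgeS R (e6 s) 1 ^ 3 *
      edgeS R (e11 s) 2 ^ 3 * ancS R (p4 s) y3 * ancS R (p5 s) y3,
    edgeS R (e1 s) 0 ^ 3 * edgeS R (e3 s) 0 ^ 3 * edgeS R (e4 s) 2 ^ 3 *
      edgeS R (e6 s) 2 ^ 3 * ancS R (p3 s) y2 * ancS R (p6 s) y2,
    edgeS R (e1 s) 1 ^ 3 * edgeS R (e3 s) 1 ^ 3 * edgeS R (e7 s) 0 ^ 3 *
      edgeS R (e8 s) 0 ^ 3 * ancS R (p1 s) y1 * ancS R (p2 s) y1]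

lemma encode_anc {n : ℕ} (x : Config R n) {p : Tri L M} (hp : p ∈ R.tris) (y : LayerPair n) :
    encode R x (Sum.inr (⟨p, hp⟩, y)) = x.at p.fst y.1.1 + x.at p.snd y.1.2 := rfl

lemma two_controlled_signs (a b c d : ZMod 2) :
    iPow a ^ 3 * iPow b ^ 3 * iPow c ^ 3 * iPow d ^ 3 * iPow (a + b) * iPow (c + d) =
      sgn (a * b + c * d) := by
  rw [sgn_add, ← iPow_cube_mul a b, ← iPow_cube_mul c d]
  apply Additive.ofMul.injective
  simp only [ofMul_mul]
  abel

variable [Nontrivial (ZMod L)] [Nontrivial (ZMod M)]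

lemma sevenStabilizer_eq (hs : s ∈ R.verts) (σ : Fin 3) : sevenStabilizer R s σ =
    shiftX (encode R (flipVec R s (Pi.single σ 1))) * sevenDiagonal R s σ := by
  fin_cases σ
  · change _ = shiftX (encode R (flipVec R s (Pi.single 0 1))) * _
    rw [← encode_flipVec_zero, ← shiftX_mul, ← shiftX_mul, ← starX_eq hs, ← ancXfst_eq hs,
      ← ancXfst_eq hs]
    simp [sevenStabilizer, sevenDiagonal, mul_assoc]
  · change _ = shiftX (encode R (flipVec R s (Pi.single 1 1))) * _
    rw [← encode_flipVec_one, ← shiftX_mul, ← shiftX_mul, ← starX_eq hs, ← ancXfst_eq hs,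
      ← ancXsnd_eq hs]
    simp [sevenStabilizer, sevenDiagonal, mul_assoc]
  · change _ = shiftX (encode R (flipVec R s (Pi.single 2 1))) * _
    rw [← encode_flipVec_two, ← shiftX_mul, ← shiftX_mul, ← starX_eq hs, ← ancXsnd_eq hs,
      ← ancXsnd_eq hs]
    simp [sevenStabilizer, sevenDiagonal, mul_assoc]

/-- The `ω₇` stabilizers describe the model with `ω(a,b,c) = (-1)^(a₁b₂c₃)`. -/
lemma seven_describes (R : Patch L M) : Describes R omegaSeven (sevenStabilizer R) := by
  refine describes_of_coincide triadditive_seven (fun s hs σ => ?_) fun s hs σ ψ hψ => ?_ <;>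
    rw [sevenStabilizer_eq hs]
  · refine mul_mem (shiftX_encode_mem _) ?_
    fin_cases σ <;>
    refine mul_mem (mul_mem (mul_mem (mul_mem (mul_mem (pow_mem (edgeS_mem ?_ _) 3)
      (pow_mem (edgeS_mem ?_ _) 3)) (pow_mem (edgeS_mem ?_ _) 3)) (pow_mem (edgeS_mem ?_ _) 3))
      (ancS_mem ?_ _)) (ancS_mem ?_ _) <;> simp [star, link, starTris]
  · obtain ⟨⟨h1, h2, h3, h4, h5, h6⟩, h7, h8, h9, h10, h11, h12⟩ := R.edge_mem hs
    obtain ⟨t1, t2, t3, t4, t5, t6⟩ := R.tri_mem hs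
    obtain rfl | rfl | rfl : σ = 0 ∨ σ = 1 ∨ σ = 2 := by fin_cases σ <;> simp
    · rw [show sevenDiagonal R s 0 = edgeS R (e4 s) 1 ^ 3 * edgeS R (e10 s) 2 ^ 3 *
        edgeS R (e6 s) 1 ^ 3 * edgeS R (e11 s) 2 ^ 3 * ancS R (p4 s) y3 * ancS R (p5 s) y3 from rfl,
        edgeS_eq h4, edgeS_eq h10, edgeS_eq h6, edgeS_eq h11, ancS_eq t4, ancS_eq t5]
      simp only [diagOp_pow, diagOp_mul]
      refine shiftX_mul_diagOp_couple (fun x hx => ?_) hψ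
      rw [phase_sgn]
      simp only [Pi.mul_apply, Pi.pow_apply, encode_edge, encode_anc, p4_fst, p4_snd, p5_fst,
        p5_snd, y3, two_controlled_signs]
      simp [phaseExp]
    · rw [show sevenDiagonal R s 1 = edgeS R (e1 s) 0 ^ 3 * edgeS R (e3 s) 0 ^ 3 *
        edgeS R (e4 s) 2 ^ 3 * edgeS R (e6 s) 2 ^ 3 * ancS R (p3 s) y2 * ancS R (p6 s) y2 from rfl,
        edgeS_eq h4, edgeS_eq h1, edgeS_eq h6, edgeS_eq h3, ancS_eq t3, ancS_eq t6]
      simp only [diagOp_pow, diagOp_mul]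
      refine shiftX_mul_diagOp_couple (fun x hx => ?_) hψ
      rw [phase_sgn]
      simp only [Pi.mul_apply, Pi.pow_apply, encode_edge, encode_anc, p3_fst, p3_snd, p6_fst,
        p6_snd, y2]
      have e : phaseExp (fun a b c : Z2 3 => a 0 * b 1 * c 2) s (Pi.single 1 1) x =
          x.at (e3 s) 0 * x.at (e4 s) 2 + x.at (e1 s) 0 * x.at (e6 s) 2 := by
        simp [phaseExp]
      rw [e, ← two_controlled_signs]
      apply Additive.ofMul.injective
      simp only [ofMul_mul]
      abel
    · rw [show sevenDiagonal R s 2 = edgeS R (e1 s) 1 ^ 3 * edgeS R (e3 s) 1 ^ 3 *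
        edgeS R (e7 s) 0 ^ 3 * edgeS R (e8 s) 0 ^ 3 * ancS R (p1 s) y1 * ancS R (p2 s) y1 from rfl,
        edgeS_eq h1, edgeS_eq h3, edgeS_eq h7, edgeS_eq h8, ancS_eq t1, ancS_eq t2]
      simp only [diagOp_pow, diagOp_mul]
      refine shiftX_mul_diagOp_couple (fun x hx => ?_) hψ
      rw [phase_sgn]
      simp only [Pi.mul_apply, Pi.pow_apply, encode_edge, encode_anc, p1_fst, p1_snd, p2_fst,
        p2_snd, y1]
      have e : phaseExp (fun a b c : Z2 3 => a 0 * b 1 * c 2) s (Pi.single 2 1) x =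
          x.at (e8 s) 0 * x.at (e3 s) 1 + x.at (e7 s) 0 * x.at (e1 s) 1 := by
        simp [phaseExp]
      rw [e, ← two_controlled_signs]
      apply Additive.ofMul.injective
      simp only [ofMul_mul]
      abel

end Seven

end TQD

namespace TQD

section NonAbelian

lemma slant_omegaSeven (x y : Z2 3) : slant omegaSeven (Pi.single 0 1) x y = sgn (x 1 * y 2) := by
  simp [slant, omegaSeven]

/-- The Pauli matrices as a projective representation of `ℤ₂³`. -/
noncomputable def pauliRep (g x : Z2 3) : Matrix (Fin 2) (Fin 2) ℂ :=
  if g = Pi.single 0 1 then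
    (if x 2 = 0 then 1 else !![0, 1; 1, 0]) * (if x 1 = 0 then 1 else !![1, 0; 0, -1])
  else 0

lemma pauliRep_isDoubleRep : IsDoubleRep omegaSeven pauliRep := by
  constructor
  · intro g h x y
    by_cases hg : g = Pi.single 0 1
    · by_cases hh : h = Pi.single 0 1
      · subst hg hh
        rw [if_pos rfl, slant_omegaSeven]
        simp only [pauliRep, if_true, Pi.add_apply]
        have two : (1 : ZMod 2) + 1 = 0 := by decide
        have cases2 : ∀ a : ZMod 2, a = 0 ∨ a = 1 := by decide
        rcases cases2 (x 1) with h1 | h1 <;> rcases cases2 (x 2) with h2 | h2 <;>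
          rcases cases2 (y 1) with h3 | h3 <;> rcases cases2 (y 2) with h4 | h4 <;>
          simp [h1, h2, h3, h4, two, Matrix.one_fin_two]
      · rw [if_neg (fun e : g = h => hh (e ▸ hg))]
        simp [pauliRep, hh]
    · have : ∀ x, pauliRep g x = 0 := fun x => if_neg hg
      simp [this]
  · rw [Finset.sum_eq_single (Pi.single 0 1)]
    · simp [pauliRep]
    · intro g _ hg
      exact if_neg hg
    · simp

/-- The model with `ω₇` supports non-Abelian anyons. -/
lemma supportsNonAbelianAnyons_omegaSeven : SupportsNonAbelianAnyons omegaSeven := by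
  refine ⟨2, one_lt_two, pauliRep, pauliRep_isDoubleRep, fun W hW => ?_⟩
  have hZ : ∀ v ∈ W, ![v 0, - v 1] ∈ W := by
    intro v hv
    have e : (pauliRep (Pi.single 0 1) (Pi.single 1 1)).mulVec v = ![v 0, - v 1] := by
      funext i
      fin_cases i <;> simp [pauliRep, Matrix.mulVec, dotProduct]
    exact e ▸ hW _ _ v hv
  have hX : ∀ v ∈ W, ![v 1, v 0] ∈ W := by
    intro v hv
    have e : (pauliRep (Pi.single 0 1) (Pi.single 2 1)).mulVec v = ![v 1, v 0] := by
      funext i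
      fin_cases i <;> simp [pauliRep, Matrix.mulVec, dotProduct]
    exact e ▸ hW _ _ v hv
  rw [or_iff_not_imp_left, Submodule.eq_bot_iff]
  intro h
  push Not at h
  obtain ⟨v, hv, hv0⟩ := h
  have h0 : ∃ w ∈ W, w 0 ≠ 0 := by
    by_cases h : v 0 = 0
    · refine ⟨_, hX v hv, fun h1 => hv0 ?_⟩
      funext i
      fin_cases i
      · exact h
      · simpa using h1
    · exact ⟨v, hv, h⟩
  obtain ⟨w, hw, hw0⟩ := h0
  have b0 : ![1, 0] ∈ W := by
    have := W.smul_mem (2 * w 0)⁻¹ (W.add_mem hw (hZ w hw))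
    convert this using 1
    funext i
    fin_cases i
    · change (1 : ℂ) = (2 * w 0)⁻¹ * (w 0 + w 0)
      field_simp
      norm_num
    · change (0 : ℂ) = (2 * w 0)⁻¹ * (w 1 + -w 1)
      simp
  have b1 : ![0, 1] ∈ W := by simpa using hX _ b0
  rw [eq_top_iff]
  intro u _
  have := W.add_mem (W.smul_mem (u 0) b0) (W.smul_mem (u 1) b1)
  convert this using 1
  funext i
  fin_cases i <;> simp

end NonAbelian

section Regularity

variable {Q : Type*}

lemma diagOp_injective : Function.Injective (diagOp (Q := Q)) := by
  intro φ φ' h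
  funext z
  have := congrFun (LinearEquiv.congr_fun h fun _ => 1) z
  rw [diagOp_apply, diagOp_apply, mul_one, mul_one] at this
  exact Circle.ext this

lemma shiftX_mul_self (v : Q → ZMod 2) : shiftX v * shiftX v = 1 := by
  rw [shiftX_mul, ← shiftX_zero]
  congr 1
  funext q
  exact CharTwo.add_self_eq_zero _

lemma shiftX_inv (v : Q → ZMod 2) : (shiftX v)⁻¹ = shiftX v :=
  inv_eq_of_mul_eq_one_right (shiftX_mul_self v)

lemma alphaOp_sq : (alphaOp : Op Q) ^ 2 = diagOp fun _ => iPow 1 := by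
  rw [show (alphaOp : Op Q) = diagOp fun _ => Circle.exp (Real.pi / 4) from rfl, diagOp_pow]
  congr 1
  funext z
  rw [Pi.pow_apply, pow_two, ← Circle.exp_add, iPow, if_neg one_ne_zero]
  congr 1
  ring

variable [DecidableEq Q]

lemma alphaOp_mem_diagonalOps : (alphaOp : Op Q) ∈ diagonalOps Q :=
  Subgroup.subset_closure (Or.inl rfl)

lemma opS_mem_diagonalOps (q : Q) : opS q ∈ diagonalOps Q :=
  Subgroup.subset_closure (Or.inr ⟨q, rfl⟩)

lemma conj_mem_diagonalOps (v : Q → ZMod 2) {g : Op Q} (hg : g ∈ diagonalOps Q) :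
    shiftX v * g * (shiftX v)⁻¹ ∈ diagonalOps Q := by
  induction hg using Subgroup.closure_induction with
  | mem g hg =>
    rw [shiftX_inv]
    rcases hg with rfl | ⟨q, rfl⟩
    · have : (alphaOp : Op Q) * shiftX v = shiftX v * alphaOp := diagOp_mul_shiftX v _
      rw [mul_assoc, this, ← mul_assoc, shiftX_mul_self, one_mul]
      exact alphaOp_mem_diagonalOps
    · rw [mul_assoc, opS_eq, diagOp_mul_shiftX, ← mul_assoc, shiftX_mul_self, one_mul]
      rcases (by decide : ∀ a : ZMod 2, a = 0 ∨ a = 1) (v q) with h | h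
      · simp only [Pi.add_apply, h, add_zero]
        exact opS_mem_diagonalOps q
      · have : (diagOp fun z : Q → ZMod 2 => iPow ((z + v) q)) =
            opS q * alphaOp ^ 2 * opS q ^ 2 := by
          rw [alphaOp_sq, opZ_eq, opS_eq, diagOp_mul, diagOp_mul]
          congr 1
          funext z
          simp only [Pi.add_apply, h, iPow_add, mul_one, Pi.mul_apply]
        rw [this]
        exact mul_mem (mul_mem (opS_mem_diagonalOps q) (pow_mem alphaOp_mem_diagonalOps 2))
          (pow_mem (opS_mem_diagonalOps q) 2)
  | one => simp
  | mul g g' _ _ hg hg' =>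
    rw [← conj_mul]
    exact mul_mem hg hg'
  | inv g _ hg =>
    rw [← conj_inv]
    exact inv_mem hg

/-- `g` flips the qubits where `v` does not vanish, and `k` is the parity of the exponent of `S`
on the qubit `q`. -/
def HasForm (q : Q) (g : Op Q) (v : Q → ZMod 2) (k : ZMod 2) : Prop :=
  ∃ φ : (Q → ZMod 2) → Circle, g = shiftX v * diagOp φ ∧ diagOp φ ∈ diagonalOps Q ∧
    ∀ z, φ (z + Pi.single q 1) ^ 2 = sgn k * φ z ^ 2

lemma HasForm.mul {q : Q} {g g' : Op Q} {v v' : Q → ZMod 2} {k k' : ZMod 2}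
    (h : HasForm q g v k) (h' : HasForm q g' v' k') : HasForm q (g * g') (v + v') (k + k') := by
  obtain ⟨φ, rfl, hφ, e⟩ := h
  obtain ⟨φ', rfl, hφ', e'⟩ := h'
  refine ⟨(fun z => φ (z + v')) * φ', ?_, ?_, fun z => ?_⟩
  · rw [← diagOp_mul, ← shiftX_mul, mul_assoc, mul_assoc, ← mul_assoc (diagOp φ),
      diagOp_mul_shiftX, mul_assoc]
  · rw [← diagOp_mul]
    refine mul_mem ?_ hφ'
    have := conj_mem_diagonalOps v' hφ
    rwa [shiftX_inv, mul_assoc, diagOp_mul_shiftX, ← mul_assoc, shiftX_mul_self, one_mul] at this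
  · have e1 := e (z + v')
    have e2 := e' z
    simp only [Pi.mul_apply, mul_pow, e2, sgn_add, add_right_comm z (Pi.single q 1), e1]
    exact mul_mul_mul_comm _ _ _ _

lemma hasForm_one (q : Q) : HasForm q 1 0 0 :=
  ⟨1, by rw [shiftX_zero, diagOp_one, one_mul], diagOp_one (Q := Q) ▸ one_mem _, by simp⟩

lemma hasForm_shiftX (q : Q) (v : Q → ZMod 2) : HasForm q (shiftX v) v 0 :=
  ⟨1, by rw [diagOp_one, mul_one], diagOp_one (Q := Q) ▸ one_mem _, by simp⟩

lemma hasForm_opS (q q' : Q) : HasForm q (opS q') 0 (if q' = q then 1 else 0) := by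
  refine ⟨fun z => iPow (z q'), by rw [shiftX_zero, one_mul, opS_eq], opS_mem_diagonalOps q',
    fun z => ?_⟩
  simp only [pow_two, iPow_mul_self, Pi.add_apply, sgn_add, Pi.single_apply]
  exact mul_comm _ _

lemma hasForm_opS_pow_three (q q' : Q) : HasForm q (opS q' ^ 3) 0 (if q' = q then 1 else 0) := by
  have := ((hasForm_opS q q').mul (hasForm_opS q q')).mul (hasForm_opS q q')
  rw [pow_succ, pow_two]
  convert this using 1
  · simp
  · rw [CharTwo.add_self_eq_zero, zero_add]

lemma HasForm.list_prod {ι : Type*} {q : Q} {g : ι → Op Q} {v : ι → Q → ZMod 2} {k : ι → ZMod 2}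
    (h : ∀ i, HasForm q (g i) (v i) (k i)) (l : List ι) :
    HasForm q (l.map g).prod (l.map v).sum (l.map k).sum := by
  induction l with
  | nil => exact hasForm_one q
  | cons i l ih => simpa only [List.map_cons, List.prod_cons, List.sum_cons] using (h i).mul ih

/-- Elements of `⟨α I, Z⟩` have even exponents of `S`. -/
lemma exists_of_mem_zOps {g : Op Q} (hg : g ∈ zOps Q) :
    ∃ φ, g = diagOp φ ∧ ∀ z w, φ z ^ 2 = φ w ^ 2 := by
  induction hg using Subgroup.closure_induction with
  | mem g hg =>
    rcases hg with rfl | ⟨q, rfl⟩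
    · exact ⟨_, rfl, fun _ _ => rfl⟩
    · exact ⟨_, opZ_eq q, fun z w => by simp only [pow_two, sgn_mul_self]⟩
  | one => exact ⟨1, diagOp_one.symm, fun _ _ => rfl⟩
  | mul g g' _ _ hg hg' =>
    obtain ⟨φ, rfl, h⟩ := hg
    obtain ⟨φ', rfl, h'⟩ := hg'
    exact ⟨φ * φ', diagOp_mul _ _, fun z w => by
      simp only [Pi.mul_apply, mul_pow, h z w, h' z w]⟩
  | inv g _ hg =>
    obtain ⟨φ, rfl, h⟩ := hg
    exact ⟨φ⁻¹, diagOp_inv _, fun z w => by simp only [Pi.inv_apply, inv_pow, h z w]⟩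

/-- A group which contains a diagonal element with an odd exponent of `S` is not regular. -/
lemma not_isRegularXSGroup_of_hasForm {G : Subgroup (Op Q)} {q : Q} {g : Op Q} (hg : g ∈ G)
    (h : HasForm q g 0 1) : ¬ IsRegularXSGroup G := by
  rintro ⟨-, hreg⟩
  obtain ⟨φ, rfl, hφ, e⟩ := h
  rw [shiftX_zero, one_mul] at hg
  have hz : diagOp φ ∈ G ⊓ zOps Q := hreg ▸ ⟨hg, hφ⟩
  obtain ⟨φ', hφ', e'⟩ := exists_of_mem_zOps hz.2
  obtain rfl := diagOp_injective hφ'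
  have e0 := e 0
  rw [e' _ 0, right_eq_mul, sgn_one] at e0
  exact neg_one_ne_one_circle e0

variable {L M : ℕ} [NeZero L] [NeZero M] [Nontrivial (ZMod L)] [Nontrivial (ZMod M)]

lemma hasForm_sevenStabilizer (s₀ s : Vert L M) :
    HasForm (Sum.inr (⟨p4 s₀, Finset.mem_univ _⟩, y3) : Qubits (torus L M) 3)
      (sevenStabilizer (torus L M) s 0) (encode _ (flipVec (torus L M) s (Pi.single 0 1)))
      (if s = s₀ then 1 else 0) := by
  have hs : s ∈ (torus L M).verts := Finset.mem_univ s
  obtain ⟨⟨h1, h2, h3, h4, h5, h6⟩, h7, h8, h9, h10, h11, h12⟩ := (torus L M).edge_mem hs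
  obtain ⟨t1, t2, t3, t4, t5, t6⟩ := (torus L M).tri_mem hs
  rw [sevenStabilizer_eq hs]
  set q : Qubits (torus L M) 3 := Sum.inr (⟨p4 s₀, Finset.mem_univ _⟩, y3) with hq
  have hS : ∀ {e : Edge L M} (_ : e ∈ (torus L M).edges) (σ : Fin 3),
      HasForm q (edgeS (torus L M) e σ ^ 3) 0 0 := by
    intro e he σ
    rw [edgeS, dif_pos he]
    simpa [hq] using hasForm_opS_pow_three q (Sum.inl (⟨e, he⟩, σ))
  have h4' : HasForm q (ancS (torus L M) (p4 s) y3) 0 (if s = s₀ then 1 else 0) := by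
    rw [ancS, dif_pos t4]
    convert hasForm_opS q (Sum.inr (⟨p4 s, t4⟩, y3)) using 1
    simp [hq, p4]
  have h5' : HasForm q (ancS (torus L M) (p5 s) y3) 0 0 := by
    rw [ancS, dif_pos t5]
    simpa [hq, p4, p5] using hasForm_opS q (Sum.inr (⟨p5 s, t5⟩, y3))
  have := (hasForm_shiftX q (encode _ (flipVec (torus L M) s (Pi.single 0 1)))).mul
    ((((((hS h4 1).mul (hS h10 2)).mul (hS h6 1)).mul (hS h11 2)).mul h4').mul h5')
  simp only [add_zero, zero_add] at this
  exact this

lemma sum_encode_flipVec (t : Z2 3) :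
    ∑ s, encode _ (flipVec (torus L M) s t) = (0 : Qubits (torus L M) 3 → ZMod 2) := by
  have h : ∑ s, flipVec (torus L M) s t = 0 := by
    funext e
    rw [Finset.sum_apply]
    simp only [flipVec, ← edgeDiff_single, edgeDiff, Finset.sum_add_distrib, Pi.single_apply,
      Finset.sum_ite_eq, Finset.mem_univ, if_true, add_self_Z2, Pi.zero_apply]
  have := map_sum (AddMonoidHom.mk' (encode (torus L M)) encode_add) (fun s => flipVec _ s t)
    Finset.univ
  rw [h, map_zero] at this
  exact this.symm

/-- The group generated by the `ω₇` stabilizers on a torus is not regular. -/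
lemma seven_not_regular :
    ¬ IsRegularXSGroup (stabilizerGroup (torus L M) (sevenStabilizer (torus L M))) := by
  refine not_isRegularXSGroup_of_hasForm (q := Sum.inr (⟨p4 0, Finset.mem_univ _⟩, y3))
    (g := (Finset.univ.toList.map fun s => sevenStabilizer (torus L M) s 0).prod) ?_ ?_
  · refine Subgroup.list_prod_mem _ fun g hg => ?_
    obtain ⟨s, -, rfl⟩ := List.mem_map.1 hg
    exact Subgroup.subset_closure (Or.inr ⟨s, Finset.mem_univ s, 0, rfl⟩)
  · have := HasForm.list_prod (hasForm_sevenStabilizer (0 : Vert L M)) Finset.univ.toList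
    rw [Finset.sum_map_toList, Finset.sum_map_toList, sum_encode_flipVec] at this
    simpa using this

end Regularity

end TQD

theorem mainTheorem10 :
    -- the products of the generators are cocycles, and they represent every class in `H³`
    (∀ (n : ℕ) (κ : TQD.TwistData n), TQD.IsCocycle κ.cocycle) ∧
    (∀ (n : ℕ) (ω : TQD.Cochain3 n), TQD.IsCocycle ω →
      ∃ (κ : TQD.TwistData n) (β : TQD.Z2 n → TQD.Z2 n → Circle),
        ω = κ.cocycle * TQD.coboundary β) ∧
    -- XS-stabilizers for the ground spaces of all twisted quantum double models
    (∀ (n : ℕ) (κ : TQD.TwistData n) (L M : ℕ), L ≠ 1 → M ≠ 1 → ∀ R : TQD.Patch L M,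
      ∃ 𝒜 : TQD.Vert L M → Fin n → TQD.Op (TQD.Qubits R n),
        TQD.Describes R κ.cocycle 𝒜 ∧
        ∀ β : TQD.Z2 n → TQD.Z2 n → Circle,
          (TQD.groundSpace (TQD.hamiltonian R (κ.cocycle * TQD.coboundary β))).map
              (TQD.couple R n ∘ₗ (TQD.cochainUnitary R β).toLinearMap) =
            TQD.code (TQD.stabilizerGroup R 𝒜)) ∧
    -- the doubled semion model
    (∀ (L M : ℕ), L ≠ 1 → M ≠ 1 → ∀ R : TQD.Patch L M,
      TQD.Describes R TQD.omegaSemion (TQD.semionStabilizer R) ∧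
      (TQD.code (TQD.stabilizerGroup R (TQD.semionStabilizer R))).map
          (TQD.allS : TQD.Op (TQD.Qubits R 1)).toLinearMap =
        TQD.code (TQD.doubledSemionGroup R)) ∧
    -- the `ω₇` model
    TQD.SupportsNonAbelianAnyons TQD.omegaSeven ∧
    (∀ (L M : ℕ), L ≠ 1 → M ≠ 1 → ∀ R : TQD.Patch L M,
      TQD.Describes R TQD.omegaSeven (TQD.sevenStabilizer R)) ∧
    (∀ (L M : ℕ) [NeZero L] [NeZero M], L ≠ 1 → M ≠ 1 →
      ¬ TQD.IsRegularXSGroup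
        (TQD.stabilizerGroup (TQD.torus L M) (TQD.sevenStabilizer (TQD.torus L M)))) := by
  refine ⟨fun n κ => κ.isCocycle, fun n ω hω => hω.exists_eq_mul_coboundary, ?_, ?_,
    TQD.supportsNonAbelianAnyons_omegaSeven, ?_, ?_⟩
  · intro n κ L M hL hM R
    have := ZMod.nontrivial_iff.2 hL
    have := ZMod.nontrivial_iff.2 hM
    obtain ⟨𝒜, h𝒜⟩ := TQD.exists_describes κ R
    refine ⟨𝒜, h𝒜, fun β => ?_⟩
    rw [← h𝒜.map_groundSpace, κ.cocycle_eq]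
    exact TQD.map_groundSpace_mul_coboundary (TQD.triadditive_trilinear κ.coeff) β
  · intro L M hL hM R
    have := ZMod.nontrivial_iff.2 hL
    have := ZMod.nontrivial_iff.2 hM
    exact ⟨TQD.semion_describes R, TQD.map_allS_code R⟩
  · intro L M hL hM R
    have := ZMod.nontrivial_iff.2 hL
    have := ZMod.nontrivial_iff.2 hM
    exact TQD.seven_describes R
  · intro L M _ _ hL hM
    have := ZMod.nontrivial_iff.2 hL
    have := ZMod.nontrivial_iff.2 hM
    exact TQD.seven_not_regular
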